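/- Consider word RAMs with word length $w\ge 1$ whose unit-cost operations are addition, subtraction and multiplication modulo $2^w$, truncating division, left shift modulo $2^w$, right shift, bitwise AND, OR and XOR, loading of constants, comparison of registers, reading and writing of memory words at computed addresses, and loading an integer $s$ with $\sqrt w\le C s$ and $s\le C\sqrt w$, where $C$ is a constant. For every $C$ there are programs (not depending on $w$ or $n$) and constants $T,R$ depending only on $C$ such that for all $w$, all $n\ge 1$ with $w>\log_2 n$, and every $s$ as above the following holds. Provided that the memory words it occupies can be addressed with $w$ bits, the programs realize, in at most $T$ steps per operation, a data structure that maintains a set $S\subseteq\{1,\dots,n\}$ (the client set), is given $n$ from outside (and the address at which it is stored) in each call, and supports the following operations: * $\mathit{init}$: sets $S=\emptyset$, starting from arbitrary memory contents; * $\mathit{insert}(\ell)$, $\mathit{delete}(\ell)$ for $\ell\in\{1,\dots,n\}$: replace $S$ by $S\cup\{\ell\}$ and $S\setminus\{\ell\}$, respectively; * $\mathit{contains}(\ell)$ for $\ell\in\{1,\dots,n\}$: returns $1$ if $\ell\in S$ and $0$ otherwise; * $\mathit{choice}$: returns an element of $S$ if $S\ne\emptyset$ and $0$ otherwise; * iteration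 over $S$ in constant time per element: $\mathit{reset}$ starts an iteration; $\mathit{next}$ returns an element of $S$ that was not yet enumerated since the last reset, or $0$ if there is none; $\mathit{done}$ returns $1$ if all elements of $S$ have been enumerated since the last reset and $0$ otherwise. These guarantees hold as long as $S$ has not changed since the last reset. In every other case (before the first reset, or after a change of $S$ since the last reset) $\mathit{next}$ still halts within $T$ steps and returns an element of $S$ or $0$, and $\mathit{done}$ still halts within $T$ steps and returns $0$ or $1$. Between operations, the data structure occupies exactly $n+1$ consecutive bits of memory, and the iteration remembers $\lceil\log_2(n+1)\rceil$ additional bits of state; nothing else is remembered, and the operations other than those of the iteration neither read nor change these additional bits. During each operation at most $R$ registers of $w$ bits each, hence $O(w)$ bits, are used in addition, and all memory bits outside the $n+1$ bits of the data structure have their old values when the operation ends. -/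

import Mathlib

namespace WordRAM

/-- The arithmetic, shift and bitwise instructions of the word RAM. -/
inductive BinOp
  | add | sub | mul | div | shl | shr | and | or | xor

/-- Meaning of the binary instructions on `w`-bit words: addition, subtraction, multiplication and
left shift modulo `2 ^ w`, truncating division (with value `0` if the divisor is `0`),
right shift, bitwise Boolean operations. -/
def BinOp.eval {w : ℕ} : BinOp → BitVec w → BitVec w → BitVec w
  | .add, x, y => x + y
  | .sub, x, y => x - y
  | .mul, x, y => x * y
  | .div, x, y => x / y
  | .shl, x, y => x <<< y.toNat
  | .shr, x, y => x >>> y.toNat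
  | .and, x, y => x &&& y
  | .or, x, y => x ||| y
  | .xor, x, y => x ^^^ y

/-- Elementary instructions; natural-number arguments `d a b` are names of registers. -/
inductive Instr
  /-- load the fixed integer `k` (modulo `2 ^ w`) into register `d` -/
  | const (d k : ℕ)
  /-- load the machine's approximation of `√w` into register `d` -/
  | sqrtw (d : ℕ)
  /-- copy register `a` into register `d` -/
  | move (d a : ℕ)
  /-- apply `o` to registers `a` and `b` and put the result into register `d` -/
  | op (o : BinOp) (d a b : ℕ)
  /-- load into register `d` the memory word whose address is in register `a` -/
  | load (d a : ℕ)
  /-- store register `b` into the memory word whose address is in register `a` -/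
  | store (a b : ℕ)

/-- Tests used in branches and loops: comparisons of registers `a` and `b`. -/
inductive Test
  | eq (a b : ℕ)
  | lt (a b : ℕ)

/-- Programs. The word length is not part of a program: the same program runs for every `w`. -/
inductive Prog
  | skip
  | instr (i : Instr)
  | seq (p q : Prog)
  | ite (b : Test) (p q : Prog)
  | loop (b : Test) (p : Prog)

def Instr.registers : Instr → Finset ℕ
  | .const d _ => {d}
  | .sqrtw d => {d}
  | .move d a => {d, a}
  | .op _ d a b => {d, a, b}
  | .load d a => {d, a}
  | .store a b => {a, b}

def Test.registers : Test → Finset ℕ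
  | .eq a b => {a, b}
  | .lt a b => {a, b}

/-- The registers that occur in a program. -/
def Prog.registers : Prog → Finset ℕ
  | .skip => ∅
  | .instr i => i.registers
  | .seq p q => p.registers ∪ q.registers
  | .ite b p q => b.registers ∪ (p.registers ∪ q.registers)
  | .loop b p => b.registers ∪ p.registers

/-- The memory of a RAM with word length `w`: one `w`-bit word for each `w`-bit address. -/
abbrev Mem (w : ℕ) : Type := BitVec w → BitVec w

/-- A configuration: the contents of the registers and of the memory. -/
structure Config (w : ℕ) where
  regs : ℕ → BitVec w
  mem : Mem w

/-- Effect of one instruction; `s` is the machine's approximation of `√w`. -/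
def Instr.exec {w : ℕ} (s : BitVec w) (c : Config w) : Instr → Config w
  | .const d k => { c with regs := Function.update c.regs d (BitVec.ofNat w k) }
  | .sqrtw d => { c with regs := Function.update c.regs d s }
  | .move d a => { c with regs := Function.update c.regs d (c.regs a) }
  | .op o d a b => { c with regs := Function.update c.regs d (o.eval (c.regs a) (c.regs b)) }
  | .load d a => { c with regs := Function.update c.regs d (c.mem (c.regs a)) }
  | .store a b => { c with mem := Function.update c.mem (c.regs a) (c.regs b) }

/-- Test outcome (words are compared as unsigned integers). -/
def Test.eval {w : ℕ} (c : Config w) : Test → Bool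
  | .eq a b => decide ((c.regs a).toNat = (c.regs b).toNat)
  | .lt a b => decide ((c.regs a).toNat < (c.regs b).toNat)

/-- `Exec s p c t c'`: program `p`, started in configuration `c`, halts after exactly `t` steps in
configuration `c'`. Every instruction and every evaluation of a test costs one step. -/
inductive Exec {w : ℕ} (s : BitVec w) : Prog → Config w → ℕ → Config w → Prop
  | skip (c : Config w) : Exec s .skip c 0 c
  | instr (i : Instr) (c : Config w) : Exec s (.instr i) c 1 (i.exec s c)
  | seq {p q : Prog} {c₀ c₁ c₂ : Config w} {t₁ t₂ : ℕ} :
      Exec s p c₀ t₁ c₁ → Exec s q c₁ t₂ c₂ → Exec s (.seq p q) c₀ (t₁ + t₂) c₂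
  | ite_true {b : Test} {p q : Prog} {c₀ c₁ : Config w} {t : ℕ} :
      b.eval c₀ = true → Exec s p c₀ t c₁ → Exec s (.ite b p q) c₀ (t + 1) c₁
  | ite_false {b : Test} {p q : Prog} {c₀ c₁ : Config w} {t : ℕ} :
      b.eval c₀ = false → Exec s q c₀ t c₁ → Exec s (.ite b p q) c₀ (t + 1) c₁
  | loop_true {b : Test} {p : Prog} {c₀ c₁ c₂ : Config w} {t₁ t₂ : ℕ} :
      b.eval c₀ = true → Exec s p c₀ t₁ c₁ → Exec s (.loop b p) c₁ t₂ c₂ →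
      Exec s (.loop b p) c₀ (t₁ + t₂ + 1) c₂
  | loop_false {b : Test} {p : Prog} {c : Config w} :
      b.eval c = false → Exec s (.loop b p) c 1 c

/-- The memory bit with bit address `p`: bit `p % w` (least significant first) of word `p / w`. -/
def Mem.bit {w : ℕ} (M : Mem w) (p : ℕ) : Bool :=
  (M (BitVec.ofNat w (p / w))).getLsbD (p % w)

end WordRAM

namespace ChoiceDict

open WordRAM

/-- The operations of a choice dictionary with iteration. -/
inductive Op
  | init | insert | delete | contains | choice
  | iterReset | iterNext | iterDone

/-- The state of a choice dictionary with iteration as the user sees it: the client set, and the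
set of the elements enumerated so far by the current iteration. The second component is `none` if
no iteration was started since the initialization or the last change of the client set. -/
structure State where
  client : Finset ℕ
  enumerated : Option (Finset ℕ)

/-- The state after the client set has been replaced by `S'`: a current iteration stays
current only if the client set did not really change. -/
def State.setClient (q : State) (S' : Finset ℕ) : State :=
  ⟨S', if S' = q.client then q.enumerated else none⟩

/-- `q.Next x q'`: in state `q` the operation "next" may return `x` and lead to state `q'`.
In a current iteration, it returns an element of the client set not enumerated before,
or `0` if there is none. If the client set was changed since the last reset, it returns
an element of the client set or `0`. -/
def State.Next (q : State) (x : ℕ) (q' : State) : Prop :=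
  match q.enumerated with
  | some E =>
      (x ∈ q.client \ E ∧ q' = ⟨q.client, some (insert x E)⟩) ∨
      (q.client \ E = ∅ ∧ x = 0 ∧ q' = q)
  | none => (x ∈ q.client ∨ x = 0) ∧ q' = q

/-- `q.Done x`: in state `q` the test for completion may return `x`. In a current
iteration it returns `1` if the whole client set has been enumerated and `0` if not. -/
def State.Done (q : State) (x : ℕ) : Prop :=
  match q.enumerated with
  | some E => x = if q.client ⊆ E then 1 else 0
  | none => x = 0 ∨ x = 1

/-- Number of bits of the iteration state, `⌈log₂ (n + 1)⌉`. -/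
abbrev iterBits (n : ℕ) : ℕ := Nat.clog 2 (n + 1)

/-- The `n + 1` bits of a dictionary for universe size `n` stored from word address `base` on. -/
def dictBits {w : ℕ} (n base : ℕ) (M : Mem w) : Fin (n + 1) → Bool :=
  fun j => M.bit (base * w + j)

/-- `Call s p T n base arg M post`: whenever `p` is started with memory contents `M`, with `base`,
`n` and `arg` in registers 0, 1, 2 and with arbitrary values in all other registers, it halts
within `T` steps, the memory bits outside the dictionary have their old values, and
`post M' x y` holds, where `M'` is the new memory contents and `x`, `y` are the final values of
registers 0 and 2. -/
def Call {w : ℕ} (s : BitVec w) (p : Prog) (T n base arg : ℕ) (M : Mem w)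
    (post : Mem w → ℕ → ℕ → Prop) : Prop :=
  ∀ c : Config w, c.mem = M → c.regs 0 = BitVec.ofNat w base → c.regs 1 = BitVec.ofNat w n →
    c.regs 2 = BitVec.ofNat w arg →
    ∃ t ≤ T, ∃ c' : Config w, Exec s p c t c' ∧
      (∀ i < 2 ^ w * w, i < base * w ∨ base * w + (n + 1) ≤ i → c'.mem.bit i = M.bit i) ∧
      post c'.mem (c'.regs 0).toNat (c'.regs 2).toNat

/-- The programs `code` realize, in at most `T` steps per operation, an externally sized choice
dictionary with iteration for universe size `n` in the `n + 1` memory bits from word `base` on.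
`Rep B σ q` says that the dictionary bits `B` and the iteration state `σ` represent `q`;
so nothing besides `B` and `σ` (and the externally stored `n` and `base`) is remembered between
operations. Only the operations of the iteration see `σ`, which is passed to "next" and "done" in
register 2 and returned by "reset" and "next" in register 2. Return values are in register 0. -/
def Realizes (code : Op → Prog) (T : ℕ) {w : ℕ} (s : BitVec w) (n base : ℕ) : Prop :=
  ∃ Rep : (Fin (n + 1) → Bool) → BitVec (iterBits n) → State → Prop,
    (∀ (M : Mem w) (a : ℕ), Call s (code .init) T n base a M
      fun M' _ _ => ∀ σ, Rep (dictBits n base M') σ ⟨∅, none⟩) ∧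
    ∀ (M : Mem w) (σ : BitVec (iterBits n)) (q : State), Rep (dictBits n base M) σ q →
      (∀ ℓ ∈ Finset.Icc 1 n,
        Call s (code .insert) T n base ℓ M
          (fun M' _ _ => Rep (dictBits n base M') σ (q.setClient (insert ℓ q.client))) ∧
        Call s (code .delete) T n base ℓ M
          (fun M' _ _ => Rep (dictBits n base M') σ (q.setClient (q.client.erase ℓ))) ∧
        Call s (code .contains) T n base ℓ M
          (fun M' x _ => x = (if ℓ ∈ q.client then 1 else 0) ∧ Rep (dictBits n base M') σ q)) ∧
      (∀ a : ℕ,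
        Call s (code .choice) T n base a M
          (fun M' x _ => (x ∈ q.client ∨ (q.client = ∅ ∧ x = 0)) ∧
            Rep (dictBits n base M') σ q) ∧
        Call s (code .iterReset) T n base a M
          (fun M' _ y => ∃ σ' : BitVec (iterBits n), y = σ'.toNat ∧
            Rep (dictBits n base M') σ' ⟨q.client, some ∅⟩)) ∧
      Call s (code .iterNext) T n base σ.toNat M
        (fun M' x y => ∃ σ' : BitVec (iterBits n), y = σ'.toNat ∧
          ∃ q' : State, q.Next x q' ∧ Rep (dictBits n base M') σ' q') ∧
      Call s (code .iterDone) T n base σ.toNat M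
        (fun M' x _ => q.Done x ∧ Rep (dictBits n base M') σ q)

end ChoiceDict

/-! The first `n` bits are cut into `N = blocks w n` blocks of three words `P`, `X`, `Y`; at most
three words, the last of them only partly owned, remain as a tail that stores its bits plainly. A
barrier `t` counts the blocks whose data are nonzero. Consequently there are as many zero blocks to
the left of `t` as nonzero blocks to the right of it, and these are matched one to one. In a pair `i
< t ≤ j` the words `P i` and `P j` point to each other, and the three data words of `j` fill the
three places `Y j`, `X i`, `Y i`. An unmatched left block stores its own data; an unmatched right
block represents zero, whatever it contains. Hence `X` is unused in every right block. If `t < N`,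
the last block is a right block and its `X` holds `t`; the remaining case `t = N` is recorded by the
single extra bit `n`. With `t = 0` no block is matched, so initialization can leave nearly all
memory as it is.

Flipping a bit changes the data of one block. If the block stays nonzero, its data are overwritten
in place. If it becomes nonzero or zero, the barrier moves by one, and only that block, the block
that crosses the barrier and the mates of these two have to be rearranged: the lemmas
`updated_left`, `updated_right`, `updated_extend_*` and `updated_shrink_*`. The one subtlety is that
data written into `P` may look like a pointer and create a false pair; `fixLoc` then turns the
pointer of the right block concerned into a pointer to itself.

The involution `partner` maps the blocks left of the barrier bijectively to the nonzero blocks. Read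
through it, the represented bit vector becomes a vector (`rankWord`) in which all nonzero blocks
come first, without gaps. So the first set bit from a given position on is found among a constant
number of words (`Valid.isFirst_scan`, `Valid.isFirst_search`). This gives `choice`, and it gives an
iteration whose entire state is a position in `0, …, n`. A position determines the set of elements
enumerated so far (`enumSet`) as long as the memory representation does not change, and insertions
and deletions that have no effect store nothing.

Extracting the lowest set bit and computing the word length need the logarithm of a power of two.
Given an approximation of `√w` this takes constant time (`exists_val_log`): with fields of about
`√w` bits, remainders modulo `2 ^ g - 1` turn exponents into numbers.

Two bridges lead to the machine. Programs are compiled from expressions and from decision trees of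
stores, of a size that depends on neither `w` nor `n`; and `Agree.repWords` shows that the
representation depends only on the `n + 1` bits that belong to the dictionary. -/

namespace ChoiceDict

open WordRAM

/-! ### Expressions, commands and their compilation to loop-free programs -/

/-- Expressions over the input registers `0`, `1`, `2` and the memory. -/
inductive Expr
  | reg (i : Fin 3)
  | const (k : ℕ)
  | sqrtw
  | op (o : BinOp) (a b : Expr)
  | load (a : Expr)
  | iteEq (a b x y : Expr)
  | iteLt (a b x y : Expr)

/-- The machine state on which expressions are evaluated. -/
structure Ctx (w : ℕ) where
  s : BitVec w
  regs : Fin 3 → BitVec w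
  mem : Mem w

/-- The value of an expression. -/
def Expr.eval {w : ℕ} (Γ : Ctx w) : Expr → BitVec w
  | .reg i => Γ.regs i
  | .const k => BitVec.ofNat w k
  | .sqrtw => Γ.s
  | .op o a b => o.eval (a.eval Γ) (b.eval Γ)
  | .load a => Γ.mem (a.eval Γ)
  | .iteEq a b x y => if (a.eval Γ).toNat = (b.eval Γ).toNat then x.eval Γ else y.eval Γ
  | .iteLt a b x y => if (a.eval Γ).toNat < (b.eval Γ).toNat then x.eval Γ else y.eval Γ

/-- A loop-free program that puts the value of an expression into register `d`
and changes no register below `d`. -/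
def Expr.compile : Expr → ℕ → Prog
  | .reg i, d => .instr (.move d i)
  | .const k, d => .instr (.const d k)
  | .sqrtw, d => .instr (.sqrtw d)
  | .op o a b, d => .seq (a.compile d) (.seq (b.compile (d + 1)) (.instr (.op o d d (d + 1))))
  | .load a, d => .seq (a.compile d) (.instr (.load d d))
  | .iteEq a b x y, d => .seq (a.compile d) (.seq (b.compile (d + 1))
      (.ite (.eq d (d + 1)) (x.compile d) (y.compile d)))
  | .iteLt a b x y, d => .seq (a.compile d) (.seq (b.compile (d + 1))
      (.ite (.lt d (d + 1)) (x.compile d) (y.compile d)))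

/-- The part of a configuration that expressions can see. -/
def ctxOf {w : ℕ} (s : BitVec w) (c : Config w) : Ctx w := ⟨s, fun i => c.regs i, c.mem⟩

/-- Scratch registers start at 3, so intermediate results never disturb the inputs, and each
subexpression is evaluated in the original context. -/
theorem ctxOf_congr {w : ℕ} {s : BitVec w} {c c' : Config w} {d : ℕ} (hd : 3 ≤ d)
    (hm : c'.mem = c.mem) (hr : ∀ r < d, c'.regs r = c.regs r) : ctxOf s c' = ctxOf s c := by
  unfold ctxOf
  rw [hm]
  congr 1
  funext i
  exact hr i (by omega)

/-- There are no loops, so the time bound depends on the expression alone; `T` is chosen before the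
word length. Since registers below the target survive, the first operand waits in `d` while the
second is computed in `d + 1`. -/
theorem Expr.exec_compile (e : Expr) : ∃ T, ∀ d, 3 ≤ d → ∀ {w : ℕ} (s : BitVec w) (c : Config w),
    ∃ t ≤ T, ∃ c', Exec s (e.compile d) c t c' ∧ c'.mem = c.mem ∧
      (∀ r < d, c'.regs r = c.regs r) ∧ c'.regs d = e.eval (ctxOf s c) := by
  induction e with
  | reg i =>
    refine ⟨1, fun d hd w s c => ⟨1, le_rfl, _, .instr _ _, rfl, fun r hr => ?_, ?_⟩⟩
    · simp [Instr.exec, Function.update_of_ne hr.ne]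
    · simp [Instr.exec, Expr.eval, ctxOf]
  | const k =>
    refine ⟨1, fun d hd w s c => ⟨1, le_rfl, _, .instr _ _, rfl, fun r hr => ?_, ?_⟩⟩
    · simp [Instr.exec, Function.update_of_ne hr.ne]
    · simp [Instr.exec, Expr.eval]
  | sqrtw =>
    refine ⟨1, fun d hd w s c => ⟨1, le_rfl, _, .instr _ _, rfl, fun r hr => ?_, ?_⟩⟩
    · simp [Instr.exec, Function.update_of_ne hr.ne]
    · simp [Instr.exec, Expr.eval, ctxOf]
  | op o a b iha ihb =>
    obtain ⟨Ta, ha⟩ := iha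
    obtain ⟨Tb, hb⟩ := ihb
    refine ⟨Ta + (Tb + 1), fun d hd w s c => ?_⟩
    obtain ⟨t₁, ht₁, c₁, e₁, m₁, r₁, v₁⟩ := ha d hd s c
    obtain ⟨t₂, ht₂, c₂, e₂, m₂, r₂, v₂⟩ := hb (d + 1) (by omega) s c₁
    refine ⟨t₁ + (t₂ + 1), by omega, _, .seq e₁ (.seq e₂ (.instr _ _)), ?_, fun r hr => ?_, ?_⟩
    · simp [Instr.exec, m₂, m₁]
    · simp only [Instr.exec, Function.update_of_ne hr.ne]
      rw [r₂ r (by omega), r₁ r hr]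
    · simp only [Instr.exec, Function.update_self, Expr.eval]
      rw [v₂, r₂ d (by omega), v₁, ctxOf_congr hd m₁ r₁]
  | load a iha =>
    obtain ⟨Ta, ha⟩ := iha
    refine ⟨Ta + 1, fun d hd w s c => ?_⟩
    obtain ⟨t₁, ht₁, c₁, e₁, m₁, r₁, v₁⟩ := ha d hd s c
    refine ⟨t₁ + 1, by omega, _, .seq e₁ (.instr _ _), ?_, fun r hr => ?_, ?_⟩
    · simp [Instr.exec, m₁]
    · simp only [Instr.exec, Function.update_of_ne hr.ne]
      rw [r₁ r hr]
    · simp only [Instr.exec, Function.update_self, Expr.eval]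
      rw [v₁, m₁]
      rfl
  | iteEq a b x y iha ihb ihx ihy =>
    obtain ⟨Ta, ha⟩ := iha
    obtain ⟨Tb, hb⟩ := ihb
    obtain ⟨Tx, hx⟩ := ihx
    obtain ⟨Ty, hy⟩ := ihy
    refine ⟨Ta + (Tb + (Tx + Ty + 1)), fun d hd w s c => ?_⟩
    obtain ⟨t₁, ht₁, c₁, e₁, m₁, r₁, v₁⟩ := ha d hd s c
    obtain ⟨t₂, ht₂, c₂, e₂, m₂, r₂, v₂⟩ := hb (d + 1) (by omega) s c₁
    have hm : c₂.mem = c.mem := m₂.trans m₁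
    have hr : ∀ r < d, c₂.regs r = c.regs r := fun r h => (r₂ r (by omega)).trans (r₁ r h)
    rw [ctxOf_congr hd m₁ r₁] at v₂
    have hv : c₂.regs d = a.eval (ctxOf s c) := (r₂ d (by omega)).trans v₁
    by_cases h : (a.eval (ctxOf s c)).toNat = (b.eval (ctxOf s c)).toNat
    · obtain ⟨t₃, ht₃, c₃, e₃, m₃, r₃, v₃⟩ := hx d hd s c₂
      refine ⟨t₁ + (t₂ + (t₃ + 1)), by omega, c₃, .seq e₁ (.seq e₂ (.ite_true ?_ e₃)),
        m₃.trans hm, fun r h => (r₃ r h).trans (hr r h), ?_⟩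
      · simpa [Test.eval, hv, v₂] using h
      · rw [v₃, ctxOf_congr hd hm hr, Expr.eval, if_pos h]
    · obtain ⟨t₃, ht₃, c₃, e₃, m₃, r₃, v₃⟩ := hy d hd s c₂
      refine ⟨t₁ + (t₂ + (t₃ + 1)), by omega, c₃, .seq e₁ (.seq e₂ (.ite_false ?_ e₃)),
        m₃.trans hm, fun r h => (r₃ r h).trans (hr r h), ?_⟩
      · simpa [Test.eval, hv, v₂] using h
      · rw [v₃, ctxOf_congr hd hm hr, Expr.eval, if_neg h]
  | iteLt a b x y iha ihb ihx ihy =>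
    obtain ⟨Ta, ha⟩ := iha
    obtain ⟨Tb, hb⟩ := ihb
    obtain ⟨Tx, hx⟩ := ihx
    obtain ⟨Ty, hy⟩ := ihy
    refine ⟨Ta + (Tb + (Tx + Ty + 1)), fun d hd w s c => ?_⟩
    obtain ⟨t₁, ht₁, c₁, e₁, m₁, r₁, v₁⟩ := ha d hd s c
    obtain ⟨t₂, ht₂, c₂, e₂, m₂, r₂, v₂⟩ := hb (d + 1) (by omega) s c₁
    have hm : c₂.mem = c.mem := m₂.trans m₁
    have hr : ∀ r < d, c₂.regs r = c.regs r := fun r h => (r₂ r (by omega)).trans (r₁ r h)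
    rw [ctxOf_congr hd m₁ r₁] at v₂
    have hv : c₂.regs d = a.eval (ctxOf s c) := (r₂ d (by omega)).trans v₁
    by_cases h : (a.eval (ctxOf s c)).toNat < (b.eval (ctxOf s c)).toNat
    · obtain ⟨t₃, ht₃, c₃, e₃, m₃, r₃, v₃⟩ := hx d hd s c₂
      refine ⟨t₁ + (t₂ + (t₃ + 1)), by omega, c₃, .seq e₁ (.seq e₂ (.ite_true ?_ e₃)),
        m₃.trans hm, fun r h => (r₃ r h).trans (hr r h), ?_⟩
      · simpa [Test.eval, hv, v₂] using h
      · rw [v₃, ctxOf_congr hd hm hr, Expr.eval, if_pos h]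
    · obtain ⟨t₃, ht₃, c₃, e₃, m₃, r₃, v₃⟩ := hy d hd s c₂
      refine ⟨t₁ + (t₂ + (t₃ + 1)), by omega, c₃, .seq e₁ (.seq e₂ (.ite_false ?_ e₃)),
        m₃.trans hm, fun r h => (r₃ r h).trans (hr r h), ?_⟩
      · simpa [Test.eval, hv, v₂] using h
      · rw [v₃, ctxOf_congr hd hm hr, Expr.eval, if_neg h]

/-- Decision trees whose leaves are lists of stores. All addresses and values are computed before
the first store; if two stores have the same address, the one that comes first in the list wins. -/
inductive Cmd
  | stores (l : List (Expr × Expr))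
  | iteEq (a b : Expr) (p q : Cmd)
  | iteLt (a b : Expr) (p q : Cmd)

/-- The memory after a list of stores. -/
def storesEval {w : ℕ} (Γ : Ctx w) : List (Expr × Expr) → Mem w
  | [] => Γ.mem
  | (a, v) :: l => Function.update (storesEval Γ l) (a.eval Γ) (v.eval Γ)

/-- The memory after a command. -/
def Cmd.eval {w : ℕ} (Γ : Ctx w) : Cmd → Mem w
  | .stores l => storesEval Γ l
  | .iteEq a b p q => if (a.eval Γ).toNat = (b.eval Γ).toNat then p.eval Γ else q.eval Γ
  | .iteLt a b p q => if (a.eval Γ).toNat < (b.eval Γ).toNat then p.eval Γ else q.eval Γ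

/-- A program for a list of stores that uses the registers from `d` on. -/
def compileStores : List (Expr × Expr) → ℕ → Prog
  | [], _ => .skip
  | (a, v) :: l, d => .seq (a.compile d) (.seq (v.compile (d + 1))
      (.seq (compileStores l (d + 2)) (.instr (.store d (d + 1)))))

/-- A program for a command. -/
def Cmd.compile : Cmd → Prog
  | .stores l => compileStores l 3
  | .iteEq a b p q => .seq (a.compile 3) (.seq (b.compile 4) (.ite (.eq 3 4) p.compile q.compile))
  | .iteLt a b p q => .seq (a.compile 3) (.seq (b.compile 4) (.ite (.lt 3 4) p.compile q.compile))

/-- The address and value of the head wait in `d` and `d + 1` while the rest of the list runs from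
register `d + 2` on. Thus everything is computed from the old memory, and the head is stored last
and prevails. -/
theorem exec_compileStores (l : List (Expr × Expr)) : ∃ T, ∀ d, 3 ≤ d → ∀ {w : ℕ} (s : BitVec w)
    (c : Config w), ∃ t ≤ T, ∃ c', Exec s (compileStores l d) c t c' ∧
      c'.mem = storesEval (ctxOf s c) l ∧ (∀ r < d, c'.regs r = c.regs r) := by
  induction l with
  | nil => exact ⟨0, fun d _ w s c => ⟨0, le_rfl, c, .skip c, rfl, fun _ _ => rfl⟩⟩
  | cons x l ih =>
    obtain ⟨a, v⟩ := x
    obtain ⟨Ta, ha⟩ := a.exec_compile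
    obtain ⟨Tb, hb⟩ := v.exec_compile
    obtain ⟨Tl, hl⟩ := ih
    refine ⟨Ta + (Tb + (Tl + 1)), fun d hd w s c => ?_⟩
    obtain ⟨t₁, ht₁, c₁, e₁, m₁, r₁, v₁⟩ := ha d hd s c
    obtain ⟨t₂, ht₂, c₂, e₂, m₂, r₂, v₂⟩ := hb (d + 1) (by omega) s c₁
    obtain ⟨t₃, ht₃, c₃, e₃, m₃, r₃⟩ := hl (d + 2) (by omega) s c₂
    have hr : ∀ r < d, c₂.regs r = c.regs r := fun r h => (r₂ r (by omega)).trans (r₁ r h)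
    rw [ctxOf_congr hd m₁ r₁] at v₂
    rw [ctxOf_congr hd (m₂.trans m₁) hr] at m₃
    refine ⟨t₁ + (t₂ + (t₃ + 1)), by omega, _, .seq e₁ (.seq e₂ (.seq e₃ (.instr _ _))), ?_, ?_⟩
    · simp only [Instr.exec, storesEval]
      rw [m₃, r₃ d (by omega), r₃ (d + 1) (by omega), v₂, r₂ d (by omega), v₁]
    · intro r h
      simp only [Instr.exec]
      rw [r₃ r (by omega), hr r h]

theorem Cmd.exec_compile (p : Cmd) : ∃ T, ∀ {w : ℕ} (s : BitVec w) (c : Config w),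
    ∃ t ≤ T, ∃ c', Exec s p.compile c t c' ∧ c'.mem = p.eval (ctxOf s c) := by
  induction p with
  | stores l =>
    obtain ⟨T, h⟩ := exec_compileStores l
    refine ⟨T, fun s c => ?_⟩
    obtain ⟨t, ht, c', e, m, -⟩ := h 3 le_rfl s c
    exact ⟨t, ht, c', e, m⟩
  | iteEq a b p q ihp ihq =>
    obtain ⟨Ta, ha⟩ := a.exec_compile
    obtain ⟨Tb, hb⟩ := b.exec_compile
    obtain ⟨Tx, hx⟩ := ihp
    obtain ⟨Ty, hy⟩ := ihq
    refine ⟨Ta + (Tb + (Tx + Ty + 1)), fun {w} s c => ?_⟩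
    obtain ⟨t₁, ht₁, c₁, e₁, m₁, r₁, v₁⟩ := ha 3 le_rfl s c
    obtain ⟨t₂, ht₂, c₂, e₂, m₂, r₂, v₂⟩ := hb 4 (by omega) s c₁
    have hm : c₂.mem = c.mem := m₂.trans m₁
    have hr : ∀ r < 3, c₂.regs r = c.regs r := fun r h => (r₂ r (by omega)).trans (r₁ r h)
    rw [ctxOf_congr le_rfl m₁ r₁] at v₂
    have hv : c₂.regs 3 = a.eval (ctxOf s c) := (r₂ 3 (by omega)).trans v₁
    by_cases h : (a.eval (ctxOf s c)).toNat = (b.eval (ctxOf s c)).toNat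
    · obtain ⟨t₃, ht₃, c₃, e₃, m₃⟩ := hx s c₂
      refine ⟨t₁ + (t₂ + (t₃ + 1)), by omega, c₃, .seq e₁ (.seq e₂ (.ite_true ?_ e₃)), ?_⟩
      · simpa [Test.eval, hv, v₂] using h
      · rw [m₃, ctxOf_congr le_rfl hm hr, Cmd.eval, if_pos h]
    · obtain ⟨t₃, ht₃, c₃, e₃, m₃⟩ := hy s c₂
      refine ⟨t₁ + (t₂ + (t₃ + 1)), by omega, c₃, .seq e₁ (.seq e₂ (.ite_false ?_ e₃)), ?_⟩
      · simpa [Test.eval, hv, v₂] using h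
      · rw [m₃, ctxOf_congr le_rfl hm hr, Cmd.eval, if_neg h]
  | iteLt a b p q ihp ihq =>
    obtain ⟨Ta, ha⟩ := a.exec_compile
    obtain ⟨Tb, hb⟩ := b.exec_compile
    obtain ⟨Tx, hx⟩ := ihp
    obtain ⟨Ty, hy⟩ := ihq
    refine ⟨Ta + (Tb + (Tx + Ty + 1)), fun {w} s c => ?_⟩
    obtain ⟨t₁, ht₁, c₁, e₁, m₁, r₁, v₁⟩ := ha 3 le_rfl s c
    obtain ⟨t₂, ht₂, c₂, e₂, m₂, r₂, v₂⟩ := hb 4 (by omega) s c₁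
    have hm : c₂.mem = c.mem := m₂.trans m₁
    have hr : ∀ r < 3, c₂.regs r = c.regs r := fun r h => (r₂ r (by omega)).trans (r₁ r h)
    rw [ctxOf_congr le_rfl m₁ r₁] at v₂
    have hv : c₂.regs 3 = a.eval (ctxOf s c) := (r₂ 3 (by omega)).trans v₁
    by_cases h : (a.eval (ctxOf s c)).toNat < (b.eval (ctxOf s c)).toNat
    · obtain ⟨t₃, ht₃, c₃, e₃, m₃⟩ := hx s c₂
      refine ⟨t₁ + (t₂ + (t₃ + 1)), by omega, c₃, .seq e₁ (.seq e₂ (.ite_true ?_ e₃)), ?_⟩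
      · simpa [Test.eval, hv, v₂] using h
      · rw [m₃, ctxOf_congr le_rfl hm hr, Cmd.eval, if_pos h]
    · obtain ⟨t₃, ht₃, c₃, e₃, m₃⟩ := hy s c₂
      refine ⟨t₁ + (t₂ + (t₃ + 1)), by omega, c₃, .seq e₁ (.seq e₂ (.ite_false ?_ e₃)), ?_⟩
      · simpa [Test.eval, hv, v₂] using h
      · rw [m₃, ctxOf_congr le_rfl hm hr, Cmd.eval, if_neg h]

/-- What expressions see when an operation is called. -/
def callCtx {w : ℕ} (s : BitVec w) (n base arg : ℕ) (M : Mem w) : Ctx w :=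
  ⟨s, ![BitVec.ofNat w base, BitVec.ofNat w n, BitVec.ofNat w arg], M⟩

theorem ctxOf_eq_callCtx {w : ℕ} {s : BitVec w} {n base arg : ℕ} {M : Mem w} {c : Config w}
    (hM : c.mem = M) (h0 : c.regs 0 = BitVec.ofNat w base) (h1 : c.regs 1 = BitVec.ofNat w n)
    (h2 : c.regs 2 = BitVec.ofNat w arg) : ctxOf s c = callCtx s n base arg M := by
  unfold ctxOf callCtx
  congr 1
  funext i
  fin_cases i
  · exact h0
  · exact h1
  · exact h2

/-- A program that returns the values of two expressions in registers `0` and `2`. -/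
def query (x y : Expr) : Prog :=
  .seq (x.compile 3) (.seq (y.compile 4) (.seq (.instr (.move 0 3)) (.instr (.move 2 4))))

/-- A query stores nothing, so all memory conditions are trivial. Both results are computed before
registers 0 and 2 are overwritten. -/
theorem call_query (x y : Expr) : ∃ T, ∀ {w : ℕ} (s : BitVec w) (n base arg : ℕ) (M : Mem w)
    (post : Mem w → ℕ → ℕ → Prop),
    post M (x.eval (callCtx s n base arg M)).toNat (y.eval (callCtx s n base arg M)).toNat →
    Call s (query x y) T n base arg M post := by
  obtain ⟨Ta, ha⟩ := x.exec_compile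
  obtain ⟨Tb, hb⟩ := y.exec_compile
  refine ⟨Ta + (Tb + (1 + 1)), fun {w} s n base arg M post hp c hM h0 h1 h2 => ?_⟩
  obtain ⟨t₁, ht₁, c₁, e₁, m₁, r₁, v₁⟩ := ha 3 le_rfl s c
  obtain ⟨t₂, ht₂, c₂, e₂, m₂, r₂, v₂⟩ := hb 4 (by omega) s c₁
  rw [ctxOf_congr le_rfl m₁ r₁, ctxOf_eq_callCtx hM h0 h1 h2] at v₂
  have hv := (r₂ 3 (by omega)).trans v₁
  rw [ctxOf_eq_callCtx hM h0 h1 h2] at hv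
  refine ⟨t₁ + (t₂ + (1 + 1)), by omega, _,
    .seq e₁ (.seq e₂ (.seq (.instr _ _) (.instr _ _))), ?_, ?_⟩
  · intro i _ _
    simp [Instr.exec, m₂, m₁, hM]
  · simpa [Instr.exec, m₂, m₁, hM, Function.update, hv, v₂] using hp

theorem call_compile (p : Cmd) : ∃ T, ∀ {w : ℕ} (s : BitVec w) (n base arg : ℕ) (M : Mem w)
    (post : Mem w → ℕ → ℕ → Prop),
    (∀ i < 2 ^ w * w, i < base * w ∨ base * w + (n + 1) ≤ i →
      (p.eval (callCtx s n base arg M)).bit i = M.bit i) →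
    (∀ x y, post (p.eval (callCtx s n base arg M)) x y) →
    Call s p.compile T n base arg M post := by
  obtain ⟨T, h⟩ := p.exec_compile
  refine ⟨T, fun {w} s n base arg M post hb hp c hM h0 h1 h2 => ?_⟩
  obtain ⟨t, ht, c', e, m⟩ := h s c
  rw [ctxOf_eq_callCtx hM h0 h1 h2] at m
  exact ⟨t, ht, c', e, m ▸ hb, m ▸ hp _ _⟩

theorem Call.mono {w : ℕ} {s : BitVec w} {p : Prog} {T T' n base arg : ℕ} {M : Mem w}
    {post : Mem w → ℕ → ℕ → Prop} (hT : T ≤ T') (h : Call s p T n base arg M post) :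
    Call s p T' n base arg M post := by
  intro c hM h0 h1 h2
  obtain ⟨t, ht, r⟩ := h c hM h0 h1 h2
  exact ⟨t, ht.trans hT, r⟩

/-! ### Values of expressions as natural numbers, given that nothing overflows -/

namespace Expr

instance : Add Expr := ⟨.op .add⟩
instance : Sub Expr := ⟨.op .sub⟩
instance : Mul Expr := ⟨.op .mul⟩
instance : Div Expr := ⟨.op .div⟩
instance : AndOp Expr := ⟨.op .and⟩
instance : XorOp Expr := ⟨.op .xor⟩
instance : HShiftLeft Expr Expr Expr := ⟨.op .shl⟩
instance : HShiftRight Expr Expr Expr := ⟨.op .shr⟩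
instance (k : ℕ) : OfNat Expr k := ⟨.const k⟩
instance : Mod Expr := ⟨fun a b => a - a / b * b⟩

section val

variable {w : ℕ} (Γ : Ctx w)

/-- The value of an expression as a natural number. -/
def val (e : Expr) : ℕ := (e.eval Γ).toNat

variable {Γ} {a b x y : Expr}

theorem val_lt (e : Expr) : e.val Γ < 2 ^ w := (e.eval Γ).isLt

theorem val_const {k : ℕ} (h : k < 2 ^ w) : val Γ (.const k) = k := by
  simp [val, eval, Nat.mod_eq_of_lt h]

theorem val_zero : val Γ 0 = 0 := val_const (k := 0) (by positivity)

theorem val_one (hw : 1 ≤ w) : val Γ 1 = 1 :=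
  val_const (k := 1) (Nat.one_lt_two_pow (by omega))

theorem val_add (h : a.val Γ + b.val Γ < 2 ^ w) : (a + b).val Γ = a.val Γ + b.val Γ := by
  change ((a.eval Γ) + (b.eval Γ)).toNat = _
  rw [BitVec.toNat_add]
  exact Nat.mod_eq_of_lt h

theorem val_sub (h : b.val Γ ≤ a.val Γ) : (a - b).val Γ = a.val Γ - b.val Γ := by
  change ((a.eval Γ) - (b.eval Γ)).toNat = _
  exact BitVec.toNat_sub_of_le h

theorem val_neg (h : 0 < a.val Γ) : (0 - a).val Γ = 2 ^ w - a.val Γ := by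
  change (BitVec.ofNat w 0 - (a.eval Γ)).toNat = _
  rw [BitVec.toNat_sub]
  simp only [BitVec.toNat_ofNat, Nat.zero_mod, add_zero]
  exact Nat.mod_eq_of_lt (by have := val_lt (Γ := Γ) a; unfold val at *; omega)

theorem val_mul (h : a.val Γ * b.val Γ < 2 ^ w) : (a * b).val Γ = a.val Γ * b.val Γ := by
  change ((a.eval Γ) * (b.eval Γ)).toNat = _
  rw [BitVec.toNat_mul]
  exact Nat.mod_eq_of_lt h

theorem val_div : (a / b).val Γ = a.val Γ / b.val Γ := by
  change ((a.eval Γ) / (b.eval Γ)).toNat = _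
  exact BitVec.toNat_udiv

/-- The remainder is computed from a quotient, a product and a difference. The product is at most
the dividend, so no overflow condition is needed. -/
theorem val_mod : (a % b).val Γ = a.val Γ % b.val Γ := by
  change (a - a / b * b).val Γ = _
  have h : a.val Γ / b.val Γ * b.val Γ ≤ a.val Γ := Nat.div_mul_le_self _ _
  have h2 : (a / b * b).val Γ = a.val Γ / b.val Γ * b.val Γ := by
    rw [val_mul, val_div]
    rw [val_div]
    exact h.trans_lt (val_lt a)
  rw [val_sub (by rw [h2]; exact h), h2]
  have := Nat.div_add_mod' (a.val Γ) (b.val Γ)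
  omega

theorem val_and : (a &&& b).val Γ = a.val Γ &&& b.val Γ := BitVec.toNat_and _ _

theorem val_xor : (a ^^^ b).val Γ = a.val Γ ^^^ b.val Γ := BitVec.toNat_xor _ _

theorem val_shr : (a >>> b).val Γ = a.val Γ >>> b.val Γ := BitVec.toNat_ushiftRight _ _

theorem val_shl (h : a.val Γ <<< b.val Γ < 2 ^ w) : (a <<< b).val Γ = a.val Γ <<< b.val Γ := by
  change ((a.eval Γ) <<< (b.eval Γ).toNat).toNat = _
  rw [BitVec.toNat_shiftLeft]
  exact Nat.mod_eq_of_lt h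

theorem val_one_shl (h : b.val Γ < w) : ((1 : Expr) <<< b).val Γ = 2 ^ b.val Γ := by
  have h1 : val Γ 1 = 1 := val_one (by omega)
  rw [val_shl, h1, Nat.one_shiftLeft]
  rw [h1, Nat.one_shiftLeft]
  exact Nat.pow_lt_pow_right (by omega) h

theorem val_load : (load a).val Γ = (Γ.mem (BitVec.ofNat w (a.val Γ))).toNat := by
  simp [val, eval]

theorem val_iteEq : (iteEq a b x y).val Γ = if a.val Γ = b.val Γ then x.val Γ else y.val Γ := by
  simp only [val, eval, apply_ite BitVec.toNat]
  congr

theorem val_iteLt : (iteLt a b x y).val Γ = if a.val Γ < b.val Γ then x.val Γ else y.val Γ := by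
  simp only [val, eval, apply_ite BitVec.toNat]
  congr

end val

end Expr

/-! ### Logarithms of powers of two in constant time -/

/-- The number whose binary representation has ones exactly in the positions
`0, g, 2 * g, …, (m - 1) * g`. -/
def comb (g m : ℕ) : ℕ := (2 ^ (g * m) - 1) / (2 ^ g - 1)

theorem comb_eq_sum {g : ℕ} (hg : 1 ≤ g) (m : ℕ) :
    comb g m = ∑ i ∈ Finset.range m, (2 ^ g) ^ i := by
  rw [Nat.geomSum_eq (Nat.le_self_pow (by omega) 2), comb, pow_mul]

theorem comb_succ {g : ℕ} (hg : 1 ≤ g) (m : ℕ) : comb g (m + 1) = 2 ^ g * comb g m + 1 := by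
  rw [comb_eq_sum hg, comb_eq_sum hg, Finset.sum_range_succ', Finset.mul_sum]
  simp [pow_succ, mul_comm]

/-- Because `2 ^ g ≡ 1`, every one of the comb contributes 1 to the remainder, which therefore
counts the ones. This is the step that turns an exponent into a number. -/
theorem comb_mod {g : ℕ} (hg : 1 ≤ g) (m : ℕ) (hm : m < 2 ^ g - 1) :
    comb g m % (2 ^ g - 1) = m := by
  have h : ∀ m, comb g m ≡ m [MOD 2 ^ g - 1] := by
    intro m
    induction m with
    | zero => simp [comb, Nat.ModEq]
    | succ m ih =>
      rw [comb_succ hg]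
      refine Nat.ModEq.add_right 1 ?_
      have h1 : 2 ^ g ≡ 1 [MOD 2 ^ g - 1] := by
        refine (Nat.modEq_iff_dvd' Nat.one_le_two_pow).2 dvd_rfl |>.symm
      simpa using h1.mul ih
  exact Nat.mod_eq_of_modEq (h m) hm

theorem testBit_comb {g : ℕ} (hg : 1 ≤ g) (m j : ℕ) :
    (comb g m).testBit j = decide (g ∣ j ∧ j < g * m) := by
  induction m generalizing j with
  | zero => simp [comb]
  | succ m ih =>
    rw [comb_succ hg, Nat.testBit_two_pow_mul_add _ (Nat.one_lt_two_pow (by omega))]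
    split_ifs with h
    · rcases Nat.eq_zero_or_pos j with rfl | hj
      · simp; omega
      · have h1 : ¬ g ∣ j := fun hd => absurd (Nat.le_of_dvd hj hd) (by omega)
        simp [h1, Nat.testBit_lt_two_pow (Nat.one_lt_two_pow hj.ne')]
    · rw [ih]
      have h1 : g ∣ j - g ↔ g ∣ j := by
        rw [Nat.dvd_sub_iff_left (by omega) dvd_rfl]
      have h2 : j - g < g * m ↔ j < g * (m + 1) := by rw [mul_add]; omega
      simp [h1, h2]

/-- A common one of both factors is at a position `r + g * b = (g + 1) * a` with `a < g`. Then `a -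
r` is a multiple of `g` of absolute value less than `g`, so `a = r`. The effect is to replace the
exponent `r` by `(g + 1) * r`, a multiple of a field length. -/
theorem two_pow_mul_comb_and_comb {g r : ℕ} (hr : r < g) :
    (2 ^ r * comb g g) &&& comb (g + 1) g = 2 ^ ((g + 1) * r) := by
  refine Nat.eq_of_testBit_eq fun j => ?_
  rw [Nat.testBit_and, Nat.testBit_two_pow_mul, testBit_comb (by omega), testBit_comb (by omega),
    Nat.testBit_two_pow]
  rw [Bool.eq_iff_iff]
  simp only [Bool.and_eq_true, decide_eq_true_eq]
  constructor
  · rintro ⟨⟨h1, ⟨b, hb⟩, h3⟩, ⟨a, rfl⟩, h5⟩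
    have ha : a < g := by
      by_contra! h
      exact absurd (Nat.mul_le_mul_left (g + 1) h) (by omega)
    have hb' : ((a : ℤ) - r) = g * ((b : ℤ) - a) := by
      have : ((g + 1) * a - r : ℕ) = ((g : ℤ) + 1) * a - r := by push_cast [h1]; ring
      rw [hb] at this
      push_cast at this
      linarith
    have : a = r := by
      rcases lt_trichotomy ((b : ℤ) - a) 0 with h | h | h
      · nlinarith
      · rw [h] at hb'; omega
      · nlinarith
    rw [this]
  · rintro rfl
    have h1 : (g + 1) * r = g * r + r := by ring
    have h2 : g * r < g * g := Nat.mul_lt_mul_of_pos_left hr (by omega)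
    refine ⟨⟨by omega, ⟨r, by omega⟩, by omega⟩, ⟨r, rfl⟩, ?_⟩
    exact Nat.mul_lt_mul_of_pos_left hr (by omega)

namespace Expr

/-- All ones. -/
def ones : Expr := 0 - 1

/-- `x` shifted right `m` times by one position. -/
def shrIter (x : Expr) : ℕ → Expr
  | 0 => x
  | m + 1 => (shrIter x m) >>> (1 : Expr)

/-- The logarithm of a power of two that is at most `2 ^ m`. -/
def logSmall : ℕ → Expr → Expr
  | 0, _ => 0
  | m + 1, x => iteEq x 1 0 (logSmall m (x >>> (1 : Expr)) + 1)

/-- The mask with `g` ones. -/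
def mask (g : Expr) : Expr := (1 : Expr) <<< g - 1

/-- The logarithm of a power of `2 ^ g`, divided by `g`. -/
def logBase (g x : Expr) : Expr := ((x - 1) / mask g) % mask g

/-- The logarithm of a power of two that is smaller than `2 ^ g`. -/
def logField (g x : Expr) : Expr :=
  logBase (g + 1) ((x * (mask (g * g) / mask g)) &&& (mask ((g + 1) * g) / mask (g + 1)))

/-- The logarithm of a power of two, computed with fields of `g` bits. -/
def logFast (g x : Expr) : Expr := logBase g (x / (x % mask g)) * g + logField g (x % mask g)

/-- The logarithm of a power of two. -/
def log (W c : ℕ) (x : Expr) : Expr :=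
  iteEq (shrIter ones W) 0 (logSmall W x) (logFast (sqrtw / .const c) x)

variable {w : ℕ} {Γ : Ctx w}

theorem val_ones (hw : 1 ≤ w) : val Γ ones = 2 ^ w - 1 := by
  rw [ones, val_neg, val_one hw]
  rw [val_one hw]; omega

theorem val_shrIter (hw : 1 ≤ w) (x : Expr) (m : ℕ) : (shrIter x m).val Γ = x.val Γ >>> m := by
  induction m with
  | zero => rfl
  | succ m ih => rw [shrIter, val_shr, ih, val_one hw, Nat.shiftRight_add]

theorem val_logSmall {m k : ℕ} (hk : k ≤ m) (hw : k < w) {x : Expr} (hx : x.val Γ = 2 ^ k) :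
    (logSmall m x).val Γ = k := by
  induction m generalizing k x with
  | zero => rw [logSmall, val_zero]; omega
  | succ m ih =>
    rw [logSmall, val_iteEq, val_one (by omega), val_zero, hx]
    rcases k with _ | k
    · simp
    · rw [if_neg (Nat.one_lt_two_pow (by omega)).ne']
      have h : (logSmall m (x >>> (1 : Expr))).val Γ = k := by
        refine ih (by omega) (by omega) ?_
        rw [val_shr, val_one (by omega), hx, Nat.shiftRight_one, pow_succ]
        omega
      have h2 : k + 1 < 2 ^ w := hw.trans Nat.lt_two_pow_self
      rw [val_add, h, val_one (by omega)]
      rw [h, val_one (by omega)]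
      exact h2

theorem val_mask {g : Expr} (hg : g.val Γ < w) : (mask g).val Γ = 2 ^ g.val Γ - 1 := by
  have h1 := val_one_shl hg
  have h2 : val Γ 1 = 1 := val_one (by omega)
  rw [mask, val_sub, h1, h2]
  rw [h1, h2]
  exact Nat.one_le_two_pow

/-- The quotient of `2 ^ (g * q) - 1` by `2 ^ g - 1` is the comb with `q` ones, and its remainder
modulo `2 ^ g - 1` is `q`. -/
theorem val_logBase {g x : Expr} {q : ℕ} (hg : 1 ≤ g.val Γ) (hgw : g.val Γ < w)
    (hq : q < 2 ^ g.val Γ - 1) (hx : x.val Γ = 2 ^ (g.val Γ * q)) : (logBase g x).val Γ = q := by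
  have h2 : val Γ 1 = 1 := val_one (by omega)
  rw [logBase, val_mod, val_div, val_mask hgw, val_sub, hx, h2]
  · exact comb_mod hg q hq
  · rw [hx, h2]
    exact Nat.one_le_two_pow

/-- The product with the comb and the conjunction change `2 ^ r` into `2 ^ ((g + 1) * r)`, to which
`logBase` with fields of `g + 1` bits applies. The shifted comb occupies fewer than `g * g + g`
bits, which the hypothesis on `w` accommodates. -/
theorem val_logField {g x : Expr} {r : ℕ} (hr : r < g.val Γ) (hg : (g.val Γ + 1) * g.val Γ < w)
    (hx : x.val Γ = 2 ^ r) : (logField g x).val Γ = r := by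
  have hw : w < 2 ^ w := Nat.lt_two_pow_self
  have hgg : (g.val Γ + 1) * g.val Γ = g.val Γ * g.val Γ + g.val Γ := by ring
  have hle : g.val Γ ≤ g.val Γ * g.val Γ := Nat.le_mul_self _
  have h1 : val Γ 1 = 1 := val_one (by omega)
  have hs : (g * g).val Γ = g.val Γ * g.val Γ := val_mul (by omega)
  have ha : (g + 1).val Γ = g.val Γ + 1 := by
    rw [val_add, h1]
    rw [h1]; omega
  have hm : ((g + 1) * g).val Γ = (g.val Γ + 1) * g.val Γ := by
    rw [val_mul, ha]
    rw [ha]; omega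
  have hc1 : (mask (g * g) / mask g).val Γ = comb (g.val Γ) (g.val Γ) := by
    rw [val_div, val_mask (by omega), val_mask (by omega), hs, comb]
  have hc2 : (mask ((g + 1) * g) / mask (g + 1)).val Γ = comb (g.val Γ + 1) (g.val Γ) := by
    rw [val_div, val_mask (by omega), val_mask (by omega), hm, ha, comb]
  have hlt : 2 ^ r * comb (g.val Γ) (g.val Γ) < 2 ^ w := by
    have h3 : comb (g.val Γ) (g.val Γ) < 2 ^ (g.val Γ * g.val Γ) := by
      refine (Nat.div_le_self _ _).trans_lt ?_
      have := Nat.one_le_two_pow (n := g.val Γ * g.val Γ)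
      omega
    calc 2 ^ r * comb (g.val Γ) (g.val Γ) < 2 ^ r * 2 ^ (g.val Γ * g.val Γ) :=
          Nat.mul_lt_mul_of_pos_left h3 (by positivity)
      _ = 2 ^ (r + g.val Γ * g.val Γ) := (pow_add _ _ _).symm
      _ ≤ 2 ^ w := Nat.pow_le_pow_right (by omega) (by omega)
  refine val_logBase (by omega) (by omega) ?_ ?_
  · rw [ha]
    have := Nat.lt_two_pow_self (n := g.val Γ)
    rw [pow_succ]
    omega
  · rw [val_and, hc2, val_mul, hc1, hx, two_pow_mul_comb_and_comb hr, ha]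
    rw [hc1, hx]
    exact hlt

/-- Write `k = g * q + r` with `r < g`. The remainder of `2 ^ k` modulo `2 ^ g - 1` is `2 ^ r`, and
division by it leaves `2 ^ (g * q)`; the two exponents are found separately. -/
theorem val_logFast {g x : Expr} {k : ℕ} (hg : 2 ≤ g.val Γ) (hgw : (g.val Γ + 1) * g.val Γ < w)
    (hw : w < 2 ^ g.val Γ - 1) (hk : k < w) (hx : x.val Γ = 2 ^ k) :
    (logFast g x).val Γ = k := by
  have hww : w < 2 ^ w := Nat.lt_two_pow_self
  have hgw' : g.val Γ < w := lt_of_le_of_lt (Nat.le_mul_of_pos_left _ (by omega)) hgw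
  have hk' := Nat.div_add_mod k (g.val Γ)
  have hmod : k % g.val Γ < g.val Γ := Nat.mod_lt _ (by omega)
  have hm : (x % mask g).val Γ = 2 ^ (k % g.val Γ) := by
    rw [val_mod, hx, val_mask hgw']
    refine Nat.mod_eq_of_modEq ?_ ?_
    · have h1 : 2 ^ g.val Γ ≡ 1 [MOD 2 ^ g.val Γ - 1] :=
        ((Nat.modEq_iff_dvd' Nat.one_le_two_pow).2 dvd_rfl).symm
      have h2 := (h1.pow (k / g.val Γ)).mul_right (2 ^ (k % g.val Γ))
      rwa [one_pow, one_mul, ← pow_mul, ← pow_add, hk'] at h2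
    -- Here `g ≥ 2` is needed: it makes `2 ^ (g - 1)` smaller than the modulus `2 ^ g - 1`.
    · have h3 : 2 ^ (k % g.val Γ) ≤ 2 ^ (g.val Γ - 1) :=
        Nat.pow_le_pow_right (by omega) (by omega)
      have h4 : 2 ^ g.val Γ = 2 ^ (g.val Γ - 1) * 2 := by
        rw [← pow_succ]; congr 1; omega
      have h5 : 2 ≤ 2 ^ (g.val Γ - 1) := Nat.le_self_pow (by omega) 2
      omega
  have hq : (logBase g (x / (x % mask g))).val Γ = k / g.val Γ := by
    refine val_logBase (by omega) hgw' ?_ ?_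
    · have := Nat.div_le_self k (g.val Γ)
      omega
    · rw [val_div, hm, hx, Nat.pow_div (Nat.mod_le _ _) (by omega)]
      congr 1
      omega
  have hr : (logField g (x % mask g)).val Γ = k % g.val Γ := val_logField hmod hgw hm
  have hmul : (logBase g (x / (x % mask g)) * g).val Γ = g.val Γ * (k / g.val Γ) := by
    rw [val_mul, hq, mul_comm]
    rw [hq, mul_comm]
    omega
  rw [logFast, val_add, hmul, hr, hk']
  rw [hmul, hr]
  omega

end Expr

open Filter in
theorem exists_forall_mul_sq_lt_two_pow (a : ℕ) :
    ∃ G, 2 ≤ G ∧ ∀ g, G ≤ g → a * (g + 1) ^ 2 + 1 < 2 ^ g := by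
  have h := tendsto_pow_const_div_const_pow_of_one_lt 2 (r := (2 : ℝ)) (by norm_num)
  -- With this bound `4 * (a + 1) * g ^ 2 < 2 ^ g`; the 4 absorbs the passage from `g` to `g + 1`,
  -- and the added 1 in `a + 1` absorbs the final `+ 1`.
  have h2 := h.eventually_lt_const (u := 1 / (4 * ((a : ℝ) + 1))) (by positivity)
  obtain ⟨G, hG⟩ := eventually_atTop.1 h2
  refine ⟨max G 2, le_max_right _ _, fun g hg => ?_⟩
  have h3 := hG g (le_trans (le_max_left _ _) hg)
  have hg1 : (2 : ℝ) ≤ g := by exact_mod_cast le_trans (le_max_right _ _) hg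
  rw [div_lt_div_iff₀ (by positivity) (by positivity)] at h3
  have h4 : ((a : ℝ) * (g + 1) ^ 2 + 1) < 2 ^ g := by
    have ha : (0 : ℝ) ≤ a := by positivity
    nlinarith [mul_nonneg ha (sq_nonneg ((g : ℝ) - 1)), mul_nonneg ha (sub_nonneg.2 hg1)]
  exact_mod_cast h4

/-- Fields of `g = σ / (2 * K)` bits with `K = ⌈C⌉` are right in both directions: `4 * g ^ 2 ≤ w`
leaves room for the combs, and `w < 4 * K ^ 4 * (g + 1) ^ 2` is less than `2 ^ g - 1` once `g ≥ G`.
Up to the word length `W` a search of constant depth is used instead. -/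
theorem exists_val_log (C : ℝ) : ∃ W c : ℕ, ∀ {w : ℕ} (Γ : Ctx w), 1 ≤ w →
    Real.sqrt w ≤ C * Γ.s.toNat → (Γ.s.toNat : ℝ) ≤ C * Real.sqrt w →
    ∀ (x : Expr) (k : ℕ), k < w → x.val Γ = 2 ^ k → (Expr.log W c x).val Γ = k := by
  set K := ⌈C⌉₊ with hK
  obtain ⟨G, hG2, hG⟩ := exists_forall_mul_sq_lt_two_pow (4 * K ^ 4)
  -- The first summand forces `G ≤ g` for longer words; the second guarantees that the divisor `2 *
  -- K` is not reduced modulo `2 ^ w`.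
  refine ⟨4 * K ^ 4 * (G + 1) ^ 2 + 2 * K, 2 * K, fun {w} Γ hw h1 h2 x k hk hx => ?_⟩
  have hCK : C ≤ K := Nat.le_ceil C
  have hsw : 0 < Real.sqrt w := Real.sqrt_pos.2 (by exact_mod_cast hw)
  set σ := Γ.s.toNat with hσ
  have h1' : Real.sqrt w ≤ K * σ := h1.trans (by gcongr)
  have h2' : (σ : ℝ) ≤ K * Real.sqrt w := h2.trans (by gcongr)
  have hsq : Real.sqrt w ^ 2 = w := Real.sq_sqrt (by positivity)
  have e1 : w ≤ (K * σ) ^ 2 := by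
    have : (w : ℝ) ≤ (K * σ) ^ 2 := by rw [← hsq]; gcongr
    exact_mod_cast this
  have e2 : σ ^ 2 ≤ K ^ 2 * w := by
    have : (σ : ℝ) ^ 2 ≤ K ^ 2 * w := by rw [← hsq, ← mul_pow]; gcongr
    exact_mod_cast this
  have hK0 : 0 < K := by
    rcases Nat.eq_zero_or_pos K with h | h
    · simp [h] at e1; omega
    · exact h
  rw [Expr.log, Expr.val_iteEq, Expr.val_shrIter hw, Expr.val_ones hw, Expr.val_zero]
  have hww : w < 2 ^ w := Nat.lt_two_pow_self
  -- The all-ones word vanishes after `W` shifts exactly if `w ≤ W`. Shifting by one position at a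
  -- time avoids the constant `W`, which might wrap around in a short word.
  split_ifs with hsmall
  · refine Expr.val_logSmall ?_ hk hx
    by_contra! hlt
    rw [Nat.shiftRight_eq_div_pow, Nat.div_eq_zero_iff] at hsmall
    have := Nat.pow_le_pow_right (n := 2) (by omega) (hlt.le.trans (Nat.le_sub_one_of_lt hk))
    have h3 : 2 ^ w = 2 ^ (w - 1) * 2 := by rw [← pow_succ]; congr 1; omega
    have h4 : 2 ^ (4 * K ^ 4 * (G + 1) ^ 2 + 2 * K) > 0 := by positivity
    omega
  · have hlarge : 4 * K ^ 4 * (G + 1) ^ 2 + 2 * K < w := by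
      by_contra! hle
      refine hsmall ?_
      rw [Nat.shiftRight_eq_div_pow]
      refine Nat.div_eq_of_lt ?_
      have := Nat.pow_le_pow_right (n := 2) (by omega) hle
      have h4 : 2 ^ w > 0 := by positivity
      omega
    have hg : (Expr.sqrtw / .const (2 * K) : Expr).val Γ = σ / (2 * K) := by
      rw [Expr.val_div, Expr.val_const (by omega)]
      rfl
    set g := σ / (2 * K) with hgdef
    have f1 : 2 * K * g ≤ σ := Nat.mul_div_le _ _
    have f2 : σ < 2 * K * (g + 1) := Nat.lt_mul_div_succ _ (by omega)
    have f3 : w < 4 * K ^ 4 * (g + 1) ^ 2 := by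
      calc w ≤ (K * σ) ^ 2 := e1
        _ < (K * (2 * K * (g + 1))) ^ 2 := by gcongr
        _ = _ := by ring
    have hGg : G ≤ g := by
      by_contra! hlt
      have : 4 * K ^ 4 * (g + 1) ^ 2 ≤ 4 * K ^ 4 * (G + 1) ^ 2 := by gcongr
      omega
    have f4 : 4 * g ^ 2 ≤ w := by
      have : K ^ 2 * (4 * g ^ 2) ≤ K ^ 2 * w := by
        calc K ^ 2 * (4 * g ^ 2) = (2 * K * g) ^ 2 := by ring
          _ ≤ σ ^ 2 := by gcongr
          _ ≤ _ := e2
      exact Nat.le_of_mul_le_mul_left this (pow_pos hK0 2)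
    have f5 := hG g hGg
    refine Expr.val_logFast ?_ ?_ ?_ hk hx
    · rw [hg]; omega
    · rw [hg]; nlinarith
    · rw [hg]; omega

/-! ### The matching of blocks across the barrier and its updates -/

/-- The block matched with block `i`, or `i` itself if there is none. A block on the left of the
barrier `t` and one on the right are matched if their first words point to each other. -/
def mate (N t : ℕ) (P : ℕ → ℕ) (i : ℕ) : ℕ :=
  if P i < N ∧ (i < t ↔ t ≤ P i) ∧ P (P i) = i then P i else i

/-- The `k`-th of three numbers. -/
def sel (a b c k : ℕ) : ℕ := if k = 0 then a else if k = 1 then b else c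

/-- The `k`-th word of the data represented by block `j`, for blocks with the words `P`, `X`, `Y`.
Unmatched blocks on the left of the barrier contain their data. The data of a matched block on the
right are spread over the block and its mate. All other blocks represent `0`. -/
def content (N t : ℕ) (P X Y : ℕ → ℕ) (j k : ℕ) : ℕ :=
  if j < t then if mate N t P j = j then sel (P j) (X j) (Y j) k else 0
  else if mate N t P j = j then 0 else sel (Y j) (X (mate N t P j)) (Y (mate N t P j)) k

/-- Block `j` has no room for data. -/
def Free (N t : ℕ) (P : ℕ → ℕ) (j : ℕ) : Prop := j < t ↔ mate N t P j ≠ j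

/-- The data of block `j` have been replaced by `a`, `b`, `c`, those of the other blocks are
unchanged, and `z` says whether block `j` is free now. -/
def Updated (N t : ℕ) (P X Y : ℕ → ℕ) (t' : ℕ) (P' X' Y' : ℕ → ℕ) (j a b c : ℕ) (z : Prop) : Prop :=
  ∀ x < N, (Free N t' P' x ↔ if x = j then z else Free N t P x) ∧
    ∀ k, content N t' P' X' Y' x k = if x = j then sel a b c k else content N t P X Y x k

/-- The block whose first word is overwritten when the left block `x` gets the first word `a`:
block `a` if it would become the mate of `x`, and otherwise just `x`. -/
def fixLoc (N t : ℕ) (P : ℕ → ℕ) (x a : ℕ) : ℕ := if t ≤ a ∧ a < N ∧ P a = x then a else x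

section

variable {N t j a b c : ℕ} {P X Y P' X' Y' : ℕ → ℕ}

theorem mate_spec (i : ℕ) : mate N t P i = i ∨ mate N t P i = P i ∧ P i < N ∧
    (i < t ↔ t ≤ P i) ∧ P (P i) = i := by
  unfold mate
  grind

/-- The condition for a pair, mutual pointers with the barrier in between, is symmetric. -/
theorem mate_mate {i : ℕ} (hi : i < N) : mate N t P (mate N t P i) = i := by
  rcases mate_spec (N := N) (t := t) (P := P) i with h | ⟨h1, h2, h3, h4⟩
  · rw [h, h]
  · rw [h1, mate, if_pos, h4]
    rw [h4]
    exact ⟨by omega, by omega, rfl⟩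

theorem mate_range (i : ℕ) :
    mate N t P i = i ∨ mate N t P i < N ∧ (i < t ↔ t ≤ mate N t P i) := by
  unfold mate
  grind

/-- The repair of a pointer harms no data: it touches `x` itself or a right block, whose first word
is never data. -/
theorem fixLoc_spec (x a : ℕ) : fixLoc N t P x a = x ∨ t ≤ fixLoc N t P x a := by
  unfold fixLoc
  grind

theorem mate_lt {i : ℕ} (hi : i < N) : mate N t P i < N := by
  unfold mate
  grind

/-- Overwriting in place. If the data word `a` happens to name a right block that points to `j`,
that block is made to point to itself. It was not matched with `j`, so no data are lost. -/
theorem updated_left (ht : t ≤ N) (hj : j < t) (hf : mate N t P j = j)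
    (hP : ∀ x < N, P' x = if x = j then a else if x = fixLoc N t P j a then a else P x)
    (hX : ∀ x < t, X' x = if x = j then b else X x)
    (hY : ∀ x < N, Y' x = if x = j then c else Y x) :
    Updated N t P X Y t P' X' Y' j a b c False := by
  intro x hx
  have h : mate N t P' x = mate N t P x := by
    clear hX hY
    unfold mate fixLoc at *
    grind (splits := 25)
  have hrx := mate_range (N := N) (t := t) (P := P) x
  have hmx := mate_mate (N := N) (t := t) (P := P) (i := x) hx
  have hrj := mate_range (N := N) (t := t) (P := P) j
  have hmj := mate_mate (N := N) (t := t) (P := P) (i := j) (by omega)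
  unfold Free content
  rw [h]
  replace hP := hP x hx
  clear h
  -- With the new matching known, the rest needs only that the matching is an involution whose
  -- proper pairs cross the barrier.
  generalize mate N t P = m at *
  constructor
  · clear hP hX hY
    grind (splits := 25)
  · intro k
    have hl0 := fixLoc_spec (N := N) (t := t) (P := P) j a
    generalize fixLoc N t P j a = l0 at *
    grind (splits := 25)

/-- The data are overwritten where they lie, in `Y j` and in `X`, `Y` of the mate. No pointer
changes. -/
theorem updated_right (hj : t ≤ j) (hjN : j < N) (hf : mate N t P j ≠ j)
    (hP : ∀ x < N, P' x = P x)
    (hX : ∀ x < t, X' x = if x = mate N t P j then b else X x)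
    (hY : ∀ x < N, Y' x = if x = j then a else if x = mate N t P j then c else Y x) :
    Updated N t P X Y t P' X' Y' j a b c False := by
  intro x hx
  have h : mate N t P' x = mate N t P x := by
    clear hX hY
    unfold mate at *
    grind (splits := 25)
  have hrx := mate_range (N := N) (t := t) (P := P) x
  have hmx := mate_mate (N := N) (t := t) (P := P) (i := x) hx
  have hrj := mate_range (N := N) (t := t) (P := P) j
  have hmj := mate_mate (N := N) (t := t) (P := P) (i := j) hjN
  unfold Free content
  rw [h]
  replace hP := hP x hx
  clear h
  generalize mate N t P = m at *
  constructor
  · clear hP hX hY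
    grind (splits := 25)
  · intro k
    grind (splits := 25)

/-- The block that crosses the barrier is the one that becomes nonzero. False pairs have to be
excluded for the new barrier, hence `t + 1` in `fixLoc`. -/
theorem updated_extend_self (ht : t < N) (hf : mate N t P t = t)
    (hP : ∀ x < N, P' x = if x = t then a else if x = fixLoc N (t + 1) P t a then a else P x)
    (hX : ∀ x < t + 1, X' x = if x = t then b else X x)
    (hY : ∀ x < N, Y' x = if x = t then c else Y x) :
    Updated N t P X Y (t + 1) P' X' Y' t a b c False := by
  intro x hx
  have h : mate N (t + 1) P' x = mate N t P x := by
    clear hX hY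
    unfold mate fixLoc at *
    grind (splits := 25)
  have hrx := mate_range (N := N) (t := t) (P := P) x
  have hmx := mate_mate (N := N) (t := t) (P := P) (i := x) hx
  have hrt := mate_range (N := N) (t := t) (P := P) t
  have hmt := mate_mate (N := N) (t := t) (P := P) (i := t) ht
  unfold Free content
  rw [h]
  replace hP := hP x hx
  clear h
  generalize mate N t P = m at *
  constructor
  · clear hP hX hY
    grind (splits := 25)
  · intro k
    have hl0 := fixLoc_spec (N := N) (t := (t + 1)) (P := P) t a
    generalize fixLoc N (t + 1) P t a = l0 at *
    grind (splits := 25)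

/-- Block `t` becomes a left block with zero data, exactly what `j` needs as a mate. -/
theorem updated_extend_right (ht : t < N) (hf : mate N t P t = t) (hj : t < j) (hjN : j < N)
    (hm : mate N t P j = j)
    (hP : ∀ x < N, P' x = if x = t then j else if x = j then t else P x)
    (hX : ∀ x < t + 1, X' x = if x = t then b else X x)
    (hY : ∀ x < N, Y' x = if x = t then c else if x = j then a else Y x) :
    Updated N t P X Y (t + 1) P' X' Y' j a b c False := by
  intro x hx
  have h : mate N (t + 1) P' x = if x = t then j else if x = j then t else mate N t P x := by
    clear hX hY
    unfold mate at *
    grind (splits := 25)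
  have hrx := mate_range (N := N) (t := t) (P := P) x
  have hmx := mate_mate (N := N) (t := t) (P := P) (i := x) hx
  have hrt := mate_range (N := N) (t := t) (P := P) t
  have hmt := mate_mate (N := N) (t := t) (P := P) (i := t) ht
  have hrj := mate_range (N := N) (t := t) (P := P) j
  have hmj := mate_mate (N := N) (t := t) (P := P) (i := j) hjN
  unfold Free content
  rw [h]
  replace hP := hP x hx
  clear h
  generalize mate N t P = m at *
  constructor
  · clear hP hX hY
    grind (splits := 25)
  · intro k
    grind (splits := 25)

/-- Block `j` hosts data of `p` and now needs its own space; the zero block `t`, new on the left,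
takes over as host of `p`. -/
theorem updated_extend_left {p : ℕ} (ht : t < N) (hf : mate N t P t = t) (hj : j < t)
    (hp : mate N t P j = p) (hm : p ≠ j)
    (hP : ∀ x < N, P' x = if x = t then p else if x = p then t else if x = j then a else
      if x = fixLoc N (t + 1) P j a then a else P x)
    (hX : ∀ x < t + 1, X' x = if x = t then X j else if x = j then b else X x)
    (hY : ∀ x < N, Y' x = if x = t then Y j else if x = j then c else Y x) :
    Updated N t P X Y (t + 1) P' X' Y' j a b c False := by
  intro x hx
  have h : mate N (t + 1) P' x = if x = t then p else if x = p then t else if x = j then j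
      else mate N t P x := by
    clear hX hY
    unfold mate fixLoc at *
    grind (splits := 25)
  have hrx := mate_range (N := N) (t := t) (P := P) x
  have hmx := mate_mate (N := N) (t := t) (P := P) (i := x) hx
  have hrt := mate_range (N := N) (t := t) (P := P) t
  have hmt := mate_mate (N := N) (t := t) (P := P) (i := t) ht
  have hrj := mate_range (N := N) (t := t) (P := P) j
  have hmj := mate_mate (N := N) (t := t) (P := P) (i := j) (by omega)
  unfold Free content
  rw [h]
  replace hP := hP x hx
  clear h
  generalize mate N t P = m at *
  constructor
  · clear hP hX hY
    grind (splits := 25)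
  · intro k
    have hl0 := fixLoc_spec (N := N) (t := (t + 1)) (P := P) j a
    generalize fixLoc N (t + 1) P j a = l0 at *
    grind (splits := 25)

/-- Block `j` hosts data of the very block that crosses the barrier. Block `t` takes its data home,
and `j` is free for its own. Both blocks now have data in `P`, so two repairs may be necessary. -/
theorem updated_extend_matched_self (ht : t < N) (hf : mate N t P t = j) (hm : j ≠ t)
    (hP : ∀ x < N, P' x = if x = j then a else if x = t then Y t else
      if x = fixLoc N (t + 1) P j a then a else if x = fixLoc N (t + 1) P t (Y t) then Y t else P x)
    (hX : ∀ x < t + 1, X' x = if x = j then b else if x = t then X j else X x)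
    (hY : ∀ x < N, Y' x = if x = j then c else if x = t then Y j else Y x) :
    Updated N t P X Y (t + 1) P' X' Y' j a b c False := by
  intro x hx
  have h : mate N (t + 1) P' x = if x = t then t else if x = j then j else mate N t P x := by
    clear hX hY
    unfold mate fixLoc at *
    grind (splits := 25)
  have hrx := mate_range (N := N) (t := t) (P := P) x
  have hmx := mate_mate (N := N) (t := t) (P := P) (i := x) hx
  have hrt := mate_range (N := N) (t := t) (P := P) t
  have hmt := mate_mate (N := N) (t := t) (P := P) (i := t) ht
  have hrj := mate_range (N := N) (t := t) (P := P) j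
  have hmj := mate_mate (N := N) (t := t) (P := P) (i := j) (hf ▸ mate_lt ht)
  unfold Free content
  rw [h]
  replace hP := hP x hx
  clear h
  generalize mate N t P = m at *
  constructor
  · clear hP hX hY
    grind (splits := 25)
  · intro k
    have hl0 := fixLoc_spec (N := N) (t := (t + 1)) (P := P) j a
    generalize fixLoc N (t + 1) P j a = l0 at *
    have hl1 := fixLoc_spec (N := N) (t := (t + 1)) (P := P) t (Y t)
    generalize fixLoc N (t + 1) P t (Y t) = l1 at *
    grind (splits := 25)

/-- Block `t` takes its data home, and its former host `i` becomes the host of `j`. -/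
theorem updated_extend_matched_right {i : ℕ} (ht : t < N) (hf : mate N t P t = i) (hi : i ≠ t)
    (hj : t < j) (hjN : j < N) (hm : mate N t P j = j)
    (hP : ∀ x < N, P' x = if x = i then j else if x = j then i else if x = t then Y t else
      if x = fixLoc N (t + 1) P t (Y t) then Y t else P x)
    (hX : ∀ x < t + 1, X' x = if x = i then b else if x = t then X i else X x)
    (hY : ∀ x < N, Y' x = if x = i then c else if x = j then a else if x = t then Y i else Y x) :
    Updated N t P X Y (t + 1) P' X' Y' j a b c False := by
  intro x hx
  have h : mate N (t + 1) P' x = if x = i then j else if x = j then i else if x = t then t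
      else mate N t P x := by
    clear hX hY
    unfold mate fixLoc at *
    grind (splits := 25)
  have hrx := mate_range (N := N) (t := t) (P := P) x
  have hmx := mate_mate (N := N) (t := t) (P := P) (i := x) hx
  have hrt := mate_range (N := N) (t := t) (P := P) t
  have hmt := mate_mate (N := N) (t := t) (P := P) (i := t) ht
  have hrj := mate_range (N := N) (t := t) (P := P) j
  have hmj := mate_mate (N := N) (t := t) (P := P) (i := j) hjN
  unfold Free content
  rw [h]
  replace hP := hP x hx
  clear h
  generalize mate N t P = m at *
  constructor
  · clear hP hX hY
    grind (splits := 25)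
  · intro k
    have hl0 := fixLoc_spec (N := N) (t := (t + 1)) (P := P) t (Y t)
    generalize fixLoc N (t + 1) P t (Y t) = l0 at *
    grind (splits := 25)

/-- Block `t` takes its data home from `i`, then `i` relieves `j` as host of `p`, and `j` can store
its own data. -/
theorem updated_extend_matched_left {i p : ℕ} (ht : t < N) (hf : mate N t P t = i) (hi : i ≠ t)
    (hj : j < t) (hij : i ≠ j) (hp : mate N t P j = p) (hm : p ≠ j)
    (hP : ∀ x < N, P' x = if x = i then p else if x = p then i else if x = j then a else
      if x = t then Y t else if x = fixLoc N (t + 1) P j a then a else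
      if x = fixLoc N (t + 1) P t (Y t) then Y t else P x)
    (hX : ∀ x < t + 1, X' x = if x = i then X j else if x = j then b else if x = t then X i else X x)
    (hY : ∀ x < N, Y' x = if x = i then Y j else if x = j then c else if x = t then Y i else Y x) :
    Updated N t P X Y (t + 1) P' X' Y' j a b c False := by
  intro x hx
  have h : mate N (t + 1) P' x = if x = i then p else if x = p then i else if x = j then j else
      if x = t then t else mate N t P x := by
    clear hX hY
    unfold mate fixLoc at *
    grind (splits := 25)
  have hrx := mate_range (N := N) (t := t) (P := P) x
  have hmx := mate_mate (N := N) (t := t) (P := P) (i := x) hx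
  have hrt := mate_range (N := N) (t := t) (P := P) t
  have hmt := mate_mate (N := N) (t := t) (P := P) (i := t) ht
  have hrj := mate_range (N := N) (t := t) (P := P) j
  have hmj := mate_mate (N := N) (t := t) (P := P) (i := j) (by omega)
  unfold Free content
  rw [h]
  replace hP := hP x hx
  clear h
  generalize mate N t P = m at *
  constructor
  · clear hP hX hY
    grind (splits := 25)
  · intro k
    have hl0 := fixLoc_spec (N := N) (t := (t + 1)) (P := P) j a
    generalize fixLoc N (t + 1) P j a = l0 at *
    have hl1 := fixLoc_spec (N := N) (t := (t + 1)) (P := P) t (Y t)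
    generalize fixLoc N (t + 1) P t (Y t) = l1 at *
    grind (splits := 25)

/-- The left block that is not needed any more once the block `j` represents `0`. -/
def slot (N t : ℕ) (P : ℕ → ℕ) (j : ℕ) : ℕ := if j < t then j else mate N t P j

/-- The superfluous left block is the one that crosses the barrier. The pointer to itself keeps its
old first word from being read as part of a pair. -/
theorem updated_shrink_self {u : ℕ} (hu : u < N) (hj : ¬ Free N (u + 1) P j) (hjN : j < N)
    (hf : slot N (u + 1) P j = u)
    (hP : ∀ x < N, P' x = if x = u then u else P x)
    (hX : ∀ x < u, X' x = X x) (hY : ∀ x < N, Y' x = Y x) :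
    Updated N (u + 1) P X Y u P' X' Y' j 0 0 0 True := by
  intro x hx
  have h : mate N u P' x = if x = u then u else if x = j then j else mate N (u + 1) P x := by
    clear hX hY
    unfold Free slot mate at *
    grind (splits := 25)
  unfold Free content sel
  rw [h]
  unfold Free slot mate at *
  grind (splits := 25)

/-- Block `u` keeps nonzero data on the right and needs a host, which is `f`. Its first word moves
to `Y u` to make room for the pointer. Redirecting `P f` also dissolves a former pair of `f` with
`j`. -/
theorem updated_shrink_unmatched {u f : ℕ} (hu : u < N) (hj : ¬ Free N (u + 1) P j) (hjN : j < N)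
    (hf : slot N (u + 1) P j = f) (hfu : f ≠ u) (hm : mate N (u + 1) P u = u)
    (hP : ∀ x < N, P' x = if x = f then u else if x = u then f else P x)
    (hX : ∀ x < u, X' x = if x = f then X u else X x)
    (hY : ∀ x < N, Y' x = if x = f then Y u else if x = u then P u else Y x) :
    Updated N (u + 1) P X Y u P' X' Y' j 0 0 0 True := by
  intro x hx
  have h : mate N u P' x = if x = u then f else if x = f then u else if x = j then j
      else mate N (u + 1) P x := by
    clear hX hY
    unfold Free slot mate at *
    grind (splits := 25)
  unfold Free content sel
  rw [h]
  unfold Free slot mate at *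
  grind (splits := 25)

/-- Block `u` hosts data of `p`; it hands them over to `f` and becomes an unmatched right block. -/
theorem updated_shrink_matched {u f p : ℕ} (hu : u < N) (hj : ¬ Free N (u + 1) P j) (hjN : j < N)
    (hf : slot N (u + 1) P j = f) (hfu : f ≠ u) (hp : mate N (u + 1) P u = p) (hm : p ≠ u)
    (hP : ∀ x < N, P' x = if x = f then p else if x = p then f else if x = u then u else P x)
    (hX : ∀ x < u, X' x = if x = f then X u else X x)
    (hY : ∀ x < N, Y' x = if x = f then Y u else Y x) :
    Updated N (u + 1) P X Y u P' X' Y' j 0 0 0 True := by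
  intro x hx
  have h : mate N u P' x = if x = f then p else if x = p then f else if x = u then u else
      if x = j then j else mate N (u + 1) P x := by
    clear hX hY
    unfold Free slot mate at *
    grind (splits := 25)
  unfold Free content sel
  rw [h]
  unfold Free slot mate at *
  grind (splits := 25)

end

/-! ### Memory layout, rank order and search on the level of natural numbers -/

/-- The words of a memory from address `base` on. -/
def words {w : ℕ} (base : ℕ) (M : Mem w) (k : ℕ) : ℕ := (M (BitVec.ofNat w (base + k))).toNat

/-- The number of blocks of three words. -/
def blocks (w n : ℕ) : ℕ := n / w / 3

/-- The barrier: the number of blocks with nonzero data. It is stored in the last block,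
unless bit `n` says that all blocks have nonzero data. -/
def barrier (w n : ℕ) (A : ℕ → ℕ) : ℕ :=
  if blocks w n = 0 then 0
  else if (A (n / w)).testBit (n % w) then blocks w n else A (3 * blocks w n - 2)

/-- The block matched with block `i`, or `i` itself if there is none. -/
def partner (w n : ℕ) (A : ℕ → ℕ) (i : ℕ) : ℕ :=
  mate (blocks w n) (barrier w n A) (fun i => A (3 * i)) i

/-- The `k`-th word of the data of block `j`. -/
def data (w n : ℕ) (A : ℕ → ℕ) (j k : ℕ) : ℕ :=
  content (blocks w n) (barrier w n A) (fun i => A (3 * i)) (fun i => A (3 * i + 1))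
    (fun i => A (3 * i + 2)) j k

/-- The `k`-th word of the represented bit vector. -/
def plainWord (w n : ℕ) (A : ℕ → ℕ) (k : ℕ) : ℕ :=
  if k < 3 * blocks w n then data w n A (k / 3) (k % 3) else A k

/-- The `k`-th word of the bit vector in which the data of each block on the left of the
barrier are replaced by those of its partner, and the blocks on the right by `0`. -/
def rankWord (w n : ℕ) (A : ℕ → ℕ) (k : ℕ) : ℕ :=
  if k < 3 * blocks w n then
    if k / 3 < barrier w n A then
      if k % 3 = 0 then
        if partner w n A (k / 3) = k / 3 then A k else A (3 * partner w n A (k / 3) + 2)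
      else A k
    else 0
  else if k = n / w then A k % 2 ^ (n % w) else A k

/-- The position of the lowest bit that is set in `x`. -/
def lsb (x : ℕ) : ℕ := Nat.log 2 (x - (x &&& (x - 1)))

/-- The index of the next word in an enumeration of the words by rank. -/
def succWord (w n : ℕ) (A : ℕ → ℕ) (k : ℕ) : ℕ :=
  if k + 1 < 3 * barrier w n A then k + 1
  else if k + 1 < 3 * blocks w n then 3 * blocks w n else k + 1

/-- The position of the first bit that is set in the first nonzero one of at most `f` words
from word `k` on; `n` if there is none. -/
def scan (w n : ℕ) (A : ℕ → ℕ) : ℕ → ℕ → ℕ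
  | 0, _ => n
  | f + 1, k =>
    if rankWord w n A k = 0 then if k < n / w then scan w n A f (succWord w n A k) else n
    else k * w + lsb (rankWord w n A k)

/-- The first position from `p` on with a set bit; `n` if there is none. -/
def search (w n : ℕ) (A : ℕ → ℕ) (p : ℕ) : ℕ :=
  if n / w < p / w then n
  else if (rankWord w n A (p / w) >>> (p % w)) <<< (p % w) = 0 then
    if p / w < n / w then scan w n A 7 (succWord w n A (p / w)) else n
  else p / w * w + lsb ((rankWord w n A (p / w) >>> (p % w)) <<< (p % w))

/-- The element of the client set that belongs to the rank position `p`. -/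
def elemAt (w n : ℕ) (A : ℕ → ℕ) (p : ℕ) : ℕ :=
  if p / w < 3 * blocks w n then
    (3 * partner w n A (p / w / 3) + p / w % 3) * w + p % w + 1
  else p + 1

/-- With `x = 2 ^ a * (2 * b + 1)`, subtracting 1 clears bit `a` and changes nothing above it; so
the conjunction removes just the lowest one. -/
theorem exists_sub_and_eq_two_pow {x : ℕ} (hx : x ≠ 0) : ∃ a, x - (x &&& (x - 1)) = 2 ^ a ∧
    x.testBit a = true ∧ ∀ b < a, x.testBit b = false := by
  obtain ⟨a, m, hm, rfl⟩ := Nat.exists_eq_two_pow_mul_odd hx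
  obtain ⟨b, rfl⟩ := hm
  have h1 : 2 ^ a * (2 * b + 1) = 2 ^ (a + 1) * b + 2 ^ a := by ring
  have hlt : 2 ^ a < 2 ^ (a + 1) := Nat.pow_lt_pow_right (by omega) (by omega)
  have hpos : 0 < 2 ^ a := by positivity
  refine ⟨a, ?_, ?_, ?_⟩
  · have h2 : 2 ^ a * (2 * b + 1) &&& (2 ^ a * (2 * b + 1) - 1) = 2 ^ (a + 1) * b := by
      rw [h1, Nat.add_sub_assoc hpos]
      refine Nat.eq_of_testBit_eq fun i => ?_
      rw [Nat.testBit_and, Nat.testBit_two_pow_mul_add _ hlt,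
        Nat.testBit_two_pow_mul_add _ (by omega), Nat.testBit_two_pow_mul]
      split_ifs with h
      · rw [Nat.testBit_two_pow, Nat.testBit_two_pow_sub_one]
        have : ¬ (a + 1 ≤ i) := by omega
        simp [this]
        omega
      · simp
        omega
    rw [h2, h1, Nat.add_sub_cancel_left]
  · simp [Nat.testBit_two_pow_mul]
  · intro i hi
    simp [Nat.testBit_two_pow_mul, hi]

theorem two_pow_lsb {x : ℕ} (hx : x ≠ 0) : x - (x &&& (x - 1)) = 2 ^ lsb x := by
  obtain ⟨a, h, -⟩ := exists_sub_and_eq_two_pow hx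
  rw [lsb, h, Nat.log_pow (by omega)]

theorem testBit_lsb {x : ℕ} (hx : x ≠ 0) : x.testBit (lsb x) = true := by
  obtain ⟨a, h, h1, -⟩ := exists_sub_and_eq_two_pow hx
  rwa [lsb, h, Nat.log_pow (by omega)]

theorem testBit_lt_lsb {x b : ℕ} (hx : x ≠ 0) (hb : b < lsb x) : x.testBit b = false := by
  obtain ⟨a, h, -, h1⟩ := exists_sub_and_eq_two_pow hx
  rw [lsb, h, Nat.log_pow (by omega)] at hb
  exact h1 b hb

theorem lsb_lt {w x : ℕ} (hx : x ≠ 0) (hw : x < 2 ^ w) : lsb x < w := by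
  by_contra! h
  have := testBit_lsb hx
  rw [Nat.testBit_lt_two_pow (hw.trans_le (Nat.pow_le_pow_right (by omega) h))] at this
  simp at this

/-! ### Expressions that read the dictionary, and their correctness -/

namespace Expr

section defs

variable (W c : ℕ)

/-- The word length. -/
def wordLen : Expr := log W c (ones - ones >>> (1 : Expr)) + 1

/-- The index of the last word of the dictionary. -/
def lastWord : Expr := reg 1 / wordLen W c

/-- The number of bits of the dictionary in its last word, without bit `n`. -/
def lastBits : Expr := reg 1 % wordLen W c

/-- The number of blocks; `3` is a proper constant only if the word length is at least `2`. -/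
def numBlocks : Expr := iteEq 2 0 0 (lastWord W c / 3)

/-- The number of words that belong to blocks. -/
def numBlockWords : Expr := 3 * numBlocks W c

/-- The `k`-th word of the dictionary. -/
def word (k : Expr) : Expr := load (reg 0 + k)

/-- The `m`-th bit of a word. -/
def bitAt (x m : Expr) : Expr := (x >>> m) &&& 1

def barrier : Expr :=
  iteEq (numBlocks W c) 0 0
    (iteEq (bitAt (word (lastWord W c)) (lastBits W c)) 1 (numBlocks W c)
      (word (numBlockWords W c - 2)))

/-- The first pointer is compared with the number of blocks before it is followed, since `3 * P i`
is exact only for a valid block index. The two innermost tests together express that the barrier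
separates the two blocks. -/
def partner (i : Expr) : Expr :=
  iteLt (word (3 * i)) (numBlocks W c)
    (iteEq (word (3 * word (3 * i))) i
      (iteLt i (barrier W c) (iteLt (word (3 * i)) (barrier W c) i (word (3 * i)))
        (iteLt (word (3 * i)) (barrier W c) (word (3 * i)) i)) i) i

def data (j k : Expr) : Expr :=
  iteLt j (barrier W c) (iteEq (partner W c j) j (word (3 * j + k)) 0)
    (iteEq (partner W c j) j 0
      (iteEq k 0 (word (3 * j + 2)) (word (3 * partner W c j + k))))

def plainWord (k : Expr) : Expr :=
  iteLt k (numBlockWords W c) (data W c (k / 3) (k % 3)) (word k)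

def rankWord (k : Expr) : Expr :=
  iteLt k (numBlockWords W c)
    (iteLt (k / 3) (barrier W c)
      (iteEq (k % 3) 0
        (iteEq (partner W c (k / 3)) (k / 3) (word k) (word (3 * partner W c (k / 3) + 2)))
        (word k)) 0)
    (iteEq k (lastWord W c) (word k % ((1 : Expr) <<< lastBits W c)) (word k))

def lsb (x : Expr) : Expr := log W c (x - (x &&& (x - 1)))

def succWord (k : Expr) : Expr :=
  iteLt (k + 1) (3 * barrier W c) (k + 1)
    (iteLt (k + 1) (numBlockWords W c) (numBlockWords W c) (k + 1))

/-- The recursion on the number of words unfolds when the expression is built; for a fixed number of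
words the size is constant. -/
def scan : ℕ → Expr → Expr
  | 0, _ => reg 1
  | f + 1, k =>
    iteEq (rankWord W c k) 0 (iteLt k (lastWord W c) (scan f (succWord W c k)) (reg 1))
      (k * wordLen W c + lsb W c (rankWord W c k))

/-- The word `k` by rank, without its lowest `m` bits. -/
def highPart (k m : Expr) : Expr := (rankWord W c k >>> m) <<< m

def search (p : Expr) : Expr :=
  iteLt (lastWord W c) (p / wordLen W c) (reg 1)
    (iteEq (highPart W c (p / wordLen W c) (p % wordLen W c)) 0
      (iteLt (p / wordLen W c) (lastWord W c)
        (scan W c 7 (succWord W c (p / wordLen W c))) (reg 1))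
      (p / wordLen W c * wordLen W c +
        lsb W c (highPart W c (p / wordLen W c) (p % wordLen W c))))

def elemAt (p : Expr) : Expr :=
  iteLt (p / wordLen W c) (numBlockWords W c)
    ((3 * partner W c (p / wordLen W c / 3) + p / wordLen W c % 3) * wordLen W c +
      p % wordLen W c + 1)
    (p + 1)

end defs

end Expr

/-- The inputs of a call of an operation on a dictionary for universe size `n` that fits into the
memory from word `base` on, on a machine on which `Expr.log W c` computes logarithms of powers
of two. -/
structure Setup (W c : ℕ) {w : ℕ} (Γ : Ctx w) (n base : ℕ) : Prop where
  one_le : 1 ≤ n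
  lt_two_pow : n < 2 ^ w
  fits : base * w + (n + 1) ≤ 2 ^ w * w
  reg_zero : Γ.regs 0 = BitVec.ofNat w base
  reg_one : Γ.regs 1 = BitVec.ofNat w n
  val_log : ∀ (x : Expr) (k : ℕ), k < w → x.val Γ = 2 ^ k → (Expr.log W c x).val Γ = k

theorem blocks_le (w n : ℕ) : 3 * blocks w n ≤ n / w := Nat.mul_div_le _ _

namespace Setup

variable {W c w n base : ℕ} {Γ : Ctx w} (h : Setup W c Γ n base)

include h

theorem one_le_wordLen : 1 ≤ w := by
  have h1 := h.lt_two_pow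
  have h2 := h.one_le
  by_contra! h3
  obtain rfl : w = 0 := by omega
  simp at h1
  omega

theorem last_lt : n / w < 2 ^ w := (Nat.div_le_self _ _).trans_lt h.lt_two_pow

theorem base_add_last_lt : base + n / w < 2 ^ w := by
  have hw := h.one_le_wordLen
  have h1 := h.fits
  have h2 : (base + n / w) * w ≤ base * w + n := by
    rw [add_mul]
    exact Nat.add_le_add_left (Nat.div_mul_le_self _ _) _
  exact Nat.lt_of_mul_lt_mul_right (a := w) (by omega)

theorem base_lt : base < 2 ^ w := (Nat.le_add_right _ _).trans_lt h.base_add_last_lt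

/-- A block requires `3 * w ≤ n < 2 ^ w`, which fails for shorter words. So the small constants in
address computations are exact whenever there is a block. -/
theorem four_le (hN : 0 < blocks w n) : 4 ≤ w := by
  have hw := h.one_le_wordLen
  have h1 : 3 ≤ n / w := by
    by_contra! h2
    rw [blocks, Nat.div_eq_of_lt h2] at hN
    omega
  have h2 : 3 * w ≤ n := (Nat.le_div_iff_mul_le hw).1 h1
  have h3 := h.lt_two_pow
  by_contra! h4
  interval_cases w <;> omega

theorem eight_lt (hN : 0 < blocks w n) : 8 < 2 ^ w :=
  lt_of_lt_of_le (by norm_num) (Nat.pow_le_pow_right (by omega) (h.four_le hN))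

end Setup

theorem words_lt {w base : ℕ} (M : Mem w) (k : ℕ) : words base M k < 2 ^ w := BitVec.isLt _

theorem rankWord_lt {w n : ℕ} {A : ℕ → ℕ} (hA : ∀ k, A k < 2 ^ w) (k : ℕ) :
    rankWord w n A k < 2 ^ w := by
  unfold rankWord
  split_ifs <;> first | exact hA _ | positivity | exact (Nat.mod_le _ _).trans_lt (hA _)

/-- The last rank word is cut off before bit `n`, so neither the flag nor foreign bits are found by
a search, and every position found fits into a word. -/
theorem rankPos_lt {w n k m : ℕ} {A : ℕ → ℕ} (hA : ∀ k, A k < 2 ^ w)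
    (hk : k ≤ n / w) (hm : (rankWord w n A k).testBit m = true) : k * w + m < n := by
  have hlt : ∀ b, rankWord w n A k < 2 ^ b → m < b := by
    intro b hb
    by_contra! h
    rw [Nat.testBit_lt_two_pow (hb.trans_le (Nat.pow_le_pow_right (by omega) h))] at hm
    simp at hm
  have h1 := Nat.div_add_mod' n w
  rcases hk.lt_or_eq with h | rfl
  · have h2 := hlt w (rankWord_lt hA k)
    have h3 : (k + 1) * w ≤ n / w * w := Nat.mul_le_mul_right _ h
    rw [add_mul] at h3
    omega
  · have h2 := hlt (n % w) (by
      have := blocks_le w n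
      rw [rankWord, if_neg (by omega), if_pos rfl]
      exact Nat.mod_lt _ (by positivity))
    omega

theorem partner_lt {w n : ℕ} {A : ℕ → ℕ} {i : ℕ} (hi : i < blocks w n) :
    partner w n A i < blocks w n :=
  mate_lt hi

theorem succWord_le {w n : ℕ} {A : ℕ → ℕ} {k : ℕ} (hk : k < n / w) : succWord w n A k ≤ n / w := by
  have := blocks_le w n
  unfold succWord
  split_ifs <;> omega

namespace Setup

variable {W c w n base : ℕ} {Γ : Ctx w} (h : Setup W c Γ n base)

include h

theorem val_reg_zero : (Expr.reg 0).val Γ = base := by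
  change (Γ.regs 0).toNat = base
  rw [h.reg_zero, BitVec.toNat_ofNat, Nat.mod_eq_of_lt h.base_lt]

theorem val_reg_one : (Expr.reg 1).val Γ = n := by
  change (Γ.regs 1).toNat = n
  rw [h.reg_one, BitVec.toNat_ofNat, Nat.mod_eq_of_lt h.lt_two_pow]

theorem val_two (hN : 0 < blocks w n) : Expr.val Γ 2 = 2 :=
  Expr.val_const (k := 2) (lt_trans (by norm_num) (h.eight_lt hN))

theorem val_three (hN : 0 < blocks w n) : Expr.val Γ 3 = 3 :=
  Expr.val_const (k := 3) (lt_trans (by norm_num) (h.eight_lt hN))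

theorem val_wordLen : (Expr.wordLen W c).val Γ = w := by
  have hw := h.one_le_wordLen
  have h1 := Expr.val_one (Γ := Γ) hw
  have h2 := Expr.val_ones (Γ := Γ) hw
  have h3 : 2 ^ w = 2 ^ (w - 1) * 2 := by rw [← pow_succ]; congr 1; omega
  have h4 : (Expr.ones >>> (1 : Expr)).val Γ = 2 ^ (w - 1) - 1 := by
    rw [Expr.val_shr, h2, h1, Nat.shiftRight_one]
    omega
  have h5 : (Expr.log W c (Expr.ones - Expr.ones >>> (1 : Expr))).val Γ = w - 1 := by
    refine h.val_log _ _ (by omega) ?_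
    rw [Expr.val_sub (by rw [h2, h4]; omega), h2, h4]
    have : 0 < 2 ^ (w - 1) := by positivity
    omega
  have hww : w < 2 ^ w := Nat.lt_two_pow_self
  rw [Expr.wordLen, Expr.val_add (by rw [h5, h1]; omega), h5, h1]
  omega

theorem val_lastWord : (Expr.lastWord W c).val Γ = n / w := by
  rw [Expr.lastWord, Expr.val_div, h.val_reg_one, h.val_wordLen]

theorem val_lastBits : (Expr.lastBits W c).val Γ = n % w := by
  rw [Expr.lastBits, Expr.val_mod, h.val_reg_one, h.val_wordLen]

theorem val_numBlocks : (Expr.numBlocks W c).val Γ = blocks w n := by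
  have hw := h.one_le_wordLen
  rw [Expr.numBlocks, Expr.val_iteEq, Expr.val_zero]
  rcases hw.lt_or_eq with hw2 | rfl
  · have h4 : 4 ≤ 2 ^ w := (Nat.pow_le_pow_right (by omega) hw2 : 2 ^ 2 ≤ 2 ^ w)
    have e2 : Expr.val Γ 2 = 2 := Expr.val_const (k := 2) (by omega)
    have e3 : Expr.val Γ 3 = 3 := Expr.val_const (k := 3) (by omega)
    rw [e2, if_neg (by omega), Expr.val_div, h.val_lastWord, e3, blocks]
  -- For `w = 1` the constant 2 wraps around to 0; this is how the expression recognizes that case,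
  -- in which `n = 1` leaves no block.
  · have e2 : Expr.val Γ 2 = 0 := rfl
    have h1 := h.lt_two_pow
    rw [if_pos e2, blocks, Nat.div_div_eq_div_mul, Nat.div_eq_of_lt (by omega)]

theorem val_numBlockWords : (Expr.numBlockWords W c).val Γ = 3 * blocks w n := by
  rcases Nat.eq_zero_or_pos (blocks w n) with h0 | h0
  · have : Expr.val Γ 3 * (Expr.numBlocks W c).val Γ = 0 := by rw [h.val_numBlocks, h0, mul_zero]
    rw [Expr.numBlockWords, Expr.val_mul (by rw [this]; positivity), this, h0]
  · have h3 : Expr.val Γ 3 = 3 := h.val_three h0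
    have := (blocks_le w n).trans_lt h.last_lt
    rw [Expr.numBlockWords, Expr.val_mul, h3, h.val_numBlocks]
    rwa [h3, h.val_numBlocks]

theorem val_word (k : Expr) : (Expr.word k).val Γ = words base Γ.mem (k.val Γ) := by
  rw [Expr.word, Expr.val_load, words]
  congr 2
  change BitVec.ofNat w ((Γ.regs 0 + k.eval Γ).toNat) = _
  rw [BitVec.ofNat_toNat, BitVec.setWidth_eq, h.reg_zero, BitVec.ofNat_add]
  congr 1
  simp [Expr.val]

theorem val_bitAt (x m : Expr) :
    (Expr.bitAt x m).val Γ = ((x.val Γ).testBit (m.val Γ)).toNat := by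
  rw [Expr.bitAt, Expr.val_and, Expr.val_shr, Expr.val_one h.one_le_wordLen, Nat.and_one_is_mod,
    Nat.shiftRight_eq_div_pow, Nat.toNat_testBit]

theorem val_barrier : (Expr.barrier W c).val Γ = barrier w n (words base Γ.mem) := by
  rw [Expr.barrier, barrier, Expr.val_iteEq, Expr.val_iteEq, h.val_numBlocks, Expr.val_zero,
    h.val_bitAt, h.val_word, h.val_lastWord, h.val_lastBits, Expr.val_one h.one_le_wordLen,
    h.val_word]
  split_ifs with h1 h2 h3 h3
  · rfl
  · rfl
  · simp [h3] at h2
  · simp [h3] at h2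
  · have e2 : Expr.val Γ 2 = 2 := h.val_two (by omega)
    rw [Expr.val_sub, h.val_numBlockWords, e2]
    rw [h.val_numBlockWords, e2]
    omega

theorem val_three_mul_add {i k : Expr} (hi : i.val Γ < blocks w n) (hk : k.val Γ < 3) :
    (3 * i + k).val Γ = 3 * i.val Γ + k.val Γ := by
  have h3 : Expr.val Γ 3 = 3 := h.val_three (by omega)
  have h1 := blocks_le w n
  have h2 := h.last_lt
  have e : (3 * i).val Γ = 3 * i.val Γ := by
    rw [Expr.val_mul, h3]
    rw [h3]; omega
  rw [Expr.val_add, e]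
  rw [e]; omega

theorem val_three_mul {i : Expr} (hi : i.val Γ < blocks w n) :
    (3 * i).val Γ = 3 * i.val Γ := by
  have h3 : Expr.val Γ 3 = 3 := h.val_three (by omega)
  have h1 := blocks_le w n
  have h2 := h.last_lt
  rw [Expr.val_mul, h3]
  rw [h3]; omega

theorem val_partner {i : Expr} (hi : i.val Γ < blocks w n) :
    (Expr.partner W c i).val Γ = partner w n (words base Γ.mem) (i.val Γ) := by
  have e1 : (Expr.word (3 * i)).val Γ = words base Γ.mem (3 * i.val Γ) := by
    rw [h.val_word, h.val_three_mul hi]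
  unfold Expr.partner partner mate
  simp only [Expr.val_iteLt, Expr.val_iteEq, e1, h.val_numBlocks, h.val_barrier, h.val_word]
  by_cases h1 : words base Γ.mem (3 * i.val Γ) < blocks w n
  · rw [h.val_three_mul (by rwa [e1]), e1]
    grind
  · simp [h1]

theorem val_data {j k : Expr} (hj : j.val Γ < blocks w n) (hk : k.val Γ < 3) :
    (Expr.data W c j k).val Γ = data w n (words base Γ.mem) (j.val Γ) (k.val Γ) := by
  have h2 : Expr.val Γ 2 = 2 := h.val_two (by omega)
  have e1 := h.val_partner hj
  have e2 : (Expr.partner W c j).val Γ < blocks w n := by rw [e1]; exact partner_lt hj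
  unfold Expr.data data content sel
  simp only [Expr.val_iteLt, Expr.val_iteEq, h.val_barrier, h.val_word, Expr.val_zero,
    h.val_three_mul_add hj hk, h.val_three_mul_add e2 hk, h.val_three_mul_add hj (k := 2) (by omega),
    e1, h2]
  unfold partner
  have : k.val Γ = 0 ∨ k.val Γ = 1 ∨ k.val Γ = 2 := by omega
  rcases this with h3 | h3 | h3 <;> simp [h3]

theorem val_div_three {k : Expr} (hk : k.val Γ < 3 * blocks w n) :
    (k / 3).val Γ = k.val Γ / 3 := by
  rw [Expr.val_div, h.val_three (by omega)]

theorem val_mod_three {k : Expr} (hk : k.val Γ < 3 * blocks w n) :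
    (k % 3).val Γ = k.val Γ % 3 := by
  rw [Expr.val_mod, h.val_three (by omega)]

theorem val_plainWord (k : Expr) :
    (Expr.plainWord W c k).val Γ = plainWord w n (words base Γ.mem) (k.val Γ) := by
  unfold Expr.plainWord plainWord
  rw [Expr.val_iteLt, h.val_numBlockWords, h.val_word]
  split_ifs with h1
  · have e1 := h.val_div_three h1
    have e2 := h.val_mod_three h1
    rw [h.val_data (by omega) (by omega), e1, e2]
  · rfl

theorem val_two_pow_lastBits : ((1 : Expr) <<< Expr.lastBits W c).val Γ = 2 ^ (n % w) := by
  have h1 := h.val_lastBits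
  have h2 : n % w < w := Nat.mod_lt _ h.one_le_wordLen
  rw [Expr.val_one_shl (by omega), h1]

theorem val_rankWord (k : Expr) :
    (Expr.rankWord W c k).val Γ = rankWord w n (words base Γ.mem) (k.val Γ) := by
  unfold Expr.rankWord rankWord
  rw [Expr.val_iteLt, h.val_numBlockWords, Expr.val_iteEq, Expr.val_mod, h.val_word, h.val_lastWord,
    h.val_two_pow_lastBits]
  split_ifs with h1 h2 h3 h4 h5
  all_goals try rfl
  all_goals
    have e1 := h.val_div_three h1
    have e2 := h.val_mod_three h1
    have e3 := h.val_partner (i := k / 3) (by omega)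
    have e4 := partner_lt (w := w) (n := n) (A := words base Γ.mem) (i := (k / 3).val Γ) (by omega)
    have e5 : Expr.val Γ 2 = 2 := h.val_two (by omega)
    simp only [Expr.val_iteLt, Expr.val_iteEq, e1, e2, e3, h.val_barrier, Expr.val_zero]
    rw [e1] at e3 e4
    simp_all [h.val_word]
  rw [h.val_three_mul_add (by omega) (by omega), e3, e5]

theorem val_lsb {x : Expr} (hx : x.val Γ ≠ 0) : (Expr.lsb W c x).val Γ = lsb (x.val Γ) := by
  refine h.val_log _ _ (lsb_lt hx (Expr.val_lt x)) ?_
  have h1 := Expr.val_one (Γ := Γ) h.one_le_wordLen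
  have h2 : (x - 1).val Γ = x.val Γ - 1 := by rw [Expr.val_sub (by omega), h1]
  rw [Expr.val_sub, Expr.val_and, h2, two_pow_lsb hx]
  rw [Expr.val_and]
  exact Nat.and_le_left

theorem val_succ {k : Expr} (hk : k.val Γ < n / w) : (k + 1).val Γ = k.val Γ + 1 := by
  have h1 := Expr.val_one (Γ := Γ) h.one_le_wordLen
  have := h.last_lt
  rw [Expr.val_add, h1]
  rw [h1]; omega

theorem val_succWord {k : Expr} (hk : k.val Γ < n / w)
    (hb : barrier w n (words base Γ.mem) ≤ blocks w n) :
    (Expr.succWord W c k).val Γ = succWord w n (words base Γ.mem) (k.val Γ) := by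
  have e : (3 * Expr.barrier W c).val Γ = 3 * barrier w n (words base Γ.mem) := by
    rcases Nat.eq_zero_or_pos (blocks w n) with h0 | h0
    · have h1 : (Expr.barrier W c).val Γ = 0 := by rw [h.val_barrier]; omega
      rw [Expr.val_mul, h1]
      · omega
      · rw [h1]; positivity
    · have h3 : Expr.val Γ 3 = 3 := h.val_three h0
      have := blocks_le w n
      have := h.last_lt
      rw [Expr.val_mul, h3, h.val_barrier]
      rw [h3, h.val_barrier]
      omega
  rw [Expr.succWord, Expr.val_iteLt, Expr.val_iteLt, e, h.val_succ hk, h.val_numBlockWords]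
  rfl

theorem val_mul_add {k m : Expr} (hlt : k.val Γ * w + m.val Γ < 2 ^ w) :
    (k * Expr.wordLen W c + m).val Γ = k.val Γ * w + m.val Γ := by
  have e : (k * Expr.wordLen W c).val Γ = k.val Γ * w := by
    rw [Expr.val_mul, h.val_wordLen]
    rw [h.val_wordLen]; omega
  rw [Expr.val_add, e]
  rw [e]; omega

theorem val_scan (hb : barrier w n (words base Γ.mem) ≤ blocks w n) (f : ℕ) {k : Expr}
    (hk : k.val Γ ≤ n / w) :
    (Expr.scan W c f k).val Γ = scan w n (words base Γ.mem) f (k.val Γ) := by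
  induction f generalizing k with
  | zero => exact h.val_reg_one
  | succ f ih =>
    rw [Expr.scan, scan, Expr.val_iteEq, Expr.val_iteLt, h.val_rankWord, h.val_lastWord,
      h.val_reg_one, Expr.val_zero]
    split_ifs with h1 h2
    · have e := h.val_succWord h2 hb
      rw [ih, e]
      rw [e]
      exact succWord_le h2
    · rfl
    · have e := h.val_lsb (x := Expr.rankWord W c k) (by rwa [h.val_rankWord])
      rw [h.val_rankWord] at e
      rw [h.val_mul_add, e]
      rw [e]
      exact (rankPos_lt (words_lt _) hk (testBit_lsb h1)).trans h.lt_two_pow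

theorem val_search (hb : barrier w n (words base Γ.mem) ≤ blocks w n) (p : Expr) :
    (Expr.search W c p).val Γ = search w n (words base Γ.mem) (p.val Γ) := by
  have e1 : (p / Expr.wordLen W c).val Γ = p.val Γ / w := by rw [Expr.val_div, h.val_wordLen]
  have e2 : (p % Expr.wordLen W c).val Γ = p.val Γ % w := by rw [Expr.val_mod, h.val_wordLen]
  have e3 : (Expr.highPart W c (p / Expr.wordLen W c) (p % Expr.wordLen W c)).val Γ =
      (rankWord w n (words base Γ.mem) (p.val Γ / w) >>> (p.val Γ % w)) <<< (p.val Γ % w) := by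
    have : (rankWord w n (words base Γ.mem) (p.val Γ / w) >>> (p.val Γ % w)) <<< (p.val Γ % w) ≤
        rankWord w n (words base Γ.mem) (p.val Γ / w) := by
      rw [Nat.shiftRight_eq_div_pow, Nat.shiftLeft_eq]
      exact Nat.div_mul_le_self _ _
    rw [Expr.highPart, Expr.val_shl, Expr.val_shr, h.val_rankWord, e1, e2]
    rw [Expr.val_shr, h.val_rankWord, e1, e2]
    exact this.trans_lt (rankWord_lt (words_lt _) _)
  rw [Expr.search, search, Expr.val_iteLt, Expr.val_iteEq, Expr.val_iteLt, h.val_lastWord, e1, e3,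
    h.val_reg_one, Expr.val_zero]
  split_ifs with h1 h2 h3
  · rfl
  · have e := h.val_succWord (k := p / Expr.wordLen W c) (by rwa [e1]) hb
    rw [e1] at e
    rw [h.val_scan hb, e]
    rw [e]
    exact succWord_le h3
  · rfl
  · have e := h.val_lsb (by rwa [← e3] at h2)
    rw [e3] at e
    rw [h.val_mul_add, e, e1]
    rw [e, e1]
    have hbit := testBit_lsb h2
    have h5 : (rankWord w n (words base Γ.mem) (p.val Γ / w)).testBit
        (lsb ((rankWord w n (words base Γ.mem) (p.val Γ / w) >>> (p.val Γ % w)) <<<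
          (p.val Γ % w))) = true := by
      generalize lsb _ = b at *
      rw [Nat.testBit_shiftLeft, Nat.testBit_shiftRight] at hbit
      simp only [ge_iff_le, Bool.and_eq_true, decide_eq_true_eq] at hbit
      rw [← hbit.2]
      congr 1
      omega
    exact (rankPos_lt (words_lt _) (by omega) h5).trans h.lt_two_pow

theorem elemAt_le {A : ℕ → ℕ} {p : ℕ} (hp : p < n) : elemAt w n A p ≤ n := by
  unfold elemAt
  split_ifs with h1
  · have h2 := partner_lt (w := w) (n := n) (A := A) (i := p / w / 3) (by omega)
    have h3 := blocks_le w n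
    have h4 : (3 * partner w n A (p / w / 3) + p / w % 3 + 1) * w ≤ n / w * w :=
      Nat.mul_le_mul_right _ (by omega)
    have h5 := Nat.div_mul_le_self n w
    have h6 : p % w < w := Nat.mod_lt _ h.one_le_wordLen
    rw [add_mul] at h4
    omega
  · exact hp

theorem val_elemAt {p : Expr} (hp : p.val Γ < n) :
    (Expr.elemAt W c p).val Γ = elemAt w n (words base Γ.mem) (p.val Γ) := by
  have hle := h.elemAt_le (A := words base Γ.mem) hp
  have hn := h.lt_two_pow
  have h1 := Expr.val_one (Γ := Γ) h.one_le_wordLen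
  have e1 : (p / Expr.wordLen W c).val Γ = p.val Γ / w := by rw [Expr.val_div, h.val_wordLen]
  have e2 : (p % Expr.wordLen W c).val Γ = p.val Γ % w := by rw [Expr.val_mod, h.val_wordLen]
  unfold elemAt at *
  rw [Expr.elemAt, Expr.val_iteLt, e1, h.val_numBlockWords]
  split_ifs with h2
  · rw [if_pos h2] at hle
    have e3 := h.val_div_three (k := p / Expr.wordLen W c) (by rwa [e1])
    have e4 := h.val_mod_three (k := p / Expr.wordLen W c) (by rwa [e1])
    have e5 := h.val_partner (i := p / Expr.wordLen W c / 3) (by omega)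
    have e6 := partner_lt (w := w) (n := n) (A := words base Γ.mem) (i := p.val Γ / w / 3) (by omega)
    rw [e3, e1] at e5
    rw [e1] at e4
    have e7 := h.val_three_mul_add (i := Expr.partner W c (p / Expr.wordLen W c / 3))
      (k := p / Expr.wordLen W c % 3) (by omega) (by omega)
    rw [e5, e4] at e7
    have e8 := h.val_mul_add (k := 3 * Expr.partner W c (p / Expr.wordLen W c / 3) +
      p / Expr.wordLen W c % 3) (m := p % Expr.wordLen W c) (by rw [e7, e2]; omega)
    rw [e7, e2] at e8
    rw [Expr.val_add, e8, h1]
    rw [e8, h1]; omega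
  · rw [Expr.val_add, h1]
    rw [h1]; omega

end Setup

/-! ### The represented set, its enumeration by rank, and correctness of the search -/

/-- The words `A` represent a set: unless a block has no room for data, its data are nonzero. -/
structure Valid (w n : ℕ) (A : ℕ → ℕ) : Prop where
  barrier_le : barrier w n A ≤ blocks w n
  full : barrier w n A = blocks w n → blocks w n = 0 ∨ (A (n / w)).testBit (n % w) = true
  occupied : ∀ j < blocks w n, Free (blocks w n) (barrier w n A) (fun i => A (3 * i)) j ∨
    ∃ k < 3, data w n A j k ≠ 0

/-- Bit `p` of the represented bit vector. -/
def plainBit (w n : ℕ) (A : ℕ → ℕ) (p : ℕ) : Bool := (plainWord w n A (p / w)).testBit (p % w)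

/-- Bit `p` of the bit vector ordered by rank. -/
def rankBit (w n : ℕ) (A : ℕ → ℕ) (p : ℕ) : Bool := (rankWord w n A (p / w)).testBit (p % w)

/-- The represented set. -/
def client (w n : ℕ) (A : ℕ → ℕ) : Finset ℕ :=
  (Finset.Icc 1 n).filter fun l => plainBit w n A (l - 1) = true

/-- The exchange of positions in matched blocks. -/
def flip (w n : ℕ) (A : ℕ → ℕ) (p : ℕ) : ℕ :=
  if p / w < 3 * blocks w n then (3 * partner w n A (p / w / 3) + p / w % 3) * w + p % w else p

/-- The elements of the represented set with a rank position smaller than `σ`. -/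
def enumSet (w n : ℕ) (A : ℕ → ℕ) (σ : ℕ) : Finset ℕ :=
  ((Finset.range n).filter fun p => p < σ ∧ rankBit w n A p = true).image (elemAt w n A)

/-- `r` is the first position from `p` on at which `b` holds; `r = n` if there is none. -/
def IsFirst (b : ℕ → Bool) (n p r : ℕ) : Prop :=
  r ≤ n ∧ (∀ q, p ≤ q → q < r → b q = false) ∧ (r < n → p ≤ r ∧ b r = true)

section

variable {w n : ℕ} {A : ℕ → ℕ}

theorem elemAt_eq_flip (p : ℕ) : elemAt w n A p = flip w n A p + 1 := by
  unfold elemAt flip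
  split_ifs <;> rfl

theorem mul_add_div_of_lt {k m : ℕ} (hm : m < w) : (k * w + m) / w = k := by
  rw [add_comm, Nat.add_mul_div_right _ _ (by omega), Nat.div_eq_of_lt hm, zero_add]

theorem mul_add_mod_of_lt {k m : ℕ} (hm : m < w) : (k * w + m) % w = m := by
  rw [add_comm, Nat.add_mul_mod_self_right, Nat.mod_eq_of_lt hm]

theorem partner_partner {i : ℕ} (hi : i < blocks w n) :
    partner w n A (partner w n A i) = i := mate_mate hi

theorem flip_div (hw : 1 ≤ w) {p : ℕ} (hp : p / w < 3 * blocks w n) :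
    flip w n A p / w = 3 * partner w n A (p / w / 3) + p / w % 3 := by
  rw [flip, if_pos hp, mul_add_div_of_lt (Nat.mod_lt _ hw)]

theorem flip_mod (p : ℕ) (hw : 1 ≤ w) : flip w n A p % w = p % w := by
  unfold flip
  split_ifs
  · rw [mul_add_mod_of_lt (Nat.mod_lt _ hw)]
  · rfl

theorem flip_div_lt (hw : 1 ≤ w) {p : ℕ} (hp : p / w < 3 * blocks w n) :
    flip w n A p / w < 3 * blocks w n := by
  rw [flip_div hw hp]
  have := partner_lt (w := w) (n := n) (A := A) (i := p / w / 3) (by omega)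
  omega

/-- Inherited from `partner`. The same map thus translates rank positions to elements and back. -/
theorem flip_flip (hw : 1 ≤ w) (p : ℕ) : flip w n A (flip w n A p) = p := by
  by_cases hp : p / w < 3 * blocks w n
  · have h1 := flip_div (A := A) hw hp
    rw [flip, if_pos (flip_div_lt hw hp), flip_mod _ hw, h1]
    have h2 : (3 * partner w n A (p / w / 3) + p / w % 3) / 3 = partner w n A (p / w / 3) := by
      omega
    have h3 : (3 * partner w n A (p / w / 3) + p / w % 3) % 3 = p / w % 3 := by omega
    rw [h2, h3, partner_partner (by omega), Nat.div_add_mod, Nat.div_add_mod']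
  · have : flip w n A p = p := if_neg hp
    rw [this, this]

theorem flip_lt (hw : 1 ≤ w) {p : ℕ} (hp : p < n) : flip w n A p < n := by
  by_cases h : p / w < 3 * blocks w n
  · have h1 := flip_div_lt (A := A) hw h
    have h2 := blocks_le w n
    exact lt_of_lt_of_le ((Nat.div_lt_iff_lt_mul hw).1 (h1.trans_le h2)) (Nat.div_mul_le_self _ _)
  · rwa [flip, if_neg h]

/-- The partner is `i` itself, unmatched on the left, or a matched block on the right; both kinds
store data. -/
theorem not_free_partner (ht : barrier w n A ≤ blocks w n) {i : ℕ} (hi : i < barrier w n A) :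
    ¬ Free (blocks w n) (barrier w n A) (fun i => A (3 * i)) (partner w n A i) := by
  have h1 := mate_range (N := blocks w n) (t := barrier w n A) (P := fun i => A (3 * i)) i
  have h2 := partner_partner (A := A) (hi.trans_le ht)
  unfold Free partner at *
  rw [h2]
  grind

/-- Of the data of a matched right block, only the first word lies outside the left block `i`. That
explains why `rankWord` treats the words with index 0 in their block separately. -/
theorem rankWord_eq_data (ht : barrier w n A ≤ blocks w n) {i k : ℕ} (hi : i < barrier w n A)
    (hk : k < 3) : rankWord w n A (3 * i + k) = data w n A (partner w n A i) k := by
  have h1 : (3 * i + k) / 3 = i := by omega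
  have h2 : (3 * i + k) % 3 = k := by omega
  have h3 := mate_range (N := blocks w n) (t := barrier w n A) (P := fun i => A (3 * i)) i
  have h4 := partner_partner (A := A) (hi.trans_le ht)
  rw [rankWord, if_pos (by omega), h1, if_pos hi, h2]
  unfold data content sel
  unfold partner at *
  rw [h4]
  generalize mate (blocks w n) (barrier w n A) (fun i => A (3 * i)) i = j at *
  have : k = 0 ∨ k = 1 ∨ k = 2 := by omega
  rcases this with rfl | rfl | rfl <;> grind

theorem lt_barrier_of_data_ne_zero {j k : ℕ} (hd : data w n A j k ≠ 0) :
    partner w n A j < barrier w n A := by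
  have h3 := mate_range (N := blocks w n) (t := barrier w n A) (P := fun i => A (3 * i)) j
  unfold data content partner at *
  grind

theorem plainBit_flip (hw : 1 ≤ w) (ht : barrier w n A ≤ blocks w n) {p : ℕ}
    (h : rankBit w n A p = true) : plainBit w n A (flip w n A p) = true := by
  unfold rankBit plainBit at *
  rw [flip_mod _ hw]
  by_cases hk : p / w < 3 * blocks w n
  · rw [plainWord, if_pos (flip_div_lt hw hk), flip_div hw hk]
    have hi : p / w / 3 < barrier w n A := by
      by_contra hi
      rw [rankWord, if_pos hk, if_neg hi] at h
      simp at h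
    have e := rankWord_eq_data ht hi (Nat.mod_lt (p / w) (by omega : 3 > 0))
    rw [Nat.div_add_mod] at e
    rw [e] at h
    convert h using 3
    · omega
    · omega
  · rw [flip, if_neg hk, plainWord, if_neg hk]
    rw [rankWord, if_neg hk] at h
    split_ifs at h
    · rw [Nat.testBit_mod_two_pow] at h
      simp at h
      exact h.2
    · exact h

theorem rankBit_flip (hw : 1 ≤ w) (ht : barrier w n A ≤ blocks w n) {p : ℕ} (hp : p < n)
    (h : plainBit w n A p = true) : rankBit w n A (flip w n A p) = true := by
  unfold rankBit plainBit at *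
  rw [flip_mod _ hw]
  by_cases hk : p / w < 3 * blocks w n
  · rw [plainWord, if_pos hk] at h
    have hi : partner w n A (p / w / 3) < barrier w n A := by
      refine lt_barrier_of_data_ne_zero (k := p / w % 3) fun h0 => ?_
      rw [h0] at h
      simp at h
    rw [flip_div hw hk, rankWord_eq_data ht hi (by omega), partner_partner (by omega)]
    exact h
  · rw [flip, if_neg hk, rankWord, if_neg hk]
    rw [plainWord, if_neg hk] at h
    split_ifs with h1
    · rw [Nat.testBit_mod_two_pow, h]
      have h2 := Nat.div_add_mod n w
      have h3 := Nat.div_add_mod p w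
      rw [h1] at h3
      simp
      omega
    · exact h

theorem mem_client {l : ℕ} :
    l ∈ client w n A ↔ (1 ≤ l ∧ l ≤ n) ∧ plainBit w n A (l - 1) = true := by
  rw [client, Finset.mem_filter, Finset.mem_Icc]

theorem elemAt_mem_client (hw : 1 ≤ w) (ht : barrier w n A ≤ blocks w n) {p : ℕ} (hp : p < n)
    (h : rankBit w n A p = true) : elemAt w n A p ∈ client w n A := by
  have h1 := flip_lt (A := A) hw hp
  rw [mem_client, elemAt_eq_flip]
  exact ⟨⟨by omega, by omega⟩, plainBit_flip hw ht h⟩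

theorem exists_elemAt_eq (hw : 1 ≤ w) (ht : barrier w n A ≤ blocks w n) {l : ℕ}
    (h : l ∈ client w n A) : ∃ p < n, rankBit w n A p = true ∧ elemAt w n A p = l := by
  rw [mem_client] at h
  refine ⟨flip w n A (l - 1), flip_lt hw (by omega), rankBit_flip hw ht (by omega) h.2, ?_⟩
  rw [elemAt_eq_flip, flip_flip hw]
  omega

theorem elemAt_injective (hw : 1 ≤ w) : Function.Injective (elemAt w n A) := by
  intro p q h
  rw [elemAt_eq_flip, elemAt_eq_flip] at h
  rw [← flip_flip (A := A) (n := n) hw p, Nat.succ_injective h, flip_flip hw]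

theorem mem_enumSet {σ l : ℕ} : l ∈ enumSet w n A σ ↔
    ∃ p, p < n ∧ p < σ ∧ rankBit w n A p = true ∧ elemAt w n A p = l := by
  simp [enumSet, and_assoc]

theorem enumSet_zero : enumSet w n A 0 = ∅ := by
  simp [enumSet]

theorem elemAt_mem_sdiff (hw : 1 ≤ w) (ht : barrier w n A ≤ blocks w n) {σ r : ℕ}
    (h : IsFirst (rankBit w n A) n σ r) (hr : r < n) :
    elemAt w n A r ∈ client w n A \ enumSet w n A σ := by
  obtain ⟨h1, h2⟩ := h.2.2 hr
  rw [Finset.mem_sdiff]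
  refine ⟨elemAt_mem_client hw ht hr h2, fun hm => ?_⟩
  obtain ⟨p, -, hp, -, he⟩ := mem_enumSet.1 hm
  have := elemAt_injective hw he
  omega

/-- No rank bit is set from `σ` up to `r`, so moving the state past `r` adds a single element. -/
theorem insert_elemAt_enumSet {σ r : ℕ} (h : IsFirst (rankBit w n A) n σ r) (hr : r < n) :
    insert (elemAt w n A r) (enumSet w n A σ) = enumSet w n A (r + 1) := by
  obtain ⟨h1, h2⟩ := h.2.2 hr
  ext l
  rw [Finset.mem_insert, mem_enumSet, mem_enumSet]
  constructor
  · rintro (rfl | ⟨p, hp, hs, hb, he⟩)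
    · exact ⟨r, hr, by omega, h2, rfl⟩
    · exact ⟨p, hp, by omega, hb, he⟩
  · rintro ⟨p, hp, hs, hb, he⟩
    rcases lt_or_ge p σ with h3 | h3
    · exact Or.inr ⟨p, hp, h3, hb, he⟩
    · rcases (Nat.lt_succ_iff.1 hs).lt_or_eq with h4 | rfl
      · rw [h.2.1 p h3 h4] at hb
        simp at hb
      · exact Or.inl he.symm

theorem client_subset_enumSet (hw : 1 ≤ w) (ht : barrier w n A ≤ blocks w n) {σ r : ℕ}
    (h : IsFirst (rankBit w n A) n σ r) (hr : ¬ r < n) : client w n A ⊆ enumSet w n A σ := by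
  intro l hl
  obtain ⟨p, hp, hb, he⟩ := exists_elemAt_eq hw ht hl
  refine mem_enumSet.2 ⟨p, hp, ?_, hb, he⟩
  by_contra! h3
  rw [h.2.1 p h3 (by omega)] at hb
  simp at hb

theorem isFirst_lsb (hA : ∀ k, A k < 2 ^ w) {k : ℕ} (hk : k ≤ n / w)
    (h : rankWord w n A k ≠ 0) :
    IsFirst (rankBit w n A) n (k * w) (k * w + lsb (rankWord w n A k)) := by
  have hl := lsb_lt h (rankWord_lt hA k)
  refine ⟨(rankPos_lt hA hk (testBit_lsb h)).le, fun q hq hqr => ?_, fun _ => ⟨by omega, ?_⟩⟩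
  · obtain ⟨m, rfl⟩ := Nat.exists_eq_add_of_le hq
    rw [rankBit, mul_add_div_of_lt (by omega), mul_add_mod_of_lt (by omega)]
    exact testBit_lt_lsb h (by omega)
  · rw [rankBit, mul_add_div_of_lt hl, mul_add_mod_of_lt hl]
    exact testBit_lsb h

theorem isFirst_of_bits_eq_false {p p' r : ℕ} (hp : p ≤ p')
    (h0 : ∀ q, p ≤ q → q < p' → q < n → rankBit w n A q = false)
    (h : IsFirst (rankBit w n A) n p' r) : IsFirst (rankBit w n A) n p r := by
  obtain ⟨h1, h2, h3⟩ := h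
  refine ⟨h1, fun q hq hqr => ?_, fun hr => ⟨hp.trans (h3 hr).1, (h3 hr).2⟩⟩
  rcases lt_or_ge q p' with h4 | h4
  · exact h0 q hq h4 (by omega)
  · exact h2 q h4 hqr

theorem rankWord_eq_zero_of_gap {k : ℕ} (h1 : 3 * barrier w n A ≤ k) (h2 : k < 3 * blocks w n) :
    rankWord w n A k = 0 := by
  rw [rankWord, if_pos h2, if_neg (by omega)]

theorem lt_succWord (k : ℕ) : k < succWord w n A k := by
  unfold succWord
  split_ifs <;> omega

theorem rankBit_eq_false_of_lt_succWord (hw : 1 ≤ w) {k q : ℕ} (hq1 : k < q / w)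
    (hq : q < succWord w n A k * w) : rankBit w n A q = false := by
  have hlt : q / w < succWord w n A k := (Nat.div_lt_iff_lt_mul hw).2 hq
  rw [rankBit, rankWord_eq_zero_of_gap (k := q / w), Nat.zero_testBit]
  · unfold succWord at hlt
    split_ifs at hlt <;> omega
  · unfold succWord at hlt
    split_ifs at hlt <;> omega

/-- The words that `succWord` skips belong to blocks on the right of the barrier, where the rank
words are zero. -/
theorem isFirst_succWord (hw : 1 ≤ w) {k p r : ℕ} (hp : p / w = k)
    (h0 : ∀ q, p ≤ q → q / w = k → rankBit w n A q = false)
    (h : IsFirst (rankBit w n A) n (succWord w n A k * w) r) :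
    IsFirst (rankBit w n A) n p r := by
  have h1 : p < (k + 1) * w := by
    rw [← hp]
    exact (Nat.div_lt_iff_lt_mul hw).1 (Nat.lt_succ_self _)
  refine isFirst_of_bits_eq_false
    (h1.le.trans (Nat.mul_le_mul_right _ (lt_succWord k))) (fun q hq hqs _ => ?_) h
  have h2 : k ≤ q / w := hp ▸ Nat.div_le_div_right hq
  rcases h2.lt_or_eq with h3 | h3
  · exact rankBit_eq_false_of_lt_succWord hw h3 hqs
  · exact h0 q hq h3.symm

theorem isFirst_self {p k : ℕ} (hp : p / w = k) (hk : n / w ≤ k)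
    (h0 : ∀ q, p ≤ q → q / w = k → rankBit w n A q = false) :
    IsFirst (rankBit w n A) n p n := by
  refine ⟨le_rfl, fun q hq hqn => h0 q hq ?_, fun h => absurd h (lt_irrefl _)⟩
  have h1 : p / w ≤ q / w := Nat.div_le_div_right hq
  have h2 : q / w ≤ n / w := Nat.div_le_div_right hqn.le
  omega

theorem isFirst_scan_succ (hw : 1 ≤ w) (hA : ∀ k, A k < 2 ^ w) {f k : ℕ} (hk : k ≤ n / w)
    (h : rankWord w n A k = 0 → k < n / w →
      IsFirst (rankBit w n A) n (succWord w n A k * w) (scan w n A f (succWord w n A k))) :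
    IsFirst (rankBit w n A) n (k * w) (scan w n A (f + 1) k) := by
  have hkw : k * w / w = k := Nat.mul_div_cancel _ hw
  rw [scan]
  split_ifs with h0 h1
  · refine isFirst_succWord hw hkw (fun q _ hq => ?_) (h h0 h1)
    rw [rankBit, hq, h0, Nat.zero_testBit]
  · refine isFirst_self hkw (by omega) (fun q _ hq => ?_)
    rw [rankBit, hq, h0, Nat.zero_testBit]
  · exact isFirst_lsb hA hk h0

theorem isFirst_scan_tail (hw : 1 ≤ w) (hA : ∀ k, A k < 2 ^ w) (ht : barrier w n A ≤ blocks w n)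
    {f k : ℕ} (hk : k ≤ n / w) (h1 : 3 * blocks w n ≤ k) (hf : n / w < k + f) :
    IsFirst (rankBit w n A) n (k * w) (scan w n A f k) := by
  induction f generalizing k with
  | zero => omega
  | succ f ih =>
    refine isFirst_scan_succ hw hA hk fun _ hlt => ?_
    have e : succWord w n A k = k + 1 := by
      rw [succWord, if_neg (by omega), if_neg (by omega)]
    rw [e]
    exact ih hlt (by omega) (by omega)

theorem last_lt_blocks (w n : ℕ) : n / w < 3 * blocks w n + 3 := by
  unfold blocks
  omega

/-- One word is inspected, then the scan jumps over the gap to the tail, which has at most three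
words: four in all. -/
theorem isFirst_scan_gap (hw : 1 ≤ w) (hA : ∀ k, A k < 2 ^ w) (ht : barrier w n A ≤ blocks w n)
    {f k : ℕ} (h1 : 3 * barrier w n A ≤ k + 1) (h2 : k < 3 * blocks w n) (hf : 4 ≤ f) :
    IsFirst (rankBit w n A) n (k * w) (scan w n A f k) := by
  have h3 := blocks_le w n
  have h4 := last_lt_blocks w n
  obtain ⟨f, rfl⟩ : ∃ g, f = g + 1 := ⟨f - 1, by omega⟩
  refine isFirst_scan_succ hw hA (by omega) fun _ hlt => ?_
  have e : succWord w n A k = 3 * blocks w n := by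
    unfold succWord
    split_ifs <;> omega
  rw [e]
  exact isFirst_scan_tail hw hA ht h3 le_rfl (by omega)

theorem isFirst_scan_last (hw : 1 ≤ w) (hA : ∀ k, A k < 2 ^ w) (ht : barrier w n A ≤ blocks w n)
    {f k : ℕ} (h1 : k < 3 * barrier w n A) (hf : 3 * barrier w n A + 3 ≤ f + k) :
    IsFirst (rankBit w n A) n (k * w) (scan w n A f k) := by
  have h3 := blocks_le w n
  induction f generalizing k with
  | zero => omega
  | succ f ih =>
    rcases Nat.lt_or_ge (k + 1) (3 * barrier w n A) with h2 | h2
    · refine isFirst_scan_succ hw hA (by omega) fun _ hlt => ?_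
      have e : succWord w n A k = k + 1 := if_pos h2
      rw [e]
      exact ih h2 (by omega)
    · exact isFirst_scan_gap hw hA ht h2 (by omega) (by omega)

theorem isFirst_scan_of_ne_zero (hw : 1 ≤ w) (hA : ∀ k, A k < 2 ^ w)
    (ht : barrier w n A ≤ blocks w n) {f k l : ℕ} (hl : l < 3 * barrier w n A)
    (h0 : rankWord w n A l ≠ 0) (hkl : k ≤ l) (hf : l < k + f) :
    IsFirst (rankBit w n A) n (k * w) (scan w n A f k) := by
  have h3 := blocks_le w n
  induction f generalizing k with
  | zero => omega
  | succ f ih =>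
    refine isFirst_scan_succ hw hA (by omega) fun hz hlt => ?_
    have hne : k ≠ l := by rintro rfl; exact h0 hz
    have e : succWord w n A k = k + 1 := if_pos (by omega)
    rw [e]
    exact ih (by omega) (by omega)

/-- The point of the rank order: every block before the barrier contains a set bit, so no search
passes over more than one whole block there. -/
theorem Valid.exists_rankWord_ne_zero (hv : Valid w n A) {i : ℕ} (hi : i < barrier w n A) :
    ∃ k < 3, rankWord w n A (3 * i + k) ≠ 0 := by
  have h1 := partner_lt (A := A) (hi.trans_le hv.barrier_le)
  rcases hv.occupied _ h1 with h | ⟨k, hk, h⟩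
  · exact absurd h (not_free_partner hv.barrier_le hi)
  · exact ⟨k, hk, by rwa [rankWord_eq_data hv.barrier_le hi hk]⟩

/-- Seven words are enough. If the next block is also left of the barrier, it has a nonzero word, at
most five words after `k`. Otherwise at most three words remain before the barrier and at most three
in the tail. -/
theorem Valid.isFirst_scan (hv : Valid w n A) (hw : 1 ≤ w) (hA : ∀ k, A k < 2 ^ w) {k : ℕ}
    (hk : k ≤ n / w) : IsFirst (rankBit w n A) n (k * w) (scan w n A 7 k) := by
  have ht := hv.barrier_le
  have h4 := last_lt_blocks w n
  rcases Nat.lt_or_ge k (3 * blocks w n) with h1 | h1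
  · rcases Nat.lt_or_ge k (3 * barrier w n A) with h2 | h2
    · rcases Nat.lt_or_ge (k / 3 + 1) (barrier w n A) with h3 | h3
      · obtain ⟨l, hl, h0⟩ := hv.exists_rankWord_ne_zero h3
        exact isFirst_scan_of_ne_zero hw hA ht (by omega) h0 (by omega) (by omega)
      · exact isFirst_scan_last hw hA ht h2 (by omega)
    · exact isFirst_scan_gap hw hA ht (by omega) h1 (by omega)
  · exact isFirst_scan_tail hw hA ht hk h1 (by omega)

theorem testBit_shiftRight_shiftLeft (x a b : ℕ) :
    ((x >>> a) <<< a).testBit b = (decide (a ≤ b) && x.testBit b) := by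
  rw [Nat.testBit_shiftLeft, Nat.testBit_shiftRight]
  by_cases h : a ≤ b
  · rw [Nat.add_sub_cancel' h]
  · simp [h]

theorem Valid.isFirst_search (hv : Valid w n A) (hw : 1 ≤ w) (hA : ∀ k, A k < 2 ^ w) (p : ℕ) :
    IsFirst (rankBit w n A) n p (search w n A p) := by
  set x := (rankWord w n A (p / w) >>> (p % w)) <<< (p % w) with hx
  have hp := Nat.div_add_mod' p w
  have hbit : ∀ b, x.testBit b =
      (decide (p % w ≤ b) && (rankWord w n A (p / w)).testBit b) :=
    fun b => testBit_shiftRight_shiftLeft _ _ b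
  have hmod : ∀ q, p ≤ q → q / w = p / w → p % w ≤ q % w := by
    intro q hq hqp
    have h1 := Nat.div_add_mod' q w
    rw [hqp] at h1
    omega
  have h0 : x = 0 → ∀ q, p ≤ q → q / w = p / w → rankBit w n A q = false := by
    intro hx0 q hq hqp
    have h1 := hbit (q % w)
    rw [hx0, Nat.zero_testBit, decide_eq_true (hmod q hq hqp), Bool.true_and] at h1
    rw [rankBit, hqp, ← h1]
  rw [search, ← hx]
  split_ifs with h1 h2 h3
  · refine ⟨le_rfl, fun q hq hqn => ?_, fun h => absurd h (lt_irrefl _)⟩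
    have h2 : p / w ≤ q / w := Nat.div_le_div_right hq
    have h3 : q / w ≤ n / w := Nat.div_le_div_right hqn.le
    omega
  · exact isFirst_succWord hw rfl (h0 h2) (hv.isFirst_scan hw hA (succWord_le h3))
  · exact isFirst_self rfl (by omega) (h0 h2)
  · have hb := testBit_lsb h2
    rw [hbit, Bool.and_eq_true, decide_eq_true_eq] at hb
    have hlt := rankPos_lt hA (by omega) hb.2
    have hlw : lsb x < w := by
      by_contra! h
      rw [Nat.testBit_lt_two_pow
        ((rankWord_lt hA _).trans_le (Nat.pow_le_pow_right (by omega) h))] at hb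
      simp at hb
    refine ⟨hlt.le, fun q hq hqr => ?_, fun _ => ⟨by omega, ?_⟩⟩
    · have h4 : q / w = p / w := by
        refine le_antisymm ?_ (Nat.div_le_div_right hq)
        rw [← mul_add_div_of_lt (k := p / w) hlw]
        exact Nat.div_le_div_right hqr.le
      have h5 := Nat.div_add_mod' q w
      rw [h4] at h5
      have h6 := testBit_lt_lsb h2 (b := q % w) (by omega)
      rw [hbit, decide_eq_true (hmod q hq h4), Bool.true_and] at h6
      rw [rankBit, h4, h6]
    · rw [rankBit, mul_add_div_of_lt hlw, mul_add_mod_of_lt hlw]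
      exact hb.2

end

/-! ### Independence of everything beyond the first `n + 1` bits -/

/-- The words `A` and `A'` agree in the first `n + 1` bits. -/
def Agree (w n : ℕ) (A A' : ℕ → ℕ) : Prop :=
  (∀ k < n / w, A k = A' k) ∧
    ∀ m ≤ n % w, (A (n / w)).testBit m = (A' (n / w)).testBit m

/-- The words `A` and the iteration state `σ` represent the state `q`. -/
def RepWords (w n : ℕ) (A : ℕ → ℕ) (σ : ℕ) (q : State) : Prop :=
  Valid w n A ∧ q.client = client w n A ∧ ∀ E, q.enumerated = some E → E = enumSet w n A σ

section

variable {w n : ℕ} {A A' : ℕ → ℕ}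

theorem mate_congr {N t i : ℕ} {P P' : ℕ → ℕ} (h : ∀ x < N, P x = P' x) (hi : i < N) :
    mate N t P i = mate N t P' i := by
  unfold mate
  rw [h i hi]
  by_cases h1 : P' i < N
  · rw [h _ h1]
  · simp [h1]

theorem content_congr {N t j : ℕ} {P P' X X' Y Y' : ℕ → ℕ} (hP : ∀ x < N, P x = P' x)
    (hX : ∀ x < t, X x = X' x) (hY : ∀ x < N, Y x = Y' x) (hj : j < N) (k : ℕ) :
    content N t P X Y j k = content N t P' X' Y' j k := by
  have h := mate_congr (t := t) hP hj
  have hr := mate_range (N := N) (t := t) (P := P') j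
  unfold content
  rw [h]
  grind

theorem Agree.barrier_eq (h : Agree w n A A') : barrier w n A = barrier w n A' := by
  unfold barrier
  split_ifs with h1 h2 h3 h3
  · rfl
  · rfl
  · rw [h.2 _ le_rfl] at h2; exact absurd h2 h3
  · rw [h.2 _ le_rfl] at h2; exact absurd h3 h2
  · refine h.1 _ ?_
    have := blocks_le w n
    omega

theorem Agree.partner_eq (h : Agree w n A A') {i : ℕ} (hi : i < blocks w n) :
    partner w n A i = partner w n A' i := by
  have := blocks_le w n
  unfold partner
  rw [h.barrier_eq]
  exact mate_congr (fun x hx => h.1 _ (by omega)) hi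

theorem Agree.data_eq (h : Agree w n A A') (ht : barrier w n A ≤ blocks w n) {j : ℕ}
    (hj : j < blocks w n) (k : ℕ) : data w n A j k = data w n A' j k := by
  have := blocks_le w n
  rw [h.barrier_eq] at ht
  unfold data
  rw [h.barrier_eq]
  exact content_congr (fun x hx => h.1 _ (by omega)) (fun x hx => h.1 _ (by omega))
    (fun x hx => h.1 _ (by omega)) hj k

theorem Agree.testBit_eq (h : Agree w n A A') {p : ℕ} (hp : p < n) :
    (A (p / w)).testBit (p % w) = (A' (p / w)).testBit (p % w) := by
  have h1 : p / w ≤ n / w := Nat.div_le_div_right hp.le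
  rcases h1.lt_or_eq with h2 | h2
  · rw [h.1 _ h2]
  · rw [h2]
    refine h.2 _ ?_
    have h3 := Nat.div_add_mod p w
    have h4 := Nat.div_add_mod n w
    rw [h2] at h3
    omega

theorem Agree.plainBit_eq (h : Agree w n A A') (ht : barrier w n A ≤ blocks w n) {p : ℕ}
    (hp : p < n) : plainBit w n A p = plainBit w n A' p := by
  unfold plainBit plainWord
  split_ifs with h1
  · rw [h.data_eq ht (by omega)]
  · exact h.testBit_eq hp

theorem Agree.client_eq (h : Agree w n A A') (ht : barrier w n A ≤ blocks w n) :
    client w n A = client w n A' := by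
  unfold client
  refine Finset.filter_congr fun l hl => ?_
  rw [Finset.mem_Icc] at hl
  rw [h.plainBit_eq ht (by omega)]

theorem Agree.rankBit_eq (h : Agree w n A A') {p : ℕ} (hp : p < n) :
    rankBit w n A p = rankBit w n A' p := by
  have h3 := blocks_le w n
  unfold rankBit rankWord
  by_cases h1 : p / w < 3 * blocks w n
  · have h4 := partner_lt (w := w) (n := n) (A := A') (i := p / w / 3) (by omega)
    rw [h.barrier_eq, h.partner_eq (by omega), h.1 (p / w) (by omega), h.1 (3 * _ + 2) (by omega)]
  · rw [if_neg h1, if_neg h1]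
    split_ifs
    · rw [Nat.testBit_mod_two_pow, Nat.testBit_mod_two_pow, h.testBit_eq hp]
    · exact h.testBit_eq hp

theorem Agree.elemAt_eq (h : Agree w n A A') (p : ℕ) : elemAt w n A p = elemAt w n A' p := by
  unfold elemAt
  split_ifs with h1
  · rw [h.partner_eq (by omega)]
  · rfl

theorem Agree.enumSet_eq (h : Agree w n A A') (σ : ℕ) : enumSet w n A σ = enumSet w n A' σ := by
  ext l
  rw [mem_enumSet, mem_enumSet]
  refine exists_congr fun p => and_congr_right fun hp => ?_
  rw [h.rankBit_eq hp, h.elemAt_eq]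

theorem Agree.valid (h : Agree w n A A') (hv : Valid w n A) : Valid w n A' := by
  have h3 := blocks_le w n
  refine ⟨h.barrier_eq ▸ hv.barrier_le, fun hf => ?_, fun j hj => ?_⟩
  · rw [← h.2 _ le_rfl]
    exact hv.full (h.barrier_eq.trans hf)
  · refine (hv.occupied j hj).imp (fun hf => ?_) fun ⟨k, hk, hd⟩ => ⟨k, hk, ?_⟩
    · unfold Free at *
      rw [← h.barrier_eq, ← mate_congr (fun x hx => h.1 (3 * x) (by omega)) hj]
      exact hf
    · rwa [← h.data_eq hv.barrier_le hj]

/-- The functions above read entire words, whose high bits in the last word do not belong to the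
dictionary. This lemma makes the representation a property of the dictionary bits alone. -/
theorem Agree.repWords (h : Agree w n A A') {σ : ℕ} {q : State} (hr : RepWords w n A σ q) :
    RepWords w n A' σ q := by
  obtain ⟨hv, hc, he⟩ := hr
  exact ⟨h.valid hv, hc.trans (h.client_eq hv.barrier_le),
    fun E hE => (he E hE).trans (h.enumSet_eq σ)⟩

end

/-! ### Stores into blocks, motion of the barrier and replacement of a block's data -/

instance : OrOp Expr := ⟨.op .or⟩

theorem Expr.val_or {w : ℕ} {Γ : Ctx w} {a b : Expr} :
    (a ||| b).val Γ = a.val Γ ||| b.val Γ := BitVec.toNat_or _ _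

/-- Stores into words of the dictionary, given by their indices. -/
def storeWords (l : List (Expr × Expr)) : Cmd := .stores (l.map fun x => (.reg 0 + x.1, x.2))

/-- The words after a list of assignments, of which the first ones are carried out last. -/
def applyWords (A : ℕ → ℕ) : List (ℕ × ℕ) → ℕ → ℕ
  | [], k => A k
  | (i, v) :: l, k => if k = i then v else applyWords A l k

/-- Stores into words of blocks; a triple consists of the index of the word in the block,
the block and the value. -/
def fieldStores (l : List (ℕ × Expr × Expr)) : List (Expr × Expr) :=
  l.map fun x => (3 * x.2.1 + .const x.1, x.2.2)

/-- The words of the blocks after a list of assignments. -/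
def applyFields (A : ℕ → ℕ) : List (ℕ × ℕ × ℕ) → ℕ → ℕ → ℕ
  | [], r, x => A (3 * x + r)
  | (r', i, v) :: l, r, x => if r = r' ∧ x = i then v else applyFields A l r x

/-- The values of a list of stores into words of blocks. -/
def fieldVals {w : ℕ} (Γ : Ctx w) (l : List (ℕ × Expr × Expr)) : List (ℕ × ℕ × ℕ) :=
  l.map fun x => (x.1, x.2.1.val Γ, x.2.2.val Γ)

/-- The memory bits that do not belong to the dictionary are the same. -/
def SameOutside {w : ℕ} (n base : ℕ) (M M' : Mem w) : Prop :=
  ∀ i < 2 ^ w * w, i < base * w ∨ base * w + (n + 1) ≤ i → M'.bit i = M.bit i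

namespace Setup

variable {W c w n base : ℕ} {Γ : Ctx w} (h : Setup W c Γ n base)

include h

/-- The dictionary starts at a word boundary, so the last word is the only one it may share with
foreign bits, and those lie above bit `n % w`. -/
theorem sameOutside {M M' : Mem w} (h1 : ∀ a, (∀ k ≤ n / w, a ≠ BitVec.ofNat w (base + k)) →
      M' a = M a)
    (h2 : ∀ m, n % w < m → (words base M' (n / w)).testBit m = (words base M (n / w)).testBit m) :
    SameOutside n base M M' := by
  intro i hi ho
  have hw := h.one_le_wordLen
  have hiw : i / w < 2 ^ w := (Nat.div_lt_iff_lt_mul hw).2 hi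
  have e1 := Nat.div_add_mod' i w
  have e2 := Nat.div_add_mod' n w
  have e3 : i % w < w := Nat.mod_lt _ hw
  have hbl := h.base_add_last_lt
  by_cases hk : i / w = base + n / w
  · have hm : n % w < i % w := by
      rw [hk, add_mul] at e1
      rcases ho with ho | ho
      · have : base * w ≤ (base + n / w) * w := Nat.mul_le_mul_right _ (by omega)
        rw [add_mul] at this
        omega
      · omega
    have := h2 _ hm
    unfold words at this
    unfold Mem.bit
    rw [hk]
    exact this
  · unfold Mem.bit
    rw [h1]
    intro k hkn heq
    have h3 := congrArg BitVec.toNat heq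
    rw [BitVec.toNat_ofNat, BitVec.toNat_ofNat, Nat.mod_eq_of_lt hiw,
      Nat.mod_eq_of_lt (by omega)] at h3
    rcases ho with ho | ho
    · have : i / w < base := (Nat.div_lt_iff_lt_mul hw).2 ho
      omega
    · have h4 : (i / w + 1) * w ≤ (base + n / w) * w := Nat.mul_le_mul_right _ (by omega)
      rw [add_mul, add_mul] at h4
      omega

theorem val_address {k : Expr} (hk : k.val Γ ≤ n / w) :
    (Expr.reg 0 + k).eval Γ = BitVec.ofNat w (base + k.val Γ) := by
  have := h.base_add_last_lt
  have e : (Expr.reg 0 + k).val Γ = base + k.val Γ := by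
    rw [Expr.val_add, h.val_reg_zero]
    rw [h.val_reg_zero]; omega
  rw [← e, Expr.val, BitVec.ofNat_toNat, BitVec.setWidth_eq]

theorem storeWords_apply_of_ne {l : List (Expr × Expr)} (hl : ∀ x ∈ l, x.1.val Γ ≤ n / w)
    {a : BitVec w} (ha : ∀ k ≤ n / w, a ≠ BitVec.ofNat w (base + k)) :
    (storeWords l).eval Γ a = Γ.mem a := by
  unfold storeWords Cmd.eval
  induction l with
  | nil => rfl
  | cons x l ih =>
    have hx := hl x (by simp)
    rw [List.map_cons, storesEval, Function.update_of_ne, ih fun y hy => hl y (by simp [hy])]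
    rw [h.val_address hx]
    exact ha _ hx

theorem words_storeWords {l : List (Expr × Expr)} (hl : ∀ x ∈ l, x.1.val Γ ≤ n / w) {k : ℕ}
    (hk : k ≤ n / w) : words base ((storeWords l).eval Γ) k =
      applyWords (words base Γ.mem) (l.map fun x => (x.1.val Γ, x.2.val Γ)) k := by
  have hbl := h.base_add_last_lt
  unfold storeWords Cmd.eval
  induction l with
  | nil => rfl
  | cons x l ih =>
    have hx := hl x (by simp)
    rw [List.map_cons, storesEval, List.map_cons, applyWords,
      ← ih fun y hy => hl y (by simp [hy])]
    unfold words
    rw [h.val_address hx]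
    split_ifs with h1
    · rw [h1, Function.update_self]
      rfl
    · rw [Function.update_of_ne]
      -- Different indices have different addresses, because `base + n / w` is less than `2 ^ w`.
      intro heq
      have h3 := congrArg BitVec.toNat heq
      rw [BitVec.toNat_ofNat, BitVec.toNat_ofNat, Nat.mod_eq_of_lt (by omega),
        Nat.mod_eq_of_lt (by omega)] at h3
      omega

theorem val_field {x : ℕ × Expr × Expr} (hx : x.1 < 3 ∧ x.2.1.val Γ < blocks w n) :
    (3 * x.2.1 + Expr.const x.1).val Γ = 3 * x.2.1.val Γ + x.1 := by
  have h8 := h.eight_lt (by omega)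
  have e : (Expr.const x.1).val Γ = x.1 := Expr.val_const (by omega)
  rw [h.val_three_mul_add hx.2 (by omega), e]

theorem fieldStores_le {l : List (ℕ × Expr × Expr)}
    (hl : ∀ x ∈ l, x.1 < 3 ∧ x.2.1.val Γ < blocks w n) :
    ∀ x ∈ fieldStores l, x.1.val Γ ≤ n / w := by
  intro x hx
  rw [fieldStores, List.mem_map] at hx
  obtain ⟨y, hy, rfl⟩ := hx
  have h1 := hl y hy
  have := blocks_le w n
  rw [h.val_field h1]
  omega

theorem applyWords_fieldStores {l : List (ℕ × Expr × Expr)} (A : ℕ → ℕ)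
    (hl : ∀ x ∈ l, x.1 < 3 ∧ x.2.1.val Γ < blocks w n) {r x : ℕ} (hr : r < 3) :
    applyWords A ((fieldStores l).map fun x => (x.1.val Γ, x.2.val Γ)) (3 * x + r) =
      applyFields A (fieldVals Γ l) r x := by
  induction l with
  | nil => rfl
  | cons y l ih =>
    have h1 := hl y (by simp)
    simp only [fieldStores, List.map_cons, applyWords, fieldVals, applyFields] at *
    rw [ih fun z hz => hl z (by simp [hz]), h.val_field h1]
    refine if_congr ?_ rfl rfl
    omega

theorem applyWords_fieldStores_of_le {l : List (ℕ × Expr × Expr)} (A : ℕ → ℕ)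
    (hl : ∀ x ∈ l, x.1 < 3 ∧ x.2.1.val Γ < blocks w n) {k : ℕ} (hk : 3 * blocks w n ≤ k) :
    applyWords A ((fieldStores l).map fun x => (x.1.val Γ, x.2.val Γ)) k = A k := by
  induction l with
  | nil => rfl
  | cons y l ih =>
    have h1 := hl y (by simp)
    simp only [fieldStores, List.map_cons, applyWords] at *
    rw [ih fun z hz => hl z (by simp [hz]), h.val_field h1, if_neg]
    omega

end Setup

/-- The data of block `j` have been replaced by `a`, `b`, `c`, and otherwise the represented bit
vector is unchanged. -/
structure BlockSet {w : ℕ} (n base : ℕ) (M M' : Mem w) (j a b c : ℕ) : Prop where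
  valid : Valid w n (words base M')
  outside : SameOutside n base M M'
  plainBit_eq : ∀ p < n, plainBit w n (words base M') p =
    if p / w < 3 * blocks w n ∧ p / w / 3 = j then (sel a b c (p / w % 3)).testBit (p % w)
    else plainBit w n (words base M) p

/-- `Updated` for the blocks of a dictionary. -/
def UpdatedWords (w n : ℕ) (A : ℕ → ℕ) (t' : ℕ) (P' X' Y' : ℕ → ℕ) (j a b c : ℕ) : Prop :=
  Updated (blocks w n) (barrier w n A) (fun i => A (3 * i)) (fun i => A (3 * i + 1))
    (fun i => A (3 * i + 2)) t' P' X' Y' j a b c (a = 0 ∧ b = 0 ∧ c = 0)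

/-- Whatever memory results from the stores `l`, the data of block `j` are replaced if the barrier
becomes `t'`. -/
def Achieves {w : ℕ} (Γ : Ctx w) (n base : ℕ) (l : List (ℕ × Expr × Expr)) (t' j a b c : ℕ) :
    Prop :=
  ∀ P' X' Y' : ℕ → ℕ,
    (∀ x < blocks w n, P' x = applyFields (words base Γ.mem) (fieldVals Γ l) 0 x) →
    (∀ x < t', X' x = applyFields (words base Γ.mem) (fieldVals Γ l) 1 x) →
    (∀ x < blocks w n, Y' x = applyFields (words base Γ.mem) (fieldVals Γ l) 2 x) →
    UpdatedWords w n (words base Γ.mem) t' P' X' Y' j a b c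

namespace Setup

variable {W c w n base : ℕ} {Γ : Ctx w} (h : Setup W c Γ n base)

include h

/-- The common conclusion for all three ways of treating the barrier. Middle words are prescribed
only left of the new barrier, so the one that stores the barrier is exempt. -/
theorem blockSet {M' : Mem w} {t' j a b d : ℕ} {l : List (ℕ × Expr × Expr)}
    (hv : Valid w n (words base Γ.mem)) (hj : j < blocks w n)
    (hP : Achieves Γ n base l t' j a b d)
    (h1 : ∀ x < blocks w n, words base M' (3 * x) =
      applyFields (words base Γ.mem) (fieldVals Γ l) 0 x)
    (h2 : ∀ x < t', words base M' (3 * x + 1) =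
      applyFields (words base Γ.mem) (fieldVals Γ l) 1 x)
    (h3 : ∀ x < blocks w n, words base M' (3 * x + 2) =
      applyFields (words base Γ.mem) (fieldVals Γ l) 2 x)
    (ht' : t' ≤ blocks w n) (hb : barrier w n (words base M') = t')
    (hf : t' = blocks w n → (words base M' (n / w)).testBit (n % w) = true)
    (htail : ∀ k, 3 * blocks w n ≤ k → k < n / w → words base M' k = words base Γ.mem k)
    (hlast : ∀ m, m ≠ n % w → (words base M' (n / w)).testBit m =
      (words base Γ.mem (n / w)).testBit m)
    (ho : ∀ a, (∀ k ≤ n / w, a ≠ BitVec.ofNat w (base + k)) → M' a = Γ.mem a) :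
    BlockSet n base Γ.mem M' j a b d := by
  have hU := hP (fun x => words base M' (3 * x)) (fun x => words base M' (3 * x + 1))
    (fun x => words base M' (3 * x + 2)) h1 h2 h3
  subst hb
  refine ⟨⟨ht', fun hfull => Or.inr (hf hfull), fun x hx => ?_⟩,
    h.sameOutside ho fun m hm => hlast m hm.ne', fun p hp => ?_⟩
  · obtain ⟨hfree, hc⟩ := hU x hx
    rw [hfree]
    unfold data
    simp only [hc]
    by_cases hxj : x = j
    · subst hxj
      simp only [if_true]
      by_cases ha : a = 0
      · by_cases hb : b = 0
        · by_cases hd : d = 0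
          · exact Or.inl ⟨ha, hb, hd⟩
          · exact Or.inr ⟨2, by omega, by simpa [sel] using hd⟩
        · exact Or.inr ⟨1, by omega, by simpa [sel] using hb⟩
      · exact Or.inr ⟨0, by omega, by simpa [sel] using ha⟩
    · simp only [hxj, if_false]
      exact hv.occupied x hx
  · unfold plainBit plainWord
    by_cases hk : p / w < 3 * blocks w n
    · have hc := (hU (p / w / 3) (by omega)).2 (p / w % 3)
      have : data w n (words base M') (p / w / 3) (p / w % 3) = _ := hc
      rw [if_pos hk, if_pos hk, this]
      by_cases hpj : p / w / 3 = j
      · simp [hpj, hk]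
      · rw [if_neg hpj, if_neg (by tauto)]
        rfl
    · rw [if_neg hk, if_neg hk, if_neg (by tauto)]
      have hle : p / w ≤ n / w := Nat.div_le_div_right hp.le
      rcases hle.lt_or_eq with h4 | h4
      · rw [htail _ (by omega) h4]
      · rw [h4]
        refine hlast _ ?_
        have e1 := Nat.div_add_mod p w
        have e2 := Nat.div_add_mod n w
        rw [h4] at e1
        omega

end Setup

namespace Expr

variable (W c : ℕ)

/-- The last word with bit `n` of the dictionary changed. -/
def flipFlag : Expr := word (lastWord W c) ^^^ ((1 : Expr) <<< lastBits W c)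

end Expr

/-- Stores into blocks that do not change the barrier. -/
def keepCmd (l : List (ℕ × Expr × Expr)) : Cmd := storeWords (fieldStores l)

/-- Stores into blocks that increase the barrier. -/
def growCmd (W c : ℕ) (l : List (ℕ × Expr × Expr)) : Cmd :=
  storeWords (
    (.iteEq (Expr.barrier W c + 1) (Expr.numBlocks W c) (Expr.lastWord W c)
        (Expr.numBlockWords W c - 2),
      .iteEq (Expr.barrier W c + 1) (Expr.numBlocks W c) (Expr.flipFlag W c)
        (Expr.barrier W c + 1)) :: fieldStores l)

/-- Stores into blocks that decrease the barrier. -/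
def shrinkCmd (W c : ℕ) (l : List (ℕ × Expr × Expr)) : Cmd :=
  storeWords (
    (Expr.lastWord W c, .iteEq (Expr.barrier W c) (Expr.numBlocks W c) (Expr.flipFlag W c)
      (Expr.word (Expr.lastWord W c))) ::
    (Expr.numBlockWords W c - 2, Expr.barrier W c - 1) :: fieldStores l)

namespace Setup

variable {W c w n base : ℕ} {Γ : Ctx w} (h : Setup W c Γ n base)

include h

theorem val_flipFlag : (Expr.flipFlag W c).val Γ = words base Γ.mem (n / w) ^^^ 2 ^ (n % w) := by
  rw [Expr.flipFlag, Expr.val_xor, h.val_word, h.val_lastWord, h.val_two_pow_lastBits]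

/-- If `t < N`, the middle word of the last block contains the barrier and must survive; this is the
purpose of `hX`. -/
theorem keepCmd_blockSet {j a b d : ℕ} {l : List (ℕ × Expr × Expr)}
    (hv : Valid w n (words base Γ.mem)) (hj : j < blocks w n)
    (hl : ∀ x ∈ l, x.1 < 3 ∧ x.2.1.val Γ < blocks w n)
    (hX : barrier w n (words base Γ.mem) < blocks w n →
      applyFields (words base Γ.mem) (fieldVals Γ l) 1 (blocks w n - 1) =
        words base Γ.mem (3 * (blocks w n - 1) + 1))
    (hP : Achieves Γ n base l (barrier w n (words base Γ.mem)) j a b d) :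
    BlockSet n base Γ.mem ((keepCmd l).eval Γ) j a b d := by
  have hN := blocks_le w n
  have hle := h.fieldStores_le hl
  have ht := hv.barrier_le
  have e : ∀ {r x : ℕ}, r < 3 → x < blocks w n → words base ((keepCmd l).eval Γ) (3 * x + r) =
      applyFields (words base Γ.mem) (fieldVals Γ l) r x := fun hr hx => by
    rw [keepCmd, h.words_storeWords hle (by omega), h.applyWords_fieldStores _ hl hr]
  have e2 : ∀ {k : ℕ}, 3 * blocks w n ≤ k → k ≤ n / w →
      words base ((keepCmd l).eval Γ) k = words base Γ.mem k := fun h1 h2 => by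
    rw [keepCmd, h.words_storeWords hle h2, h.applyWords_fieldStores_of_le _ hl h1]
  refine h.blockSet hv hj hP (fun x hx => e (r := 0) (by omega) hx)
    (fun x hx => e (r := 1) (by omega) (by omega)) (fun x hx => e (r := 2) (by omega) hx) ht ?_ (fun hf => ?_) (fun k h1 h2 => e2 h1 h2.le)
    (fun m _ => ?_) (fun a ha => h.storeWords_apply_of_ne hle ha)
  · have h1 := e (r := 1) (x := blocks w n - 1) (by omega) (by omega)
    have h2 : 3 * (blocks w n - 1) + 1 = 3 * blocks w n - 2 := by omega
    unfold barrier at hX ⊢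
    rw [e2 hN le_rfl]
    rw [h2] at h1 hX
    split_ifs at hX ⊢ with h3 h4
    · rfl
    · rfl
    · rw [h1]
      by_cases h5 : barrier w n (words base Γ.mem) < blocks w n
      · exact hX (by rwa [barrier, if_neg h3, if_neg h4] at h5)
      · exact absurd (hv.full (by omega)) (by simp [h3, h4])
  · rw [e2 hN le_rfl]
    exact (hv.full hf).resolve_left (by omega)
  · rw [e2 hN le_rfl]

/-- While `t + 1 < N`, the new barrier goes to the spare middle word of the last block. For `t + 1 =
N` that word becomes data, and the flag is switched on instead; it was off because `t < N`. -/
theorem growCmd_blockSet {j a b d : ℕ} {l : List (ℕ × Expr × Expr)}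
    (hv : Valid w n (words base Γ.mem)) (hj : j < blocks w n)
    (ht : barrier w n (words base Γ.mem) < blocks w n)
    (hl : ∀ x ∈ l, x.1 < 3 ∧ x.2.1.val Γ < blocks w n)
    (hP : Achieves Γ n base l (barrier w n (words base Γ.mem) + 1) j a b d) :
    BlockSet n base Γ.mem ((growCmd W c l).eval Γ) j a b d := by
  have hN := blocks_le w n
  have hnw := h.last_lt
  have hflag : (words base Γ.mem (n / w)).testBit (n % w) = false := by
    by_contra hne
    rw [barrier, if_neg (by omega), if_pos (by simpa using hne)] at ht
    omega
  have e1 : Expr.val Γ 1 = 1 := Expr.val_one h.one_le_wordLen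
  have e2 : Expr.val Γ 2 = 2 := h.val_two (by omega)
  have e3 : (Expr.barrier W c + 1).val Γ = barrier w n (words base Γ.mem) + 1 := by
    rw [Expr.val_add, h.val_barrier, e1]
    rw [h.val_barrier, e1]; omega
  have e4 : (Expr.numBlockWords W c - 2).val Γ = 3 * blocks w n - 2 := by
    rw [Expr.val_sub, h.val_numBlockWords, e2]
    rw [h.val_numBlockWords, e2]; omega
  have hle : ∀ x ∈ ((.iteEq (Expr.barrier W c + 1) (Expr.numBlocks W c) (Expr.lastWord W c)
      (Expr.numBlockWords W c - 2), .iteEq (Expr.barrier W c + 1) (Expr.numBlocks W c)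
      (Expr.flipFlag W c) (Expr.barrier W c + 1)) :: fieldStores l : List (Expr × Expr)),
      x.1.val Γ ≤ n / w := by
    intro x hx
    rcases List.mem_cons.1 hx with rfl | hx
    · rw [Expr.val_iteEq, h.val_lastWord, e4]
      split_ifs <;> omega
    · exact h.fieldStores_le hl x hx
  have e : ∀ k ≤ n / w, words base ((growCmd W c l).eval Γ) k =
      if barrier w n (words base Γ.mem) + 1 = blocks w n then
        if k = n / w then words base Γ.mem (n / w) ^^^ 2 ^ (n % w)
        else applyWords (words base Γ.mem) ((fieldStores l).map fun x => (x.1.val Γ, x.2.val Γ)) k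
      else if k = 3 * blocks w n - 2 then barrier w n (words base Γ.mem) + 1
        else applyWords (words base Γ.mem) ((fieldStores l).map fun x => (x.1.val Γ, x.2.val Γ)) k := by
    intro k hk
    rw [growCmd, h.words_storeWords hle hk, List.map_cons, applyWords]
    simp only [Expr.val_iteEq, e3, h.val_numBlocks, h.val_lastWord, e4, h.val_flipFlag]
    split_ifs <;> rfl
  have ef := fun r x (hr : r < 3) =>
    h.applyWords_fieldStores (r := r) (x := x) (words base Γ.mem) hl hr
  have et := fun k hk => h.applyWords_fieldStores_of_le (k := k) (words base Γ.mem) hl hk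
  refine h.blockSet hv hj hP (fun x hx => ?_) (fun x hx => ?_)
    (fun x hx => ?_) ht ?_ (fun hf => ?_) (fun k h1 h2 => ?_)
    (fun m hm => ?_) (fun a ha => h.storeWords_apply_of_ne hle ha)
  · rw [← ef 0 x (by omega), e _ (by omega)]
    split_ifs <;> first | rfl | omega
  · rw [← ef 1 x (by omega), e _ (by omega)]
    split_ifs <;> first | rfl | omega
  · rw [← ef 2 x (by omega), e _ (by omega)]
    split_ifs <;> first | rfl | omega
  · rw [barrier, if_neg (by omega), e (n / w) le_rfl, e (3 * blocks w n - 2) (by omega)]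
    by_cases h1 : barrier w n (words base Γ.mem) + 1 = blocks w n
    · simp [h1, Nat.testBit_xor, hflag, Nat.testBit_two_pow_self]
    · have h2 : n / w ≠ 3 * blocks w n - 2 := by omega
      simp [h1, h2, et _ hN, hflag]
  · rw [e _ le_rfl, if_pos hf, if_pos rfl, Nat.testBit_xor, hflag, Nat.testBit_two_pow_self]
    rfl
  · rw [e _ h2.le, et _ h1]
    split_ifs <;> first | rfl | omega
  · rw [e _ le_rfl, et _ hN]
    split_ifs
    all_goals first
      | rw [Nat.testBit_xor, Nat.testBit_two_pow_of_ne hm.symm, Bool.xor_false]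
      | omega
      | rfl

/-- Afterwards the last block is on the right of the barrier, so its middle word can always receive
`u`. The flag changes only if the barrier was `N`. -/
theorem shrinkCmd_blockSet {j a b d u : ℕ} {l : List (ℕ × Expr × Expr)}
    (hv : Valid w n (words base Γ.mem)) (hj : j < blocks w n)
    (hu : barrier w n (words base Γ.mem) = u + 1)
    (hl : ∀ x ∈ l, x.1 < 3 ∧ x.2.1.val Γ < blocks w n)
    (hP : Achieves Γ n base l u j a b d) :
    BlockSet n base Γ.mem ((shrinkCmd W c l).eval Γ) j a b d := by
  have hN := blocks_le w n
  have hnw := h.last_lt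
  have ht := hv.barrier_le
  -- In a valid memory with blocks the flag is equivalent to `t = N`; hence the exclusive or really
  -- switches it off.
  have hflag : (words base Γ.mem (n / w)).testBit (n % w) =
      decide (barrier w n (words base Γ.mem) = blocks w n) := by
    by_cases h1 : barrier w n (words base Γ.mem) = blocks w n
    · rw [decide_eq_true h1]
      exact (hv.full h1).resolve_left (by omega)
    · rw [decide_eq_false h1]
      by_contra hne
      exact h1 (by rw [barrier, if_neg (by omega), if_pos (by simpa using hne)])
  have e1 : Expr.val Γ 1 = 1 := Expr.val_one h.one_le_wordLen
  have e2 : Expr.val Γ 2 = 2 := h.val_two (by omega)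
  have e3 : (Expr.barrier W c - 1).val Γ = u := by
    rw [Expr.val_sub, h.val_barrier, e1]
    · omega
    · rw [h.val_barrier, e1]; omega
  have e4 : (Expr.numBlockWords W c - 2).val Γ = 3 * blocks w n - 2 := by
    rw [Expr.val_sub, h.val_numBlockWords, e2]
    rw [h.val_numBlockWords, e2]; omega
  have hle : ∀ x ∈ ((Expr.lastWord W c, .iteEq (Expr.barrier W c) (Expr.numBlocks W c)
      (Expr.flipFlag W c) (Expr.word (Expr.lastWord W c))) ::
      (Expr.numBlockWords W c - 2, Expr.barrier W c - 1) :: fieldStores l : List (Expr × Expr)),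
      x.1.val Γ ≤ n / w := by
    intro x hx
    rcases List.mem_cons.1 hx with rfl | hx
    · exact h.val_lastWord.le
    rcases List.mem_cons.1 hx with rfl | hx
    · change (Expr.numBlockWords W c - 2).val Γ ≤ _
      omega
    · exact h.fieldStores_le hl x hx
  have e : ∀ k ≤ n / w, words base ((shrinkCmd W c l).eval Γ) k =
      if k = n / w then
        if barrier w n (words base Γ.mem) = blocks w n then
          words base Γ.mem (n / w) ^^^ 2 ^ (n % w) else words base Γ.mem (n / w)
      else if k = 3 * blocks w n - 2 then u
        else applyWords (words base Γ.mem) ((fieldStores l).map fun x => (x.1.val Γ, x.2.val Γ)) k := by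
    intro k hk
    rw [shrinkCmd, h.words_storeWords hle hk, List.map_cons, List.map_cons, applyWords, applyWords]
    simp only [Expr.val_iteEq, e3, h.val_barrier, h.val_numBlocks, h.val_lastWord, e4,
      h.val_flipFlag, h.val_word]
  have ef := fun r x (hr : r < 3) =>
    h.applyWords_fieldStores (r := r) (x := x) (words base Γ.mem) hl hr
  have et := fun k hk => h.applyWords_fieldStores_of_le (k := k) (words base Γ.mem) hl hk
  refine h.blockSet hv hj hP (fun x hx => ?_) (fun x hx => ?_)
    (fun x hx => ?_) (by omega) ?_ (fun hf => by omega) (fun k h1 h2 => ?_)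
    (fun m hm => ?_) (fun a ha => h.storeWords_apply_of_ne hle ha)
  · rw [← ef 0 x (by omega), e _ (by omega), if_neg (by omega), if_neg (by omega)]
    rfl
  · rw [← ef 1 x (by omega), e _ (by omega), if_neg (by omega), if_neg (by omega)]
  · rw [← ef 2 x (by omega), e _ (by omega), if_neg (by omega), if_neg (by omega)]
  · rw [barrier, if_neg (by omega), e (n / w) le_rfl, e (3 * blocks w n - 2) (by omega)]
    have h2 : 3 * blocks w n - 2 ≠ n / w := by omega
    by_cases h1 : barrier w n (words base Γ.mem) = blocks w n
    · simp [h1, h2, Nat.testBit_xor, hflag, Nat.testBit_two_pow_self]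
    · simp [h1, h2, hflag]
  · rw [e _ h2.le, et _ h1, if_neg (by omega), if_neg (by omega)]
  · rw [e _ le_rfl, if_pos rfl]
    split_ifs
    · rw [Nat.testBit_xor, Nat.testBit_two_pow_of_ne hm.symm, Bool.xor_false]
    · rfl

end Setup

namespace Expr

variable (W c : ℕ)

/-- The word with index `r` of block `i`. -/
def field (r : ℕ) (i : Expr) : Expr := word (3 * i + .const r)

/-- `fixLoc` for the barrier `t` and the blocks of the dictionary. -/
def fixLoc (t x a : Expr) : Expr :=
  iteLt a t x (iteLt a (numBlocks W c) (iteEq (word (3 * a)) x a x) x)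

end Expr

/-- Removal of the last block on the left of the barrier if the left block `f` is not needed. -/
def clearCmd (W c : ℕ) (f : Expr) : Cmd :=
  let u : Expr := Expr.barrier W c - 1
  let p : Expr := Expr.partner W c u
  .iteEq f u (shrinkCmd W c [(0, u, u)])
    (.iteEq p u
      (shrinkCmd W c [(0, f, u), (0, u, f), (1, f, .field 1 u), (2, f, .field 2 u),
        (2, u, .field 0 u)])
      (shrinkCmd W c [(0, f, p), (0, p, f), (0, u, u), (1, f, .field 1 u), (2, f, .field 2 u)]))

/-- Replacement of the data of block `j` by `a`, `b`, `d`. -/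
def setBlockCmd (W c : ℕ) (j a b d : Expr) : Cmd :=
  let t : Expr := Expr.barrier W c
  let m : Expr := Expr.partner W c j
  let i : Expr := Expr.partner W c t
  .iteLt j t
    (.iteEq m j
      (.iteEq (a ||| b ||| d) 0 (clearCmd W c j)
        (keepCmd [(0, j, a), (0, .fixLoc W c t j a, a), (1, j, b), (2, j, d)]))
      (.iteEq i t
        (growCmd W c [(0, t, m), (0, m, t), (0, j, a), (0, .fixLoc W c (t + 1) j a, a),
          (1, t, .field 1 j), (1, j, b), (2, t, .field 2 j), (2, j, d)])
        (.iteEq i j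
          (growCmd W c [(0, j, a), (0, t, .field 2 t), (0, .fixLoc W c (t + 1) j a, a),
            (0, .fixLoc W c (t + 1) t (.field 2 t), .field 2 t), (1, j, b), (1, t, .field 1 j),
            (2, j, d), (2, t, .field 2 j)])
          (growCmd W c [(0, i, m), (0, m, i), (0, j, a), (0, t, .field 2 t),
            (0, .fixLoc W c (t + 1) j a, a), (0, .fixLoc W c (t + 1) t (.field 2 t), .field 2 t),
            (1, i, .field 1 j), (1, j, b), (1, t, .field 1 i), (2, i, .field 2 j), (2, j, d),
            (2, t, .field 2 i)]))))
    (.iteEq m j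
      (.iteEq j t
        (growCmd W c [(0, t, a), (0, .fixLoc W c (t + 1) t a, a), (1, t, b), (2, t, d)])
        (.iteEq i t
          (growCmd W c [(0, t, j), (0, j, t), (1, t, b), (2, t, d), (2, j, a)])
          (growCmd W c [(0, i, j), (0, j, i), (0, t, .field 2 t),
            (0, .fixLoc W c (t + 1) t (.field 2 t), .field 2 t), (1, i, b), (1, t, .field 1 i),
            (2, i, d), (2, j, a), (2, t, .field 2 i)])))
      (.iteEq (a ||| b ||| d) 0 (clearCmd W c m)
        (keepCmd [(1, m, b), (2, j, a), (2, m, d)])))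

theorem Cmd.eval_iteEq {w : ℕ} {Γ : Ctx w} (a b : Expr) (p q : Cmd) :
    (Cmd.iteEq a b p q).eval Γ = if a.val Γ = b.val Γ then p.eval Γ else q.eval Γ := by
  simp only [Cmd.eval, Expr.val]
  congr

theorem Cmd.eval_iteLt {w : ℕ} {Γ : Ctx w} (a b : Expr) (p q : Cmd) :
    (Cmd.iteLt a b p q).eval Γ = if a.val Γ < b.val Γ then p.eval Γ else q.eval Γ := by
  simp only [Cmd.eval, Expr.val]
  congr

theorem fixLoc_lt {N t x a : ℕ} {P : ℕ → ℕ} (hx : x < N) : fixLoc N t P x a < N := by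
  unfold fixLoc
  split_ifs <;> omega

theorem Updated.of_iff {N t : ℕ} {P X Y : ℕ → ℕ} {t' : ℕ} {P' X' Y' : ℕ → ℕ} {j a b c : ℕ}
    {z z' : Prop} (hU : Updated N t P X Y t' P' X' Y' j a b c z) (hz : z ↔ z') :
    Updated N t P X Y t' P' X' Y' j a b c z' := by
  rwa [← propext hz]

namespace Setup

variable {W c w n base : ℕ} {Γ : Ctx w} (h : Setup W c Γ n base)

include h

theorem val_field_word {r : ℕ} {i : Expr} (hi : i.val Γ < blocks w n) (hr : r < 3) :
    (Expr.field r i).val Γ = words base Γ.mem (3 * i.val Γ + r) := by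
  rw [Expr.field, h.val_word]
  exact congrArg _ (h.val_field (x := (r, i, i)) ⟨hr, hi⟩)

theorem val_fixLoc {t x a : Expr} :
    (Expr.fixLoc W c t x a).val Γ = fixLoc (blocks w n) (t.val Γ)
      (fun i => words base Γ.mem (3 * i)) (x.val Γ) (a.val Γ) := by
  unfold Expr.fixLoc fixLoc
  simp only [Expr.val_iteLt, Expr.val_iteEq, h.val_numBlocks, h.val_word]
  by_cases h1 : a.val Γ < blocks w n
  · rw [h.val_three_mul h1]
    grind
  · simp [h1]

theorem clearCmd_blockSet {f : Expr} {j : ℕ} (hv : Valid w n (words base Γ.mem))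
    (hj : j < blocks w n)
    (hfree : ¬ Free (blocks w n) (barrier w n (words base Γ.mem))
      (fun i => words base Γ.mem (3 * i)) j)
    (hf : slot (blocks w n) (barrier w n (words base Γ.mem))
      (fun i => words base Γ.mem (3 * i)) j = f.val Γ) :
    BlockSet n base Γ.mem ((clearCmd W c f).eval Γ) j 0 0 0 := by
  have ht := hv.barrier_le
  have hft : f.val Γ < barrier w n (words base Γ.mem) := by
    have h1 := mate_range (N := blocks w n) (t := barrier w n (words base Γ.mem))
      (P := fun i => words base Γ.mem (3 * i)) j
    unfold slot at hf
    unfold Free at hfree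
    grind
  obtain ⟨u, hu⟩ : ∃ u, barrier w n (words base Γ.mem) = u + 1 :=
    ⟨barrier w n (words base Γ.mem) - 1, by omega⟩
  have e1 : Expr.val Γ 1 = 1 := Expr.val_one h.one_le_wordLen
  have e3 : (Expr.barrier W c - 1).val Γ = u := by
    rw [Expr.val_sub, h.val_barrier, e1]
    · omega
    · rw [h.val_barrier, e1]; omega
  have huN : u < blocks w n := by omega
  have hfN : f.val Γ < blocks w n := by omega
  have e4 := h.val_partner (i := Expr.barrier W c - 1) (by omega)
  have e5 := h.val_field_word (r := 0) (i := Expr.barrier W c - 1) (by omega) (by omega)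
  have e6 := h.val_field_word (r := 1) (i := Expr.barrier W c - 1) (by omega) (by omega)
  have e7 := h.val_field_word (r := 2) (i := Expr.barrier W c - 1) (by omega) (by omega)
  have hp := partner_lt (w := w) (n := n) (A := words base Γ.mem) huN
  rw [e3] at e4 e5 e6 e7
  unfold clearCmd
  simp only [Cmd.eval_iteEq, e3, e4]
  split_ifs with h1 h2
  · refine h.shrinkCmd_blockSet hv hj hu (by simp [e3, huN]) fun P' X' Y' hP hX hY => ?_
    unfold UpdatedWords
    rw [hu] at hfree hf ⊢
    refine (updated_shrink_self huN hfree hj (hf.trans h1) (fun x hx => ?_) (fun x hx => ?_)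
      (fun x hx => ?_)).of_iff (by simp)
    · rw [hP x hx]; simp [applyFields, fieldVals, e3]
    · rw [hX x hx]; simp [applyFields, fieldVals]
    · rw [hY x hx]; simp [applyFields, fieldVals]
  · refine h.shrinkCmd_blockSet hv hj hu (by simp [e3, huN, hfN]) fun P' X' Y' hP hX hY => ?_
    unfold UpdatedWords
    unfold partner at h2
    rw [hu] at hfree hf h2 ⊢
    refine (updated_shrink_unmatched huN hfree hj hf h1 h2 (fun x hx => ?_) (fun x hx => ?_)
      (fun x hx => ?_)).of_iff (by simp)
    · rw [hP x hx]; simp [applyFields, fieldVals, e3]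
    · rw [hX x hx]; simp [applyFields, fieldVals, e6]
    · rw [hY x hx]; simp [applyFields, fieldVals, e3, e5, e7]
  · refine h.shrinkCmd_blockSet hv hj hu (by simp [e3, e4, huN, hfN, hp])
      fun P' X' Y' hP hX hY => ?_
    unfold UpdatedWords
    unfold partner at h2 e4
    rw [hu] at hfree hf h2 e4 ⊢
    refine (updated_shrink_matched huN hfree hj hf h1 rfl h2 (fun x hx => ?_) (fun x hx => ?_)
      (fun x hx => ?_)).of_iff (by simp)
    · rw [hP x hx]; simp [applyFields, fieldVals, e3, e4]
    · rw [hX x hx]; simp [applyFields, fieldVals, e6]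
    · rw [hY x hx]; simp [applyFields, fieldVals, e7]

-- Each leaf of the decision tree is one of the lemmas `updated_*` with its assignments as stores.
-- The case that a free block receives zero data is excluded by `hne`, since it would move the
-- barrier for no reason.
set_option maxHeartbeats 2000000 in
theorem setBlockCmd_blockSet {j a b d : Expr} (hv : Valid w n (words base Γ.mem))
    (hj : j.val Γ < blocks w n)
    (hne : Free (blocks w n) (barrier w n (words base Γ.mem))
      (fun i => words base Γ.mem (3 * i)) (j.val Γ) →
        ¬ (a.val Γ = 0 ∧ b.val Γ = 0 ∧ d.val Γ = 0)) :
    BlockSet n base Γ.mem ((setBlockCmd W c j a b d).eval Γ) (j.val Γ) (a.val Γ) (b.val Γ)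
      (d.val Γ) := by
  have ht := hv.barrier_le
  have hNw := blocks_le w n
  have hlw := h.last_lt
  have e1 : Expr.val Γ 1 = 1 := Expr.val_one h.one_le_wordLen
  have e0 : (a ||| b ||| d).val Γ = 0 ↔ a.val Γ = 0 ∧ b.val Γ = 0 ∧ d.val Γ = 0 := by
    rw [Expr.val_or, Expr.val_or, Nat.or_eq_zero_iff, Nat.or_eq_zero_iff, and_assoc]
  have em := h.val_partner hj
  have hm := partner_lt (A := words base Γ.mem) hj
  have j1 := h.val_field_word (r := 1) hj (by omega)
  have j2 := h.val_field_word (r := 2) hj (by omega)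
  have hr := mate_range (N := blocks w n) (t := barrier w n (words base Γ.mem))
    (P := fun i => words base Γ.mem (3 * i)) (j.val Γ)
  have et1 : barrier w n (words base Γ.mem) < blocks w n →
      (Expr.barrier W c + 1).val Γ = barrier w n (words base Γ.mem) + 1 := fun hlt => by
    rw [Expr.val_add, h.val_barrier, e1]
    rw [h.val_barrier, e1]; omega
  unfold setBlockCmd
  simp only [Cmd.eval_iteEq, Cmd.eval_iteLt, em, e0, h.val_barrier, Expr.val_zero]
  by_cases hjt : j.val Γ < barrier w n (words base Γ.mem)
  · rw [if_pos hjt]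
    by_cases hmj : partner w n (words base Γ.mem) (j.val Γ) = j.val Γ
    · rw [if_pos hmj]
      by_cases hz : a.val Γ = 0 ∧ b.val Γ = 0 ∧ d.val Γ = 0
      · rw [if_pos hz, hz.1, hz.2.1, hz.2.2]
        refine h.clearCmd_blockSet hv hj ?_ (if_pos hjt)
        unfold Free
        unfold partner at hmj
        tauto
      · rw [if_neg hz]
        refine h.keepCmd_blockSet hv hj ?_ (fun hlt => ?_) fun P' X' Y' hP hX hY => ?_
        · simp [h.val_fixLoc, hj, fixLoc_lt]
        · have : blocks w n - 1 ≠ j.val Γ := by omega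
          simp [applyFields, fieldVals, this]
        · refine (updated_left ht hjt hmj (fun x hx => ?_) (fun x hx => ?_)
            (fun x hx => ?_)).of_iff (iff_of_false id hz)
          · rw [hP x hx]; simp [applyFields, fieldVals, h.val_fixLoc, h.val_barrier]
          · rw [hX x hx]; simp [applyFields, fieldVals]
          · rw [hY x hx]; simp [applyFields, fieldVals]
    · rw [if_neg hmj]
      have hz := hne (by unfold Free; unfold partner at hmj; tauto)
      have htN : barrier w n (words base Γ.mem) < blocks w n := by
        unfold partner at hmj; omega
      have hbt : (Expr.barrier W c).val Γ < blocks w n := by rwa [h.val_barrier]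
      have ei := h.val_partner hbt
      rw [h.val_barrier] at ei
      have t2 := h.val_field_word (r := 2) hbt (by omega)
      have hi := partner_lt (A := words base Γ.mem) htN
      have i1 := h.val_field_word (r := 1) (i := Expr.partner W c (Expr.barrier W c))
        (by rwa [ei]) (by omega)
      have i2 := h.val_field_word (r := 2) (i := Expr.partner W c (Expr.barrier W c))
        (by rwa [ei]) (by omega)
      have et := et1 htN
      simp only [ei, h.val_barrier] at t2 i1 i2 ⊢
      by_cases hit : partner w n (words base Γ.mem) (barrier w n (words base Γ.mem)) =
        barrier w n (words base Γ.mem)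
      · rw [if_pos hit]
        refine h.growCmd_blockSet hv hj htN ?_ fun P' X' Y' hP hX hY => ?_
        · simp [h.val_fixLoc, hj, fixLoc_lt, h.val_barrier, htN, em, hm]
        · refine (updated_extend_left htN hit hjt rfl hmj (fun x hx => ?_) (fun x hx => ?_)
            (fun x hx => ?_)).of_iff (iff_of_false id hz)
          · rw [hP x hx]
            simp [applyFields, fieldVals, h.val_fixLoc, h.val_barrier, et, em]
            rfl
          · rw [hX x hx]; simp [applyFields, fieldVals, h.val_barrier, j1]
          · rw [hY x hx]; simp [applyFields, fieldVals, h.val_barrier, j2]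
      · rw [if_neg hit]
        by_cases hij : partner w n (words base Γ.mem) (barrier w n (words base Γ.mem)) = j.val Γ
        · rw [if_pos hij]
          refine h.growCmd_blockSet hv hj htN ?_ fun P' X' Y' hP hX hY => ?_
          · simp [h.val_fixLoc, hj, fixLoc_lt, h.val_barrier, htN]
          · refine (updated_extend_matched_self htN hij hjt.ne (fun x hx => ?_) (fun x hx => ?_)
              (fun x hx => ?_)).of_iff (iff_of_false id hz)
            · rw [hP x hx]
              simp [applyFields, fieldVals, h.val_fixLoc, h.val_barrier, et, t2]
            · rw [hX x hx]; simp [applyFields, fieldVals, h.val_barrier, j1]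
            · rw [hY x hx]; simp [applyFields, fieldVals, h.val_barrier, j2]
        · rw [if_neg hij]
          refine h.growCmd_blockSet hv hj htN ?_ fun P' X' Y' hP hX hY => ?_
          · simp [h.val_fixLoc, hj, fixLoc_lt, h.val_barrier, htN, em, ei, hm, hi]
          · refine (updated_extend_matched_left htN rfl hit hjt hij rfl hmj (fun x hx => ?_)
              (fun x hx => ?_) (fun x hx => ?_)).of_iff (iff_of_false id hz)
            · rw [hP x hx]
              simp [applyFields, fieldVals, h.val_fixLoc, h.val_barrier, et, t2, em, ei]
              rfl
            · rw [hX x hx]; simp [applyFields, fieldVals, h.val_barrier, j1, i1, ei]; rfl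
            · rw [hY x hx]; simp [applyFields, fieldVals, h.val_barrier, j2, i2, ei]; rfl
  · rw [if_neg hjt]
    by_cases hmj : partner w n (words base Γ.mem) (j.val Γ) = j.val Γ
    · rw [if_pos hmj]
      have hz := hne (by unfold Free; unfold partner at hmj; tauto)
      have htN : barrier w n (words base Γ.mem) < blocks w n := by omega
      have hbt : (Expr.barrier W c).val Γ < blocks w n := by rwa [h.val_barrier]
      have ei := h.val_partner hbt
      rw [h.val_barrier] at ei
      have t2 := h.val_field_word (r := 2) hbt (by omega)
      have hi := partner_lt (A := words base Γ.mem) htN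
      have i1 := h.val_field_word (r := 1) (i := Expr.partner W c (Expr.barrier W c))
        (by rwa [ei]) (by omega)
      have i2 := h.val_field_word (r := 2) (i := Expr.partner W c (Expr.barrier W c))
        (by rwa [ei]) (by omega)
      have et := et1 htN
      simp only [ei, h.val_barrier] at t2 i1 i2 ⊢
      by_cases hjt' : j.val Γ = barrier w n (words base Γ.mem)
      · rw [if_pos hjt']
        refine h.growCmd_blockSet hv hj htN ?_ fun P' X' Y' hP hX hY => ?_
        · simp [h.val_fixLoc, fixLoc_lt, h.val_barrier, htN]
        · rw [hjt'] at hmj ⊢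
          refine (updated_extend_self htN hmj (fun x hx => ?_) (fun x hx => ?_)
            (fun x hx => ?_)).of_iff (iff_of_false id hz)
          · rw [hP x hx]; simp [applyFields, fieldVals, h.val_fixLoc, h.val_barrier, et]
          · rw [hX x hx]; simp [applyFields, fieldVals, h.val_barrier]
          · rw [hY x hx]; simp [applyFields, fieldVals, h.val_barrier]
      · rw [if_neg hjt']
        have hlt : barrier w n (words base Γ.mem) < j.val Γ := by omega
        by_cases hit : partner w n (words base Γ.mem) (barrier w n (words base Γ.mem)) =
          barrier w n (words base Γ.mem)
        · rw [if_pos hit]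
          refine h.growCmd_blockSet hv hj htN ?_ fun P' X' Y' hP hX hY => ?_
          · simp [hj, h.val_barrier, htN]
          · refine (updated_extend_right htN hit hlt hj hmj (fun x hx => ?_) (fun x hx => ?_)
              (fun x hx => ?_)).of_iff (iff_of_false id hz)
            · rw [hP x hx]; simp [applyFields, fieldVals, h.val_barrier]
            · rw [hX x hx]; simp [applyFields, fieldVals, h.val_barrier]
            · rw [hY x hx]; simp [applyFields, fieldVals, h.val_barrier]
        · rw [if_neg hit]
          refine h.growCmd_blockSet hv hj htN ?_ fun P' X' Y' hP hX hY => ?_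
          · simp [h.val_fixLoc, hj, fixLoc_lt, h.val_barrier, htN, ei, hi]
          · refine (updated_extend_matched_right htN rfl hit hlt hj hmj (fun x hx => ?_)
              (fun x hx => ?_) (fun x hx => ?_)).of_iff (iff_of_false id hz)
            · rw [hP x hx]
              simp [applyFields, fieldVals, h.val_fixLoc, h.val_barrier, et, t2, ei]
              rfl
            · rw [hX x hx]; simp [applyFields, fieldVals, h.val_barrier, i1, ei]; rfl
            · rw [hY x hx]; simp [applyFields, fieldVals, h.val_barrier, i2, ei]; rfl
    · rw [if_neg hmj]
      by_cases hz : a.val Γ = 0 ∧ b.val Γ = 0 ∧ d.val Γ = 0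
      · rw [if_pos hz, hz.1, hz.2.1, hz.2.2]
        refine h.clearCmd_blockSet hv hj ?_ ?_
        · unfold Free
          unfold partner at hmj
          tauto
        · rw [slot, if_neg hjt, em]
          rfl
      · rw [if_neg hz]
        refine h.keepCmd_blockSet hv hj ?_ (fun hlt => ?_) fun P' X' Y' hP hX hY => ?_
        · simp [hj, em, hm]
        · have : blocks w n - 1 ≠ partner w n (words base Γ.mem) (j.val Γ) := by
            unfold partner at hmj ⊢; omega
          simp [applyFields, fieldVals, em, this]
        · refine (updated_right (not_lt.1 hjt) hj hmj (fun x hx => ?_) (fun x hx => ?_)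
            (fun x hx => ?_)).of_iff (iff_of_false id hz)
          · rw [hP x hx]; simp [applyFields, fieldVals]
          · rw [hX x hx]; simp [applyFields, fieldVals, em]; rfl
          · rw [hY x hx]; simp [applyFields, fieldVals, em]; rfl

end Setup

/-! ### Changing a single bit of the represented vector -/

/-- The `r`-th word of the data of the block of bit `p` after the bit has been changed. -/
def Expr.toggledData (W c : ℕ) (p : Expr) (r : ℕ) : Expr :=
  .iteEq (p / .wordLen W c % 3) (.const r)
    (.data W c (p / .wordLen W c / 3) (.const r) ^^^ ((1 : Expr) <<< (p % .wordLen W c)))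
    (.data W c (p / .wordLen W c / 3) (.const r))

/-- Change of bit `p` of the represented bit vector. -/
def toggleCmd (W c : ℕ) (p : Expr) : Cmd :=
  .iteLt (p / .wordLen W c) (.numBlockWords W c)
    (setBlockCmd W c (p / .wordLen W c / 3) (.toggledData W c p 0) (.toggledData W c p 1)
      (.toggledData W c p 2))
    (storeWords [(p / .wordLen W c,
      .word (p / .wordLen W c) ^^^ ((1 : Expr) <<< (p % .wordLen W c)))])

theorem data_eq_zero_of_free {w n : ℕ} {A : ℕ → ℕ} {j : ℕ}
    (h : Free (blocks w n) (barrier w n A) (fun i => A (3 * i)) j) (k : ℕ) :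
    data w n A j k = 0 := by
  unfold Free at h
  unfold data content
  grind

theorem eq_of_div_eq_of_mod_eq {w p q : ℕ} (h1 : q / w = p / w) (h2 : q % w = p % w) : q = p := by
  rw [← Nat.div_add_mod q w, h1, h2, Nat.div_add_mod]

/-- Bit `p` of the represented bit vector has been changed. -/
structure Toggled {w : ℕ} (n base : ℕ) (M M' : Mem w) (p : ℕ) : Prop where
  valid : Valid w n (words base M')
  outside : SameOutside n base M M'
  plainBit_eq : ∀ q < n, plainBit w n (words base M') q =
    (plainBit w n (words base M) q ^^ decide (q = p))

theorem testBit_xor_two_pow (x m b : ℕ) :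
    (x ^^^ 2 ^ m).testBit b = (x.testBit b ^^ decide (m = b)) := by
  rw [Nat.testBit_xor, Nat.testBit_two_pow]

namespace Setup

variable {W c w n base : ℕ} {Γ : Ctx w} (h : Setup W c Γ n base)

include h

theorem val_toggledData {p : Expr} (hp : p.val Γ / w < 3 * blocks w n) {r : ℕ} (hr : r < 3) :
    (Expr.toggledData W c p r).val Γ =
      if p.val Γ / w % 3 = r then
        data w n (words base Γ.mem) (p.val Γ / w / 3) r ^^^ 2 ^ (p.val Γ % w)
      else data w n (words base Γ.mem) (p.val Γ / w / 3) r := by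
  have e1 : (p / Expr.wordLen W c).val Γ = p.val Γ / w := by rw [Expr.val_div, h.val_wordLen]
  have e2 : (p % Expr.wordLen W c).val Γ = p.val Γ % w := by rw [Expr.val_mod, h.val_wordLen]
  have h8 := h.eight_lt (by omega)
  have e3 : (Expr.const r).val Γ = r := Expr.val_const (by omega)
  have e4 := h.val_div_three (k := p / Expr.wordLen W c) (by rwa [e1])
  have e5 := h.val_mod_three (k := p / Expr.wordLen W c) (by rwa [e1])
  have e6 := h.val_data (j := p / Expr.wordLen W c / 3) (k := .const r) (by omega) (by omega)
  rw [e3, e4, e1] at e6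
  rw [Expr.toggledData, Expr.val_iteEq, Expr.val_xor, e6, e5, e1, e3, Expr.val_one_shl, e2]
  rw [e2]
  exact Nat.mod_lt _ h.one_le_wordLen

/-- A free block represents zero, and a flipped bit makes it nonzero; so the excluded case of
`setBlockCmd_blockSet` does not arise. -/
theorem toggled_setBlockCmd {p : Expr} (hv : Valid w n (words base Γ.mem))
    (hp : p.val Γ / w < 3 * blocks w n) :
    Toggled n base Γ.mem ((setBlockCmd W c (p / .wordLen W c / 3) (.toggledData W c p 0)
      (.toggledData W c p 1) (.toggledData W c p 2)).eval Γ) (p.val Γ) := by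
  have e1 : (p / Expr.wordLen W c).val Γ = p.val Γ / w := by rw [Expr.val_div, h.val_wordLen]
  have e4 := h.val_div_three (k := p / Expr.wordLen W c) (by rwa [e1])
  rw [e1] at e4
  have d0 := h.val_toggledData hp (r := 0) (by omega)
  have d1 := h.val_toggledData hp (r := 1) (by omega)
  have d2 := h.val_toggledData hp (r := 2) (by omega)
  have hr : p.val Γ / w % 3 = 0 ∨ p.val Γ / w % 3 = 1 ∨ p.val Γ / w % 3 = 2 := by omega
  have hB := h.setBlockCmd_blockSet (j := p / .wordLen W c / 3) (a := .toggledData W c p 0)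
    (b := .toggledData W c p 1) (d := .toggledData W c p 2) hv (by omega) (fun hf => by
      rw [e4] at hf
      have h0 := data_eq_zero_of_free hf
      have hpos : 2 ^ (p.val Γ % w) ≠ 0 := by positivity
      rw [d0, d1, d2, h0, h0, h0, Nat.zero_xor]
      rcases hr with hr | hr | hr <;> simp [hr])
  rw [e4, d0, d1, d2] at hB
  refine ⟨hB.valid, hB.outside, fun q hq => ?_⟩
  rw [hB.plainBit_eq q hq]
  by_cases h1 : q / w < 3 * blocks w n ∧ q / w / 3 = p.val Γ / w / 3
  · rw [if_pos h1, plainBit, plainWord, if_pos h1.1, h1.2]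
    have h2 : q = p.val Γ ↔ q / w % 3 = p.val Γ / w % 3 ∧ p.val Γ % w = q % w :=
      ⟨fun he => by simp [he], fun he => eq_of_div_eq_of_mod_eq (w := w) (by omega) he.2.symm⟩
    have hs : q / w % 3 = 0 ∨ q / w % 3 = 1 ∨ q / w % 3 = 2 := by omega
    simp only [h2]
    rcases hs with hs | hs | hs <;> rcases hr with hr | hr | hr <;>
      simp [hs, hr, sel, Nat.testBit_xor, Nat.testBit_two_pow]
  · have h2 : q ≠ p.val Γ := fun he => h1 (by rw [he]; exact ⟨hp, rfl⟩)
    rw [if_neg h1]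
    simp [h2]

theorem toggled_storeWords {p : Expr} (hv : Valid w n (words base Γ.mem)) (hpn : p.val Γ < n)
    (hp : ¬ p.val Γ / w < 3 * blocks w n) :
    Toggled n base Γ.mem ((storeWords [(p / .wordLen W c,
      .word (p / .wordLen W c) ^^^ ((1 : Expr) <<< (p % .wordLen W c)))]).eval Γ) (p.val Γ) := by
  have hw := h.one_le_wordLen
  have e1 : (p / Expr.wordLen W c).val Γ = p.val Γ / w := by rw [Expr.val_div, h.val_wordLen]
  have e2 : (p % Expr.wordLen W c).val Γ = p.val Γ % w := by rw [Expr.val_mod, h.val_wordLen]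
  have hle : p.val Γ / w ≤ n / w := Nat.div_le_div_right hpn.le
  have hN := blocks_le w n
  have hl : ∀ x ∈ [(p / Expr.wordLen W c, Expr.word (p / .wordLen W c) ^^^
      ((1 : Expr) <<< (p % .wordLen W c)))], x.1.val Γ ≤ n / w := by
    simpa [e1] using hle
  have e : ∀ k ≤ n / w, words base ((storeWords [(p / Expr.wordLen W c,
      Expr.word (p / .wordLen W c) ^^^ ((1 : Expr) <<< (p % .wordLen W c)))]).eval Γ) k =
      if k = p.val Γ / w then words base Γ.mem k ^^^ 2 ^ (p.val Γ % w)
      else words base Γ.mem k := by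
    intro k hk
    rw [h.words_storeWords hl hk]
    simp only [List.map_cons, List.map_nil, applyWords, e1]
    rw [Expr.val_xor, h.val_word, e1, Expr.val_one_shl, e2]
    · split_ifs with h1
      · rw [h1]
      · rfl
    · rw [e2]
      exact Nat.mod_lt _ hw
  generalize hM : (storeWords _).eval Γ = M' at *
  have hM' := fun a ha => hM ▸ h.storeWords_apply_of_ne hl (a := a) ha
  have elt : ∀ k < 3 * blocks w n, words base M' k = words base Γ.mem k := fun k hk => by
    rw [e k (by omega), if_neg (by omega)]
  -- Since `p < n`, neither the flag nor a foreign bit is flipped if `p` lies in the last word.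
  have elast : ∀ m, n % w ≤ m → (words base M' (n / w)).testBit m =
      (words base Γ.mem (n / w)).testBit m := fun m hm => by
    rw [e _ le_rfl]
    split_ifs with h1
    · have h2 := Nat.div_add_mod n w
      have h3 := Nat.div_add_mod (p.val Γ) w
      rw [h1] at h2
      rw [testBit_xor_two_pow, decide_eq_false (by omega), Bool.xor_false]
    · rfl
  have eb : barrier w n (words base M') = barrier w n (words base Γ.mem) := by
    unfold barrier
    rw [elast _ le_rfl]
    split_ifs
    · rfl
    · rfl
    · exact elt _ (by omega)
  have ed : ∀ j < blocks w n, ∀ k, data w n (words base M') j k =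
      data w n (words base Γ.mem) j k := fun j hj k => by
    have := hv.barrier_le
    unfold data
    rw [eb]
    exact content_congr (fun x hx => elt _ (by omega)) (fun x hx => elt _ (by omega))
      (fun x hx => elt _ (by omega)) hj k
  refine ⟨⟨eb ▸ hv.barrier_le, fun hf => ?_, fun j hj => ?_⟩, ?_, fun q hq => ?_⟩
  · rw [elast _ le_rfl]
    exact hv.full (eb ▸ hf)
  · refine (hv.occupied j hj).imp (fun hf => ?_) fun ⟨k, hk, hd⟩ => ⟨k, hk, ?_⟩
    · unfold Free at *
      rwa [eb, mate_congr (fun x hx => elt (3 * x) (by omega)) hj]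
    · rwa [ed j hj]
  · exact h.sameOutside hM' fun m hm => elast m hm.le
  · have hqle : q / w ≤ n / w := Nat.div_le_div_right hq.le
    unfold plainBit plainWord
    split_ifs with h1
    · have h2 : q ≠ p.val Γ := fun he => hp (by rwa [← he])
      rw [ed _ (by omega)]
      simp [h2]
    · rw [e _ hqle]
      split_ifs with h2
      · have h3 : q = p.val Γ ↔ p.val Γ % w = q % w :=
          ⟨fun he => by rw [he], fun he => eq_of_div_eq_of_mod_eq h2 he.symm⟩
        simp only [testBit_xor_two_pow, h3]
      · have h3 : q ≠ p.val Γ := fun he => h2 (by rw [he])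
        simp [h3]

theorem toggled_toggleCmd {p : Expr} (hv : Valid w n (words base Γ.mem)) (hpn : p.val Γ < n) :
    Toggled n base Γ.mem ((toggleCmd W c p).eval Γ) (p.val Γ) := by
  have e1 : (p / Expr.wordLen W c).val Γ = p.val Γ / w := by rw [Expr.val_div, h.val_wordLen]
  rw [toggleCmd, Cmd.eval_iteLt, e1, h.val_numBlockWords]
  split_ifs with h1
  · exact h.toggled_setBlockCmd hv h1
  · exact h.toggled_storeWords hv hpn h1

end Setup

/-! ### Specifications of the operations -/

theorem RepWords.choice {w n : ℕ} {A : ℕ → ℕ} {σ : ℕ} {q : State} (hr : RepWords w n A σ q)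
    (hw : 1 ≤ w) (hA : ∀ k, A k < 2 ^ w) {x : ℕ}
    (hx : x = if search w n A 0 < n then elemAt w n A (search w n A 0) else 0) :
    x ∈ q.client ∨ (q.client = ∅ ∧ x = 0) := by
  obtain ⟨hv, hc, -⟩ := hr
  have hf := hv.isFirst_search hw hA 0
  split_ifs at hx with h1
  · rw [hx, hc]
    exact Or.inl (elemAt_mem_client hw hv.barrier_le h1 (hf.2.2 h1).2)
  · have h2 := client_subset_enumSet hw hv.barrier_le hf h1
    rw [enumSet_zero, Finset.subset_empty] at h2
    exact Or.inr ⟨hc.trans h2, hx⟩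

/-- The search is correct from every `σ`, and validity does not involve `σ`. So an outdated state
still yields an element or 0. -/
theorem RepWords.next {w n : ℕ} {A : ℕ → ℕ} {σ : ℕ} {q : State} (hr : RepWords w n A σ q)
    (hw : 1 ≤ w) (hA : ∀ k, A k < 2 ^ w) {x y : ℕ}
    (hx : x = if search w n A σ < n then elemAt w n A (search w n A σ) else 0)
    (hy : y = if search w n A σ < n then search w n A σ + 1 else σ) :
    ∃ q' : State, q.Next x q' ∧ RepWords w n A y q' := by
  obtain ⟨hv, hc, he⟩ := hr
  obtain ⟨S, o⟩ := q
  dsimp only at hc he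
  subst hc
  have hf := hv.isFirst_search hw hA σ
  split_ifs at hx hy with h1 <;> subst hx <;> subst hy
  · cases o with
    | none =>
      exact ⟨_, ⟨Or.inl (elemAt_mem_client hw hv.barrier_le h1 (hf.2.2 h1).2), rfl⟩, hv, rfl,
        by simp⟩
    | some E =>
      obtain rfl := he E rfl
      refine ⟨_, Or.inl ⟨elemAt_mem_sdiff hw hv.barrier_le hf h1, rfl⟩, hv, rfl, fun E hE => ?_⟩
      rw [← Option.some.inj hE, insert_elemAt_enumSet hf h1]
  · cases o with
    | none => exact ⟨_, ⟨Or.inr rfl, rfl⟩, hv, rfl, by simp⟩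
    | some E =>
      obtain rfl := he E rfl
      refine ⟨_, Or.inr ⟨?_, rfl, rfl⟩, hv, rfl, he⟩
      exact Finset.sdiff_eq_empty_iff_subset.2 (client_subset_enumSet hw hv.barrier_le hf h1)

theorem RepWords.done {w n : ℕ} {A : ℕ → ℕ} {σ : ℕ} {q : State} (hr : RepWords w n A σ q)
    (hw : 1 ≤ w) (hA : ∀ k, A k < 2 ^ w) {x : ℕ}
    (hx : x = if search w n A σ < n then 0 else 1) : q.Done x := by
  obtain ⟨hv, hc, he⟩ := hr
  obtain ⟨S, o⟩ := q
  dsimp only at hc he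
  subst hc
  have hf := hv.isFirst_search hw hA σ
  cases o with
  | none =>
    change x = 0 ∨ x = 1
    split_ifs at hx <;> simp [hx]
  | some E =>
    obtain rfl := he E rfl
    change x = if client w n A ⊆ enumSet w n A σ then 1 else 0
    split_ifs at hx with h1
    · have h2 := Finset.mem_sdiff.1 (elemAt_mem_sdiff hw hv.barrier_le hf h1)
      rw [hx, if_neg fun hs => h2.2 (hs h2.1)]
    · rw [hx, if_pos (client_subset_enumSet hw hv.barrier_le hf h1)]

theorem RepWords.reset {w n : ℕ} {A : ℕ → ℕ} {σ : ℕ} {q : State} (hr : RepWords w n A σ q) :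
    RepWords w n A 0 ⟨q.client, some ∅⟩ :=
  ⟨hr.1, hr.2.1, fun E hE => by rw [← Option.some.inj hE, enumSet_zero]⟩

theorem SameOutside.refl {w n base : ℕ} (M : Mem w) : SameOutside n base M M :=
  fun _ _ _ => rfl

theorem Toggled.client_eq {w n base : ℕ} {M M' : Mem w} {l : ℕ}
    (hT : Toggled n base M M' (l - 1)) (hl : l ∈ Finset.Icc 1 n) :
    client w n (words base M') = if l ∈ client w n (words base M) then
      (client w n (words base M)).erase l else insert l (client w n (words base M)) := by
  rw [Finset.mem_Icc] at hl
  ext x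
  have hx : x ∈ client w n (words base M') ↔ (1 ≤ x ∧ x ≤ n) ∧
      (plainBit w n (words base M) (x - 1) ^^ decide (x = l)) = true := by
    rw [mem_client]
    refine and_congr_right fun hx => ?_
    rw [hT.plainBit_eq _ (by omega)]
    simp only [show x - 1 = l - 1 ↔ x = l by omega]
  rw [hx]
  split_ifs with h1
  · rw [Finset.mem_erase]
    by_cases hxl : x = l
    · subst hxl
      simp [(mem_client.1 h1).2]
    · simp [hxl, mem_client]
  · rw [Finset.mem_insert]
    by_cases hxl : x = l
    · subst hxl
      simp only [mem_client, hl, true_and] at h1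
      simp [h1, hl]
    · simp [hxl, mem_client]

namespace Expr

variable (W c : ℕ)

/-- The bit that says whether the argument is in the client set. -/
def member : Expr :=
  bitAt (plainWord W c ((reg 2 - 1) / wordLen W c)) ((reg 2 - 1) % wordLen W c)

/-- The first element with a rank position of at least `p`; `0` if there is none. -/
def next (p : Expr) : Expr := iteLt (search W c p) (reg 1) (elemAt W c (search W c p)) 0

/-- The rank position after that of the first element with a rank position of at least `p`. -/
def nextPos (p : Expr) : Expr := iteLt (search W c p) (reg 1) (search W c p + 1) p

/-- Is there no element with a rank position of at least `p`? -/
def done (p : Expr) : Expr := iteLt (search W c p) (reg 1) 0 1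

/-- The last word of the dictionary with the bits of the dictionary set to `0`. -/
def clearedLast : Expr :=
  (word (lastWord W c) >>> (lastBits W c + 1)) <<< (lastBits W c + 1)

/-- The successor of the word index `k`, unless `k` is the last one. -/
def succOrLast (k : Expr) : Expr := iteLt k (lastWord W c) (k + 1) k

end Expr

/-- Initialization to the empty set. -/
def initCmd (W c : ℕ) : Cmd :=
  let k : Expr := Expr.numBlockWords W c
  storeWords [(.lastWord W c, .clearedLast W c), (k, 0), (.succOrLast W c k, 0),
    (.succOrLast W c (.succOrLast W c k), 0),
    (.iteEq (.numBlocks W c) 0 (.lastWord W c) (k - 2), 0)]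

/-- Change of the membership of the argument if the membership bit has the value `b`. -/
def updateCmd (W c : ℕ) (b : Expr) : Cmd :=
  .iteEq (.member W c) b (toggleCmd W c (.reg 2 - 1)) (.stores [])

namespace Setup

variable {W c w n base : ℕ} {Γ : Ctx w} (h : Setup W c Γ n base)

include h

theorem val_next (hb : barrier w n (words base Γ.mem) ≤ blocks w n) (p : Expr) :
    (Expr.next W c p).val Γ = if search w n (words base Γ.mem) (p.val Γ) < n then
      elemAt w n (words base Γ.mem) (search w n (words base Γ.mem) (p.val Γ)) else 0 := by
  have e := h.val_search hb p
  rw [Expr.next, Expr.val_iteLt, e, h.val_reg_one, Expr.val_zero]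
  split_ifs with h1
  · rw [h.val_elemAt (by rwa [e]), e]
  · rfl

theorem val_nextPos (hb : barrier w n (words base Γ.mem) ≤ blocks w n) (p : Expr) :
    (Expr.nextPos W c p).val Γ = if search w n (words base Γ.mem) (p.val Γ) < n then
      search w n (words base Γ.mem) (p.val Γ) + 1 else p.val Γ := by
  have e := h.val_search hb p
  have e1 := Expr.val_one (Γ := Γ) h.one_le_wordLen
  have hn := h.lt_two_pow
  rw [Expr.nextPos, Expr.val_iteLt, e, h.val_reg_one]
  split_ifs with h1
  · rw [Expr.val_add, e, e1]
    rw [e, e1]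
    omega
  · rfl

theorem val_done (hb : barrier w n (words base Γ.mem) ≤ blocks w n) (p : Expr) :
    (Expr.done W c p).val Γ =
      if search w n (words base Γ.mem) (p.val Γ) < n then 0 else 1 := by
  rw [Expr.done, Expr.val_iteLt, h.val_search hb p, h.val_reg_one, Expr.val_zero,
    Expr.val_one h.one_le_wordLen]

theorem val_arg_sub_one {l : ℕ} (hl : 1 ≤ l) (h2 : (Expr.reg 2).val Γ = l) :
    (Expr.reg 2 - 1).val Γ = l - 1 := by
  have e1 := Expr.val_one (Γ := Γ) h.one_le_wordLen
  rw [Expr.val_sub, h2, e1]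
  rwa [h2, e1]

theorem val_member {l : ℕ} (hl : 1 ≤ l) (h2 : (Expr.reg 2).val Γ = l) :
    (Expr.member W c).val Γ = (plainBit w n (words base Γ.mem) (l - 1)).toNat := by
  rw [Expr.member, h.val_bitAt, h.val_plainWord, Expr.val_div, Expr.val_mod, h.val_wordLen,
    h.val_arg_sub_one hl h2, plainBit]

theorem val_member_of_repWords {l σ : ℕ} {q : State} (hl : l ∈ Finset.Icc 1 n)
    (h2 : (Expr.reg 2).val Γ = l) (hr : RepWords w n (words base Γ.mem) σ q) :
    (Expr.member W c).val Γ = if l ∈ q.client then 1 else 0 := by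
  rw [Finset.mem_Icc] at hl
  rw [h.val_member hl.1 h2, hr.2.1]
  simp only [mem_client]
  cases plainBit w n (words base Γ.mem) (l - 1) <;> simp [hl]

/-- An update without effect stores nothing, so the rank order and with it a current iteration
survive. A real change ends the iteration, after which `σ` is unconstrained. -/
theorem updateCmd_spec {b : Bool} {e : Expr} (he : e.val Γ = b.toNat) {l σ : ℕ} {q : State}
    (hl : l ∈ Finset.Icc 1 n) (h2 : (Expr.reg 2).val Γ = l)
    (hr : RepWords w n (words base Γ.mem) σ q) :
    SameOutside n base Γ.mem ((updateCmd W c e).eval Γ) ∧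
      RepWords w n (words base ((updateCmd W c e).eval Γ)) σ
        (q.setClient (if b then q.client.erase l else insert l q.client)) := by
  have hp : (Expr.reg 2 - 1).val Γ = l - 1 := h.val_arg_sub_one (Finset.mem_Icc.1 hl).1 h2
  have hT : Toggled n base Γ.mem ((toggleCmd W c (Expr.reg 2 - 1)).eval Γ) (l - 1) :=
    hp ▸ h.toggled_toggleCmd hr.1 (by rw [Finset.mem_Icc] at hl; omega)
  have hq := hr.2.1
  rw [updateCmd, Cmd.eval_iteEq, h.val_member_of_repWords hl h2 hr, he]
  by_cases h1 : l ∈ q.client <;> cases b <;> simp only [h1, Bool.toNat_false, Bool.toNat_true,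
    if_true, if_false, Bool.false_eq_true, one_ne_zero, zero_ne_one]
  · refine ⟨.refl _, ?_⟩
    rw [Finset.insert_eq_of_mem h1]
    simpa [State.setClient, Cmd.eval, storesEval] using hr
  · refine ⟨hT.outside, hT.valid, ?_, ?_⟩
    · rw [hT.client_eq hl, ← hq, if_pos h1]
      rfl
    · simp [State.setClient, h1]
  · refine ⟨hT.outside, hT.valid, ?_, ?_⟩
    · rw [hT.client_eq hl, ← hq, if_neg h1]
      rfl
    · simp [State.setClient, h1]
  · refine ⟨.refl _, ?_⟩
    rw [Finset.erase_eq_of_notMem h1]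
    simpa [State.setClient, Cmd.eval, storesEval] using hr

/-- With barrier 0 every block is an unmatched right block, whatever its words contain. Only the
stored barrier, the flag and the tail have to be cleared. Surplus stores are directed to the last
word, where the first entry of the list prevails. -/
theorem initCmd_spec : SameOutside n base Γ.mem ((initCmd W c).eval Γ) ∧
    ∀ σ, RepWords w n (words base ((initCmd W c).eval Γ)) σ ⟨∅, none⟩ := by
  have hw := h.one_le_wordLen
  have hN := blocks_le w n
  have hN3 := last_lt_blocks w n
  have hlt := h.last_lt
  have e1 := Expr.val_one (Γ := Γ) hw
  have es : ∀ k : Expr, k.val Γ ≤ n / w →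
      (Expr.succOrLast W c k).val Γ = min (k.val Γ + 1) (n / w) := fun k hk => by
    rw [Expr.succOrLast, Expr.val_iteLt, h.val_lastWord]
    split_ifs with h1
    · rw [h.val_succ h1]; omega
    · omega
  have ek := h.val_numBlockWords
  have es1 := es _ (ek.trans_le hN)
  have es2 := es _ (es1.trans_le (by omega))
  have em : (Expr.numBlockWords W c - 2).val Γ = 3 * blocks w n - 2 ∨ blocks w n = 0 := by
    rcases Nat.eq_zero_or_pos (blocks w n) with h0 | h0
    · exact Or.inr h0
    · have e2 : Expr.val Γ 2 = 2 := h.val_two h0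
      rw [Expr.val_sub, ek, e2]
      · exact Or.inl rfl
      · rw [ek, e2]; omega
  have el : (Expr.lastBits W c + 1).val Γ = n % w + 1 := by
    have h1 : n % w < w := Nat.mod_lt _ hw
    have h2 : w < 2 ^ w := Nat.lt_two_pow_self
    rw [Expr.val_add, h.val_lastBits, e1]
    rw [h.val_lastBits, e1]; omega
  have ec : (Expr.clearedLast W c).val Γ =
      (words base Γ.mem (n / w) >>> (n % w + 1)) <<< (n % w + 1) := by
    rw [Expr.clearedLast, Expr.val_shl, Expr.val_shr, h.val_word, h.val_lastWord, el]
    rw [Expr.val_shr, h.val_word, h.val_lastWord, el, Nat.shiftRight_eq_div_pow, Nat.shiftLeft_eq]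
    exact (Nat.div_mul_le_self _ _).trans_lt (words_lt _ _)
  have hl : ∀ x ∈ [(Expr.lastWord W c, Expr.clearedLast W c), (Expr.numBlockWords W c, 0),
      (.succOrLast W c (.numBlockWords W c), 0),
      (.succOrLast W c (.succOrLast W c (.numBlockWords W c)), 0),
      (.iteEq (.numBlocks W c) 0 (.lastWord W c) (.numBlockWords W c - 2), 0)],
      x.1.val Γ ≤ n / w := by
    simp only [List.forall_mem_cons, Expr.val_iteEq, h.val_lastWord, ek, es1, es2,
      h.val_numBlocks, Expr.val_zero]
    refine ⟨le_rfl, hN, by omega, by omega, ?_, by simp⟩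
    split_ifs <;> omega
  have e : ∀ k ≤ n / w, (k = 3 * blocks w n - 2 ∨ 3 * blocks w n ≤ k) →
      words base ((initCmd W c).eval Γ) k =
        if k = n / w then (words base Γ.mem (n / w) >>> (n % w + 1)) <<< (n % w + 1) else 0 := by
    intro k hk hk'
    rw [initCmd, h.words_storeWords hl hk]
    simp only [List.map_cons, List.map_nil, applyWords, Expr.val_iteEq, h.val_lastWord, ek, es1,
      es2, h.val_numBlocks, Expr.val_zero, ec]
    split_ifs <;> first | rfl | omega
  have hlast : ∀ m, (words base ((initCmd W c).eval Γ) (n / w)).testBit m =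
      (decide (n % w < m) && (words base Γ.mem (n / w)).testBit m) := fun m => by
    rw [e _ le_rfl (Or.inr hN), if_pos rfl, testBit_shiftRight_shiftLeft]
    rfl
  have eb : barrier w n (words base ((initCmd W c).eval Γ)) = 0 := by
    rw [barrier, hlast]
    split_ifs with h1 h2
    · rfl
    · simp at h2
    · rw [e _ (by omega) (Or.inl rfl), if_neg (by omega)]
  have hfree : ∀ j, Free (blocks w n) (barrier w n (words base ((initCmd W c).eval Γ)))
      (fun i => words base ((initCmd W c).eval Γ) (3 * i)) j := fun j => by
    rw [eb]
    simp [Free, mate]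
  refine ⟨h.sameOutside (fun a ha => h.storeWords_apply_of_ne hl ha) fun m hm => ?_,
    fun σ => ⟨⟨?_, fun hf => Or.inl ?_, fun j _ => Or.inl (hfree j)⟩, ?_, by simp⟩⟩
  · rw [hlast, decide_eq_true hm, Bool.true_and]
  · omega
  · omega
  · symm
    refine Finset.filter_eq_empty_iff.2 fun l hl => ?_
    rw [Finset.mem_Icc] at hl
    generalize hp : l - 1 = p
    have hpn : p < n := by omega
    have hle : p / w ≤ n / w := Nat.div_le_div_right hpn.le
    rw [plainBit, plainWord]
    split_ifs with h1
    · rw [data_eq_zero_of_free (hfree _)]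
      simp
    · rcases hle.lt_or_eq with h2 | h2
      · rw [e _ hle (Or.inr (by omega)), if_neg h2.ne]
        simp
      · have h3 := Nat.div_add_mod n w
        have h4 := Nat.div_add_mod p w
        rw [h2] at h4
        rw [h2, hlast, decide_eq_false (by omega)]
        simp

end Setup

/-! ### Programs, representation by bits, and assembly -/

/-- The programs for the operations. -/
def code (W c : ℕ) : Op → Prog
  | .init => (initCmd W c).compile
  | .insert => (updateCmd W c 0).compile
  | .delete => (updateCmd W c 1).compile
  | .contains => query (.member W c) 0
  | .choice => query (.next W c 0) 0
  | .iterReset => query 0 0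
  | .iterNext => query (.next W c (.reg 2)) (.nextPos W c (.reg 2))
  | .iterDone => query (.done W c (.reg 2)) 0

theorem testBit_words {w n base : ℕ} (hw : 1 ≤ w) (M : Mem w) (j : Fin (n + 1)) :
    (words base M (j / w)).testBit (j % w) = dictBits n base M j := by
  have h1 : (base * w + j) / w = base + j / w := by
    rw [add_comm, Nat.add_mul_div_right _ _ hw, add_comm]
  have h2 : (base * w + j) % w = j % w := by rw [add_comm, Nat.add_mul_mod_self_right]
  rw [dictBits, Mem.bit, h1, h2]
  rfl

theorem agree_of_dictBits_eq {w n base : ℕ} (hw : 1 ≤ w) {M M' : Mem w}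
    (h : dictBits n base M = dictBits n base M') : Agree w n (words base M) (words base M') := by
  have e : ∀ k m, m < w → k * w + m ≤ n →
      (words base M k).testBit m = (words base M' k).testBit m := fun k m hm hk => by
    have h1 := testBit_words (n := n) (base := base) hw M ⟨k * w + m, by omega⟩
    have h2 := testBit_words (n := n) (base := base) hw M' ⟨k * w + m, by omega⟩
    rw [← h, ← h1] at h2
    simp only [mul_add_div_of_lt hm, mul_add_mod_of_lt hm] at h2
    exact h2.symm
  have hn := Nat.div_add_mod' n w
  refine ⟨fun k hk => Nat.eq_of_testBit_eq fun m => ?_, fun m hm => ?_⟩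
  · rcases Nat.lt_or_ge m w with h1 | h1
    · have h2 : (k + 1) * w ≤ n / w * w := Nat.mul_le_mul_right _ hk
      rw [add_mul] at h2
      exact e k m h1 (by omega)
    · rw [Nat.testBit_lt_two_pow ((words_lt _ _).trans_le (Nat.pow_le_pow_right (by omega) h1)),
        Nat.testBit_lt_two_pow ((words_lt _ _).trans_le (Nat.pow_le_pow_right (by omega) h1))]
  · exact e _ m (hm.trans_lt (Nat.mod_lt _ hw)) (by omega)

/-- The dictionary bits `B` and the iteration state `σ` represent the state `q`. -/
def Rep (w n base : ℕ) (B : Fin (n + 1) → Bool) (σ : BitVec (iterBits n)) (q : State) : Prop :=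
  ∃ M : Mem w, dictBits n base M = B ∧ RepWords w n (words base M) σ.toNat q

/-- `Rep` asks for some memory with the given bits; by `agree_of_dictBits_eq` the choice is
immaterial, so the actual memory will do. -/
theorem rep_dictBits {w n base : ℕ} (hw : 1 ≤ w) {M : Mem w} {σ : BitVec (iterBits n)}
    {q : State} :
    Rep w n base (dictBits n base M) σ q ↔ RepWords w n (words base M) σ.toNat q :=
  ⟨fun ⟨_, h1, h2⟩ => (agree_of_dictBits_eq hw h1).repWords h2, fun h => ⟨M, rfl, h⟩⟩

/-- On a machine with the approximation `s` of `√w`, the expression `Expr.log W c` computes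
logarithms of powers of two. -/
def LogCorrect (W c : ℕ) {w : ℕ} (s : BitVec w) : Prop :=
  ∀ Γ : Ctx w, Γ.s = s → ∀ (x : Expr) (k : ℕ), k < w → x.val Γ = 2 ^ k →
    (Expr.log W c x).val Γ = k

theorem setup_callCtx {W c w n base : ℕ} {s : BitVec w} (hs : LogCorrect W c s) (hn : 1 ≤ n)
    (hlt : n < 2 ^ w) (hfit : base * w + (n + 1) ≤ 2 ^ w * w) (arg : ℕ) (M : Mem w) :
    Setup W c (callCtx s n base arg M) n base :=
  ⟨hn, hlt, hfit, rfl, rfl, fun x k hk hx => hs _ rfl x k hk hx⟩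

theorem val_callCtx_two {w n base arg : ℕ} {s : BitVec w} {M : Mem w} (h : arg < 2 ^ w) :
    (Expr.reg 2).val (callCtx s n base arg M) = arg := by
  change (BitVec.ofNat w arg).toNat = arg
  rw [BitVec.toNat_ofNat, Nat.mod_eq_of_lt h]

theorem iterState_lt {w n : ℕ} (hlt : n < 2 ^ w) (σ : BitVec (iterBits n)) :
    σ.toNat < 2 ^ w :=
  σ.isLt.trans_le (Nat.pow_le_pow_right (by omega) (Nat.clog_le_of_le_pow hlt))

/-- The states that occur after a reset are the `n + 1` positions `0, …, n`, which is why `⌈log₂ (n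
+ 1)⌉` bits suffice. -/
theorem exists_iterState_eq {n y : ℕ} (hy : y ≤ n) : ∃ σ : BitVec (iterBits n), y = σ.toNat := by
  refine ⟨BitVec.ofNat _ y, ?_⟩
  rw [BitVec.toNat_ofNat, Nat.mod_eq_of_lt]
  exact (Nat.lt_succ_of_le hy).trans_le (Nat.le_pow_clog (by omega) _)

theorem exists_realizes_code (W c : ℕ) : ∃ T, ∀ {w : ℕ} (n base : ℕ) (s : BitVec w),
    LogCorrect W c s → 1 ≤ n → n < 2 ^ w → base * w + (n + 1) ≤ 2 ^ w * w →
    Realizes (code W c) T s n base := by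
  obtain ⟨T₁, h₁⟩ := call_compile (initCmd W c)
  obtain ⟨T₂, h₂⟩ := call_compile (updateCmd W c 0)
  obtain ⟨T₃, h₃⟩ := call_compile (updateCmd W c 1)
  obtain ⟨T₄, h₄⟩ := call_query (.member W c) 0
  obtain ⟨T₅, h₅⟩ := call_query (.next W c 0) 0
  obtain ⟨T₆, h₆⟩ := call_query 0 0
  obtain ⟨T₇, h₇⟩ := call_query (.next W c (.reg 2)) (.nextPos W c (.reg 2))
  obtain ⟨T₈, h₈⟩ := call_query (.done W c (.reg 2)) 0
  refine ⟨T₁ + T₂ + T₃ + T₄ + T₅ + T₆ + T₇ + T₈, fun {w} n base s hs hn hlt hfit => ?_⟩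
  have hset := setup_callCtx hs hn hlt hfit
  have hw : 1 ≤ w := (hset 0 fun _ => 0).one_le_wordLen
  refine ⟨Rep w n base, fun M a => ?_, fun M σ q hq => ?_⟩
  · obtain ⟨ho, hr⟩ := (hset a M).initCmd_spec
    exact (h₁ s n base a M _ ho fun _ _ σ => (rep_dictBits hw).2 (hr _)).mono (by omega)
  have hr := (rep_dictBits hw).1 hq
  have hb := hr.1.barrier_le
  have hA := words_lt (base := base) M
  have hσ := val_callCtx_two (n := n) (base := base) (s := s) (M := M) (iterState_lt hlt σ)
  refine ⟨fun l hl => ?_, fun a => ⟨?_, ?_⟩, ?_, ?_⟩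
  · have e2 : (Expr.reg 2).val (callCtx s n base l M) = l :=
      val_callCtx_two ((Finset.mem_Icc.1 hl).2.trans_lt hlt)
    obtain ⟨ho₁, hr₁⟩ := (hset l M).updateCmd_spec (b := false) (e := 0) Expr.val_zero hl e2 hr
    obtain ⟨ho₂, hr₂⟩ := (hset l M).updateCmd_spec (b := true) (e := 1) (Expr.val_one hw) hl e2 hr
    refine ⟨?_, ?_, ?_⟩
    · exact (h₂ s n base l M _ ho₁ fun _ _ => (rep_dictBits hw).2 hr₁).mono (by omega)
    · exact (h₃ s n base l M _ ho₂ fun _ _ => (rep_dictBits hw).2 hr₂).mono (by omega)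
    · exact (h₄ s n base l M _
        ⟨(hset l M).val_member_of_repWords hl e2 hr, hq⟩).mono (by omega)
  · refine (h₅ s n base a M _ ⟨hr.choice hw hA ?_, hq⟩).mono (by omega)
    have e := (hset a M).val_next hb 0
    rwa [Expr.val_zero] at e
  · obtain ⟨σ₀, h0⟩ := exists_iterState_eq (Nat.zero_le n)
    refine (h₆ s n base a M _ ⟨σ₀, ?_, (rep_dictBits hw).2 (h0 ▸ hr.reset)⟩).mono (by omega)
    rw [← h0]
    exact Expr.val_zero
  · have e₁ := (hset σ.toNat M).val_next hb (.reg 2)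
    have e₂ := (hset σ.toNat M).val_nextPos hb (.reg 2)
    rw [hσ] at e₁ e₂
    obtain ⟨q', hn', hr'⟩ := hr.next hw hA e₁ e₂
    obtain ⟨σ', hσ'⟩ : ∃ σ' : BitVec (iterBits n),
        (Expr.nextPos W c (.reg 2)).val (callCtx s n base σ.toNat M) = σ'.toNat := by
      rw [e₂]
      split_ifs with h1
      · exact exists_iterState_eq h1
      · exact ⟨σ, rfl⟩
    rw [hσ'] at hr'
    exact (h₇ s n base _ M _ ⟨σ', hσ', q', hn', (rep_dictBits hw).2 hr'⟩).mono (by omega)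
  · have e := (hset σ.toNat M).val_done hb (.reg 2)
    rw [hσ] at e
    exact (h₈ s n base _ M _ ⟨hr.done hw hA e, hq⟩).mono (by omega)

end ChoiceDict

theorem mainTheorem3 (C : ℝ) :
    ∃ (code : ChoiceDict.Op → WordRAM.Prog) (T R : ℕ),
      (∀ op, (code op).registers.card ≤ R) ∧
      ∀ (w n base : ℕ) (s : BitVec w),
        1 ≤ n → n < 2 ^ w →
        base * w + (n + 1) ≤ 2 ^ w * w →
        Real.sqrt w ≤ C * s.toNat → (s.toNat : ℝ) ≤ C * Real.sqrt w →
        ChoiceDict.Realizes code T s n base := by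
  obtain ⟨W, c, hlog⟩ := ChoiceDict.exists_val_log C
  obtain ⟨T, hT⟩ := ChoiceDict.exists_realizes_code W c
  let r (op : ChoiceDict.Op) : ℕ := (ChoiceDict.code W c op).registers.card
  refine ⟨ChoiceDict.code W c, T, r .init + r .insert + r .delete + r .contains + r .choice +
    r .iterReset + r .iterNext + r .iterDone, fun op => ?_, ?_⟩
  · change r op ≤ _
    cases op <;> omega
  · intro w n base s hn hlt hfit h1 h2
    have hw : 1 ≤ w := by
      rcases Nat.eq_zero_or_pos w with rfl | hw
      · rw [pow_zero] at hlt
        omega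
      · exact hw
    exact hT n base s (fun Γ hΓ x k hk hx =>
      hlog Γ hw (by rw [hΓ]; exact h1) (by rw [hΓ]; exact h2) x k hk hx) hn hlt hfit
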